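/- Let $S\subset\mathbb R^2$ be an open set, $I=(-\tfrac12,\tfrac12)$, $\Omega=S\times I$, $x=(x',x_3)$ with $x'=(x_1,x_2)$, and write $\nabla_h v=(\nabla' v\,|\,\tfrac1h\partial_3 v)$ with $\nabla'=(\partial_1,\partial_2)$. Let $Y^d=[0,1)^d$ and let $\mathcal Y^d$ be $Y^d$ with the topology of the torus; write $y=(y',y_3)\in Y^3$. For $\varepsilon_1(h),\varepsilon_2(h)>0$, a sequence $(v^{h})$, $h\to0$, bounded in $L^2(\Omega)$, two-scale converges to $V\in L^2(\Omega\times Y^3)$ if $$\lim_{h\to0}\int_\Omega v^h(x)\,\psi\Bigl(x,\tfrac{x'}{\varepsilon_1(h)},\tfrac{x_3}{\varepsilon_2(h)}\Bigr)dx=\iint_{\Omega\times Y^3}V(x,y)\,\psi(x,y)\,dy\,dx\qquad\text{for all }\psi\in C_0^\infty(\Omega;C(\mathcal Y^3));$$ for matrix fields this is understood componentwise. Let $(u^h)_{h>0}$ converge weakly in $H^1(\Omega;\mathbb R^3)$ to $u$ as $h\to0$, and let $(\|\nabla_hu^h\|_{L^2(\Omega)})_{h>0}$ be bounded. Then $u$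 is independent of $x_3$: there is $u^0\in H^1(S;\mathbb R^3)$ with $u(x)=u^0(x')$ for a.e. $x\in\Omega$. Moreover: 1. Suppose that $\varepsilon_1(h)=h^{\alpha+1}$ and $\varepsilon_2(h)=h^\alpha$ for some $\alpha>0$. Then every sequence of $h>0$ tending to $0$ has a subsequence for which there are $u^1\in L^2(\Omega;\mathbb R^3)$ with weak derivative $\partial_{x_3}u^1\in L^2(\Omega;\mathbb R^3)$, and $u^2\in L^2(\Omega;H^1(\mathcal Y^3;\mathbb R^3))$, such that along it $\nabla_hu^h$ two-scale converges to $$(\nabla'u^0\,|\,\partial_{x_3}u^1)+\nabla_yu^2 .$$ 2. Suppose that $\varepsilon_1(h),\varepsilon_2(h)>0$, $\lim_{h\to0}h/\varepsilon_1(h)=1$ and $\lim_{h\to0}\varepsilon_2(h)=0$. Then every sequence of $h>0$ tending to $0$ has a subsequence for which there are $u^1\in L^2(\Omega;H^1(\mathcal Y^2;\mathbb R^3))$ with weak derivative $\partial_{x_3}u^1\in L^2(\Omega\times Y^2;\mathbb R^3)$, and $d\in L^2(\Omega\times Y^3;\mathbb R^3)$ with $\int_0^1 d(x,y',y_3)\,dy_3=0$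 for a.e. $(x,y')\in\Omega\times Y^2$, such that along it $\nabla_hu^h$ two-scale converges to $$(\nabla'u^0\,|\,0)+(\nabla_{y'}u^1\,|\,\partial_{x_3}u^1)+(0\,|\,0\,|\,d).$$ -/

import Mathlib

open MeasureTheory Filter Topology Set
open scoped ContDiff

namespace ThinPlate

/-- Points `x' = (x₁, x₂)` of the plane. (Only the linear structure, the topology and Lebesgue
measure of the spaces of points are used below.) -/
abbrev Plane : Type := Fin 2 → ℝ

/-- Points `x = (x', x₃)` of three-dimensional space. -/
abbrev Space : Type := Plane × ℝ

/-- The canonical basis of the plane. -/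
def e2 : Fin 2 → Plane := fun i => Pi.single i 1

/-- The canonical basis of space. -/
def e3 : Fin 3 → Space := ![(e2 0, 0), (e2 1, 0), (0, 1)]

/-- `Ω = S × (-1/2, 1/2)`. -/
def plate (S : Set Plane) : Set Space := S ×ˢ Ioo (-(1 / 2) : ℝ) (1 / 2)

/-- The periodicity cell `Y² = [0,1)²`. -/
def cell2 : Set Plane := Set.pi univ fun _ => Ico (0 : ℝ) 1

/-- The periodicity cell `Y³ = [0,1)³`. -/
def cell3 : Set Space := cell2 ×ˢ Ico (0 : ℝ) 1

/-- The torus `𝒴³ = 𝒴² × 𝒴¹`. -/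
abbrev Torus3 : Type := UnitAddTorus (Fin 2) × UnitAddCircle

/-- The projection of space onto the torus. -/
def toTorus (y : Space) : Torus3 := (fun i => (y.1 i : UnitAddCircle), (y.2 : UnitAddCircle))

section Sobolev

variable {E : Type} [NormedAddCommGroup E] [NormedSpace ℝ E] [MeasureSpace E]

/-- `g` is the weak derivative of `f` in the direction `v` on the open set `U`. -/
def HasWeakDeriv (U : Set E) (v : E) (f g : E → ℝ) : Prop :=
  ∀ φ : E → ℝ, ContDiff ℝ ∞ φ → HasCompactSupport φ → tsupport φ ⊆ U →
    ∫ x in U, f x * fderiv ℝ φ x v = -∫ x in U, g x * φ x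

/-- `f ∈ H¹(U; ℝ³)`, with weak gradient `Df`; `Df x i j` is the derivative of the
component `i` in the direction of the basis vector `e j`. -/
structure IsH1 {d : ℕ} (e : Fin d → E) (U : Set E)
    (f : E → Fin 3 → ℝ) (Df : E → Fin 3 → Fin d → ℝ) : Prop where
  memLp : ∀ i, MemLp (fun x => f x i) 2 (volume.restrict U)
  memLp_grad : ∀ i j, MemLp (fun x => Df x i j) 2 (volume.restrict U)
  weak_grad : ∀ i j, HasWeakDeriv U (e j) (fun x => f x i) (fun x => Df x i j)

/-- `g` is the weak derivative in the direction `v`, on the torus, of the function that `f`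
defines on the cell `Y` of the lattice spanned by `e`: the test functions are the smooth
periodic functions. -/
def HasPeriodicWeakDeriv {d : ℕ} (e : Fin d → E) (Y : Set E) (v : E) (f g : E → ℝ) : Prop :=
  ∀ φ : E → ℝ, ContDiff ℝ ∞ φ → (∀ k y, φ (y + e k) = φ y) →
    ∫ y in Y, f y * fderiv ℝ φ y v = -∫ y in Y, g y * φ y

/-- `f ∈ H¹(𝒴; ℝ³)`, with weak gradient `Df`, where `𝒴` is the cell `Y` with the topology
of the torus. -/
structure IsPeriodicH1 {d : ℕ} (e : Fin d → E) (Y : Set E)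
    (f : E → Fin 3 → ℝ) (Df : E → Fin 3 → Fin d → ℝ) : Prop where
  memLp : ∀ i, MemLp (fun y => f y i) 2 (volume.restrict Y)
  memLp_grad : ∀ i j, MemLp (fun y => Df y i j) 2 (volume.restrict Y)
  weak_grad : ∀ i j, HasPeriodicWeakDeriv e Y (e j) (fun y => f y i) (fun y => Df y i j)

/-- `w ∈ L²(Ω; H¹(𝒴; ℝ³))`, with gradient `Dw = ∇_y w`. -/
structure IsL2PeriodicH1 {d : ℕ} (Ω : Set Space) (e : Fin d → E) (Y : Set E)
    (w : Space × E → Fin 3 → ℝ) (Dw : Space × E → Fin 3 → Fin d → ℝ) : Prop where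
  memLp : ∀ i, MemLp (fun p => w p i) 2 (volume.restrict (Ω ×ˢ Y))
  memLp_grad : ∀ i j, MemLp (fun p => Dw p i j) 2 (volume.restrict (Ω ×ˢ Y))
  slice : ∀ᵐ x ∂(volume.restrict Ω),
    IsPeriodicH1 e Y (fun y => w (x, y)) (fun y => Dw (x, y))

end Sobolev

/-- Inner product of `H¹(Ω; ℝ³)`, in terms of functions and their weak gradients. -/
noncomputable def innerH1 (Ω : Set Space) (f : Space → Fin 3 → ℝ)
    (Df : Space → Fin 3 → Fin 3 → ℝ) (g : Space → Fin 3 → ℝ)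
    (Dg : Space → Fin 3 → Fin 3 → ℝ) : ℝ :=
  (∫ x in Ω, ∑ i, f x i * g x i) + ∫ x in Ω, ∑ i, ∑ j, Df x i j * Dg x i j

/-- The family `(f h)_{h > 0}` converges to `g` weakly in `H¹(Ω; ℝ³)` as `h → 0`. -/
structure WeaklyConvergesH1 (Ω : Set Space) (f : ℝ → Space → Fin 3 → ℝ)
    (Df : ℝ → Space → Fin 3 → Fin 3 → ℝ) (g : Space → Fin 3 → ℝ)
    (Dg : Space → Fin 3 → Fin 3 → ℝ) : Prop where
  mem : ∀ h, 0 < h → IsH1 e3 Ω (f h) (Df h)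
  mem_lim : IsH1 e3 Ω g Dg
  tendsto : ∀ (v : Space → Fin 3 → ℝ) (Dv : Space → Fin 3 → Fin 3 → ℝ), IsH1 e3 Ω v Dv →
    Tendsto (fun h => innerH1 Ω (f h) (Df h) v Dv) (𝓝[>] 0) (𝓝 (innerH1 Ω g Dg v Dv))

/-- The matrix `(A | b)` with first two columns `A` and third column `b`. -/
def withCol (A : Fin 3 → Fin 2 → ℝ) (b : Fin 3 → ℝ) : Fin 3 → Fin 3 → ℝ :=
  fun i => ![A i 0, A i 1, b i]

/-- The scaled gradient `∇_h f = (∇' f | h⁻¹ ∂₃ f)`, where `Df` is the gradient of `f`. -/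
noncomputable def scaledGrad (h : ℝ) (Df : Space → Fin 3 → Fin 3 → ℝ) :
    Space → Fin 3 → Fin 3 → ℝ :=
  fun x => withCol (fun i => ![Df x i 0, Df x i 1]) (fun i => h⁻¹ * Df x i 2)

/-- The sequence `v n`, bounded in `L²(Ω)`, two-scale converges to `V ∈ L²(Ω × Y³)` with respect
to the scales `ε₁ n` (in-plane) and `ε₂ n` (transversal). The test functions are the elements
of `C₀^∞(Ω; C(𝒴³))`. -/
structure TwoScaleConverges (Ω : Set Space) (ε₁ ε₂ : ℕ → ℝ)
    (v : ℕ → Space → ℝ) (V : Space × Space → ℝ) : Prop where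
  memLp : ∀ n, MemLp (v n) 2 (volume.restrict Ω)
  bounded : ∃ C : ℝ, ∀ n, ∫ x in Ω, v n x ^ 2 ≤ C
  memLp_lim : MemLp V 2 (volume.restrict (Ω ×ˢ cell3))
  tendsto : ∀ ψ : Space → C(Torus3, ℝ),
    ContDiff ℝ ∞ ψ → HasCompactSupport ψ → tsupport ψ ⊆ Ω →
    Tendsto
      (fun n => ∫ x in Ω, v n x * ψ x (toTorus ((ε₁ n)⁻¹ • x.1, (ε₂ n)⁻¹ * x.2)))
      atTop (𝓝 (∫ p in Ω ×ˢ cell3, V p * ψ p.1 (toTorus p.2)))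

/-- Two-scale convergence of matrix fields, defined componentwise. -/
def TwoScaleConvergesMatrix (Ω : Set Space) (ε₁ ε₂ : ℕ → ℝ)
    (G : ℕ → Space → Fin 3 → Fin 3 → ℝ) (V : Space × Space → Fin 3 → Fin 3 → ℝ) : Prop :=
  ∀ i j, TwoScaleConverges Ω ε₁ ε₂ (fun n x => G n x i j) (fun p => V p i j)

end ThinPlate

open ThinPlate

/-! Everything is read off from Fourier coefficients in the fast variable. With `a = 1/ε₁` and `b =
1/ε₂`, the characters of the torus become plane waves `exp (2πi (a k'·x' + b k₃ x₃))`. A bounded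
sequence in `L²(Ω)` acts with a uniform bound on `L²(Ω; C(𝒴³))`, so Banach–Alaoglu yields a
subsequence along which all pairings converge. Riesz representation gives amplitudes `c_k ∈ L²(Ω)`,
asymptotic orthogonality of the waves (Riemann–Lebesgue) gives a Bessel inequality for them, and
density of trigonometric polynomials (Stone–Weierstrass) identifies the limit with `∑ c_k(x)
e_k(y)`: see `exists_modes` and `exists_hasModes`. What remains is algebra between the amplitudes of
the entries of `∇_h u^h`.

Let `w` be a component of `u^h`, let `G` be its scaled gradient, and write `W(φ)`, `G_j(φ)` for
pairings with `φ` times the plane wave of mode `k`. Integration by parts (`ThinSequence.ibp`) gives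
`2πi a k_j W(φ) = -G_j(φ) - W(∂_j φ)` for the two planar directions, and `2πi b k₃ W(φ) = -h G₃(φ) -
W(∂₃φ)`. The right-hand sides stay bounded, so `W → 0` whenever `k ≠ 0`.

First regime: `b = h a`, so after division of the third identity by `h` all three frequencies are `a
k_j`. Eliminating `W(φ)` gives `k_i c_j = k_j c_i` in the limit: for `k ≠ 0` the amplitudes are
those of the `y`-gradient of `potential`. The zero mode of the planar columns is the weak limit
`∇'u⁰`. That of the third column is an unrestricted `L²` function of `x`, hence `∂₃u¹` for a
primitive `u¹`.

Second regime: `h a → 1`. If `k₃ ≠ 0`, the third identity makes `a W(φ)` of order `1/b`, so the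
planar amplitudes vanish, while those of the third column form `d`. If `k₃ = 0`, the planar
amplitudes are curl free in `y'`; the third identity becomes `W(∂₃φ) = -h G₃(φ)`, and the planar
identities tested with `∂₃φ` then show that the third amplitude is the `x₃`-derivative of the planar
potential. The zero mode of `u¹` is again a free primitive.

The sums are differentiated term by term in `y` by `WaveSystem.ae_hasPeriodicWeakDeriv` and in `x₃`
by `hasWeakDeriv_sum`. That `u` does not depend on `x₃` follows from `∂₃u^h = h · (bounded)`, and
`u⁰` is a weighted vertical mean of `u` (`exists_planar`). Weak convergence in `H¹` is used through
the bound on `u^h` and the weak convergence of gradients; both come from viewing `H¹` as a closed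
subspace of a product of `L²` spaces. -/

namespace ThinPlate

/-! ### Plane waves and their derivatives. -/

section PlaneWave

variable {E : Type*} [NormedAddCommGroup E] [NormedSpace ℝ E]

/-- The plane wave `y ↦ exp (2πi ℓ(y))`. -/
noncomputable def planeWave (l : E →L[ℝ] ℝ) (y : E) : ℂ :=
  Complex.exp (2 * Real.pi * Complex.I * (l y : ℝ))

lemma norm_planeWave (l : E →L[ℝ] ℝ) (y : E) : ‖planeWave l y‖ = 1 := by
  rw [planeWave, show (2 * Real.pi * Complex.I * (l y : ℝ) : ℂ)
    = ((2 * Real.pi * l y : ℝ) : ℂ) * Complex.I by push_cast; ring, Complex.norm_exp_ofReal_mul_I]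

lemma contDiff_planeWave (l : E →L[ℝ] ℝ) {n : WithTop ℕ∞} : ContDiff ℝ n (planeWave l) := by
  unfold planeWave
  have : ContDiff ℝ n (fun y => ((l y : ℝ) : ℂ)) := Complex.ofRealCLM.contDiff.comp l.contDiff
  exact (contDiff_const.mul this).cexp

lemma continuous_planeWave (l : E →L[ℝ] ℝ) : Continuous (planeWave l) :=
  (contDiff_planeWave l (n := 0)).continuous

lemma fderiv_planeWave (l : E →L[ℝ] ℝ) (y v : E) :
    fderiv ℝ (planeWave l) y v = 2 * Real.pi * Complex.I * (l v : ℝ) * planeWave l y := by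
  have h1 : HasFDerivAt (fun y => ((l y : ℝ) : ℂ)) (Complex.ofRealCLM.comp l) y :=
    (Complex.ofRealCLM.comp l).hasFDerivAt
  have h2 := (h1.const_mul (2 * Real.pi * Complex.I : ℂ)).cexp
  have h3 : fderiv ℝ (planeWave l) y = _ := h2.fderiv
  rw [h3]
  simp [planeWave]
  ring

lemma planeWave_add (l m : E →L[ℝ] ℝ) (y : E) :
    planeWave (l + m) y = planeWave l y * planeWave m y := by
  rw [planeWave, planeWave, planeWave, ← Complex.exp_add]
  congr 1
  simp
  ring

lemma planeWave_zero (y : E) : planeWave (0 : E →L[ℝ] ℝ) y = 1 := by simp [planeWave]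

lemma planeWave_neg (l : E →L[ℝ] ℝ) (y : E) :
    planeWave (-l) y = starRingEnd ℂ (planeWave l y) := by
  rw [planeWave, planeWave, ← Complex.exp_conj]
  congr 1
  simp only [map_mul, Complex.conj_I, Complex.conj_ofReal, neg_apply, map_ofNat]
  push_cast
  ring

lemma conj_planeWave_mul (l m : E →L[ℝ] ℝ) (y : E) :
    starRingEnd ℂ (planeWave l y) * planeWave m y = planeWave (m - l) y := by
  rw [sub_eq_add_neg, planeWave_add, planeWave_neg, mul_comm]

lemma planeWave_eq_fourierChar (l : E →L[ℝ] ℝ) (y : E) :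
    planeWave l y = (Real.fourierChar (l y) : ℂ) := by
  rw [Real.fourierChar_apply, planeWave]
  congr 1
  push_cast
  ring

lemma planeWave_add_int (l : E →L[ℝ] ℝ) (y v : E) (m : ℤ) (h : l v = m) :
    planeWave l (y + v) = planeWave l y := by
  rw [planeWave, planeWave, map_add, h]
  push_cast
  rw [mul_add, Complex.exp_add, show (2 * Real.pi * Complex.I * (m : ℂ)) = m * (2 * Real.pi * Complex.I) by ring,
    Complex.exp_int_mul_two_pi_mul_I, mul_one]

end PlaneWave

/-! ### Characters of the torus and their density. -/

section Modes

/-- The linear form `x' ↦ k · x'` on the plane. -/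
noncomputable def freq2 (k : Fin 2 → ℤ) : Plane →L[ℝ] ℝ :=
  ∑ i, (k i : ℝ) • ContinuousLinearMap.proj (R := ℝ) (φ := fun _ : Fin 2 => ℝ) i

lemma freq2_apply (k : Fin 2 → ℤ) (y : Plane) : freq2 k y = ∑ i, (k i : ℝ) * y i := by
  simp [freq2]

/-- The modes of the torus `𝒴³`. -/
abbrev Mode : Type := (Fin 2 → ℤ) × ℤ

/-- The linear form `x ↦ a k' · x' + b k₃ x₃`. -/
noncomputable def phase (a b : ℝ) (k : Mode) : Space →L[ℝ] ℝ :=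
  a • (freq2 k.1).comp (ContinuousLinearMap.fst ℝ Plane ℝ)
    + (b * k.2) • ContinuousLinearMap.snd ℝ Plane ℝ

lemma phase_apply (a b : ℝ) (k : Mode) (y : Space) :
    phase a b k y = a * (∑ i, (k.1 i : ℝ) * y.1 i) + b * k.2 * y.2 := by
  simp [phase, freq2_apply]

/-- The three entries of a mode. -/
def Mode.entry (k : Mode) : Fin 3 → ℤ := ![k.1 0, k.1 1, k.2]

lemma freq2_e2 (k : Fin 2 → ℤ) (j : Fin 2) : freq2 k (e2 j) = k j := by
  fin_cases j <;> simp [freq2_apply, e2]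

lemma phase_e3 (a b : ℝ) (k : Mode) (j : Fin 3) :
    phase a b k (e3 j) = ![a, a, b] j * k.entry j := by
  fin_cases j <;> simp [phase_apply, e3, e2, Mode.entry]

lemma phase_sub (a b : ℝ) (k l : Mode) : phase a b k - phase a b l = phase a b (k - l) := by
  ext y
  all_goals simp [phase_apply]
  all_goals ring

lemma Mode.exists_entry_ne_zero {k : Mode} (hk : k ≠ 0) : ∃ j, k.entry j ≠ 0 := by
  by_contra! h
  apply hk
  have h0 := h 0
  have h1 := h 1
  have h2 := h 2
  simp only [Mode.entry] at h0 h1 h2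
  ext i
  · fin_cases i
    · exact h0
    · exact h1
  · exact h2

/-- The characters of the torus `𝒴³`. -/
noncomputable def torusChar (k : Mode) : C(Torus3, ℂ) where
  toFun t := UnitAddTorus.mFourier k.1 t.1 * fourier k.2 t.2
  continuous_toFun := by fun_prop

/-- This identity turns a two-scale test function with a single mode into an oscillatory integral in
`x`. -/
lemma torusChar_toTorus (a b : ℝ) (k : Mode) (x : Space) :
    torusChar k (toTorus (a • x.1, b * x.2)) = planeWave (phase a b k) x := by
  simp only [torusChar, toTorus, UnitAddTorus.mFourier, ContinuousMap.coe_mk, fourier_coe_apply,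
    Fin.prod_univ_two, ← Complex.exp_add, planeWave, phase_apply, Fin.sum_univ_two]
  congr 1
  simp
  ring

lemma torusChar_toTorus' (k : Mode) (x : Space) :
    torusChar k (toTorus x) = planeWave (phase 1 1 k) x := by
  rw [← torusChar_toTorus]
  simp

lemma continuous_toTorus : Continuous toTorus := by
  unfold toTorus
  have h : Continuous (fun x : ℝ => (x : UnitAddCircle)) := AddCircle.continuous_mk' 1
  refine Continuous.prodMk (continuous_pi fun i => h.comp ?_) (h.comp continuous_snd)
  fun_prop

/-- Stone–Weierstrass: the characters are closed under products and conjugation, and the first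
characters of the three circles already separate points. -/
lemma span_torusChar_closure_eq_top :
    (Submodule.span ℂ (range torusChar)).topologicalClosure = ⊤ := by
  let A : StarSubalgebra ℂ C(Torus3, ℂ) :=
    { toSubalgebra := Algebra.adjoin ℂ (range torusChar)
      star_mem' := by
        change Algebra.adjoin ℂ (range torusChar) ≤ star (Algebra.adjoin ℂ (range torusChar))
        refine Algebra.adjoin_le ?_
        rintro _ ⟨n, rfl⟩
        refine Algebra.subset_adjoin ⟨-n, ?_⟩
        ext1 x
        simp [torusChar, UnitAddTorus.mFourier_neg] }
  have hA : A.toSubalgebra.toSubmodule = Submodule.span ℂ (range torusChar) := by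
    apply Algebra.adjoin_eq_span_of_subset
    refine .trans (fun x ↦ Submonoid.closure_induction (fun _ ↦ id) ⟨0, ?_⟩ ?_)
      Submodule.subset_span
    · ext z
      simp [torusChar, UnitAddTorus.mFourier_zero]
    · rintro _ _ _ _ ⟨m, rfl⟩ ⟨n, rfl⟩
      refine ⟨m + n, ?_⟩
      ext z
      simp only [torusChar, Prod.fst_add, Prod.snd_add, ContinuousMap.coe_mk,
        UnitAddTorus.mFourier_add, fourier_add, ContinuousMap.mul_apply]
      ring
  have hsep : A.SeparatesPoints := by
    intro x y hxy
    have hinj : Function.Injective (fun z : UnitAddCircle => (fourier 1 z : ℂ)) := by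
      intro z w hzw
      simp only [fourier_one] at hzw
      exact AddCircle.injective_toCircle one_ne_zero (Subtype.coe_injective hzw)
    by_cases h2 : x.2 = y.2
    · have h1 : x.1 ≠ y.1 := fun h => hxy (Prod.ext h h2)
      obtain ⟨i, hi⟩ := Function.ne_iff.1 h1
      refine ⟨_, ⟨torusChar (Pi.single i 1, 0), Algebra.subset_adjoin ⟨_, rfl⟩, rfl⟩, ?_⟩
      simp only [torusChar, ContinuousMap.coe_mk, UnitAddTorus.mFourier_single, fourier_zero,
        mul_one]
      exact fun h => hi (hinj h)
    · refine ⟨_, ⟨torusChar (0, 1), Algebra.subset_adjoin ⟨_, rfl⟩, rfl⟩, ?_⟩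
      simp only [torusChar, ContinuousMap.coe_mk, UnitAddTorus.mFourier_zero,
        ContinuousMap.one_apply, one_mul]
      exact fun h => h2 (hinj h)
  rw [← hA]
  exact congr_arg (Subalgebra.toSubmodule <| StarSubalgebra.toSubalgebra ·)
    (ContinuousMap.starSubalgebra_topologicalClosure_eq_top_of_separatesPoints A hsep)

end Modes

/-! ### Periodicity cells and integration by parts on them. -/

section Cells

lemma volume_cell2 : volume cell2 = 1 := by
  rw [cell2, volume_pi_pi]
  simp

lemma volume_cell3 : volume cell3 = 1 := by
  rw [cell3, Measure.volume_eq_prod, Measure.prod_prod, volume_cell2]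
  simp

instance : IsProbabilityMeasure (volume.restrict cell2) :=
  ⟨by rw [Measure.restrict_apply_univ, volume_cell2]⟩

instance : IsProbabilityMeasure (volume.restrict cell3) :=
  ⟨by rw [Measure.restrict_apply_univ, volume_cell3]⟩

lemma measurableSet_cell2 : MeasurableSet cell2 :=
  MeasurableSet.univ_pi fun _ => measurableSet_Ico

lemma measurableSet_cell3 : MeasurableSet cell3 := measurableSet_cell2.prod measurableSet_Ico

lemma cell2_ae_eq_Icc : cell2 =ᵐ[volume] Icc (0 : Plane) 1 :=
  Measure.univ_pi_Ico_ae_eq_Icc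

lemma cell3_subset_Icc : cell3 ⊆ Icc (0 : Space) 1 := by
  rintro ⟨y, s⟩ ⟨hy, hs⟩
  exact ⟨⟨fun i => (hy i trivial).1, hs.1⟩, ⟨fun i => (hy i trivial).2.le, hs.2.le⟩⟩

lemma cell2_subset_Icc : cell2 ⊆ Icc (0 : Plane) 1 :=
  fun _ hy => ⟨fun i => (hy i trivial).1, fun i => (hy i trivial).2.le⟩

lemma Continuous.integrableOn_cell2 {F : Type*} [NormedAddCommGroup F] {f : Plane → F}
    (hf : Continuous f) : IntegrableOn f cell2 :=
  (hf.continuousOn.integrableOn_compact isCompact_Icc).mono_set cell2_subset_Icc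

lemma isCompact_Icc_space : IsCompact (Icc (0 : Space) 1) := by
  rw [show (0 : Space) = (0, 0) from rfl, show (1 : Space) = (1, 1) from rfl, ← Icc_prod_Icc]
  exact isCompact_Icc.prod isCompact_Icc

lemma Continuous.integrableOn_cell3 {F : Type*} [NormedAddCommGroup F] {f : Space → F}
    (hf : Continuous f) : IntegrableOn f cell3 :=
  (hf.continuousOn.integrableOn_compact isCompact_Icc_space).mono_set cell3_subset_Icc

/-- Divergence theorem on the closed square, which differs from the cell by a null set, for the
field whose only nonzero component is the `j`-th, equal to `f`. Opposite faces differ by a period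
and cancel. -/
lemma integral_cell2_fderiv_eq_zero {f : Plane → ℂ} (hf : ContDiff ℝ 1 f)
    (hper : ∀ k y, f (y + e2 k) = f y) (j : Fin 2) :
    ∫ y in cell2, fderiv ℝ f y (e2 j) = 0 := by
  rw [setIntegral_congr_set cell2_ae_eq_Icc]
  have hd : Differentiable ℝ f := hf.differentiable one_ne_zero
  let L : ℂ →L[ℝ] (Fin 2 → ℂ) := ContinuousLinearMap.single ℝ (fun _ : Fin 2 => ℂ) j
  have hc : Continuous fun y => fderiv ℝ f y (e2 j) :=
    (hf.continuous_fderiv one_ne_zero).clm_apply continuous_const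
  have hsum : ∀ y, ∑ i, (L.comp (fderiv ℝ f y)) (Pi.single i 1) i = fderiv ℝ f y (e2 j) := by
    intro y
    rw [Finset.sum_eq_single j]
    · simp [L, e2]
    · intro i _ hi
      simp [L, hi]
    · simp
  have := integral_divergence_of_hasFDerivAt_off_countable (0 : Plane) 1 zero_le_one
    (fun y => L (f y)) (fun y => L.comp (fderiv ℝ f y)) ∅ countable_empty
    (L.continuous.comp hf.continuous).continuousOn
    (fun y _ => L.hasFDerivAt.comp y (hd y).hasFDerivAt)
    (by simp_rw [hsum]; exact hc.continuousOn.integrableOn_compact isCompact_Icc)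
  simp_rw [hsum] at this
  rw [this]
  refine Finset.sum_eq_zero fun i _ => ?_
  rw [sub_eq_zero]
  refine integral_congr_ae (Eventually.of_forall fun y => ?_)
  dsimp only
  have hins : i.insertNth ((1 : Plane) i) y = i.insertNth ((0 : Plane) i) y + e2 i := by
    ext l
    refine Fin.succAboveCases i ?_ (fun m => ?_) l
    · simp [e2]
    · simp [e2]
  rw [hins, hper]

/-- By Fubini the planar directions reduce to the square on each horizontal slice, and the vertical
one to the fundamental theorem of calculus on each vertical segment. -/
lemma integral_cell3_fderiv_eq_zero {f : Space → ℂ} (hf : ContDiff ℝ 1 f)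
    (hper : ∀ k y, f (y + e3 k) = f y) (j : Fin 3) :
    ∫ y in cell3, fderiv ℝ f y (e3 j) = 0 := by
  have hd : Differentiable ℝ f := hf.differentiable one_ne_zero
  have hc : ∀ v, Continuous fun y => fderiv ℝ f y v := fun v =>
    (hf.continuous_fderiv one_ne_zero).clm_apply continuous_const
  have hplane : ∀ i : Fin 2, ∫ y in cell3, fderiv ℝ f y (e2 i, 0) = 0 := by
    intro i
    have hInt := Continuous.integrableOn_cell3 (hc (e2 i, 0))
    rw [cell3, Measure.volume_eq_prod, IntegrableOn, ← Measure.prod_restrict] at hInt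
    rw [cell3, Measure.volume_eq_prod, ← Measure.prod_restrict, integral_prod_symm _ hInt]
    refine integral_eq_zero_of_ae (Eventually.of_forall fun s => ?_)
    have key := integral_cell2_fderiv_eq_zero (f := fun y' => f (y', s))
      (hf.comp (contDiff_id.prodMk contDiff_const)) (fun k y' => by
        have h := hper (Fin.castSucc k) (y', s)
        rw [← h]
        fin_cases k <;> simp [e3]) i
    rw [Pi.zero_apply, ← key]
    refine integral_congr_ae (Eventually.of_forall fun y' => ?_)
    have h1 : HasFDerivAt (fun y' : Plane => (y', s))
      (ContinuousLinearMap.inl ℝ Plane ℝ) y' := hasFDerivAt_prodMk_left y' s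
    have h2 := (hd (y', s)).hasFDerivAt.comp y' h1
    have h3 : fderiv ℝ (fun y' => f (y', s)) y' = _ := h2.fderiv
    simp [h3]
  have hlast : ∫ y in cell3, fderiv ℝ f y (0, 1) = 0 := by
    have hInt := Continuous.integrableOn_cell3 (hc (0, 1))
    rw [cell3, Measure.volume_eq_prod, IntegrableOn, ← Measure.prod_restrict] at hInt
    rw [cell3, Measure.volume_eq_prod, ← Measure.prod_restrict, integral_prod _ hInt]
    refine integral_eq_zero_of_ae (Eventually.of_forall fun y' => ?_)
    dsimp only
    rw [integral_Ico_eq_integral_Ioc, ← intervalIntegral.integral_of_le zero_le_one]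
    have hder : ∀ s, HasDerivAt (fun s => f (y', s)) (fderiv ℝ f (y', s) (0, 1)) s := by
      intro s
      have h1 : HasDerivAt (fun s : ℝ => (y', s)) ((0 : Plane), (1 : ℝ)) s :=
        (hasDerivAt_const s y').prodMk (hasDerivAt_id s)
      exact (hd (y', s)).hasFDerivAt.comp_hasDerivAt s h1
    rw [intervalIntegral.integral_eq_sub_of_hasDerivAt (fun s _ => hder s)
      (((hc (0, 1)).comp (by fun_prop : Continuous fun s : ℝ => (y', s))).intervalIntegrable _ _)]
    have h := hper 2 (y', 0)
    simp [e3] at h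
    simp [h]
  fin_cases j
  · exact hplane 0
  · exact hplane 1
  · exact hlast

/-- A periodicity cell `Y` of the lattice spanned by `e`: it has volume one, and derivatives of
periodic functions have mean zero over it. -/
structure IsCell {E : Type} [NormedAddCommGroup E] [NormedSpace ℝ E] [MeasureSpace E] {d : ℕ}
    (e : Fin d → E) (Y : Set E) : Prop where
  volume_eq : volume Y = 1
  measurableSet : MeasurableSet Y
  exists_compact : ∃ K, IsCompact K ∧ Y ⊆ K
  integrable : ∀ f : E → ℂ, Continuous f → IntegrableOn f Y
  integral_fderiv : ∀ f : E → ℂ, ContDiff ℝ 1 f → (∀ k y, f (y + e k) = f y) →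
    ∀ j, ∫ y in Y, fderiv ℝ f y (e j) = 0

lemma isCell_cell2 : IsCell e2 cell2 :=
  ⟨volume_cell2, measurableSet_cell2, ⟨_, isCompact_Icc, cell2_subset_Icc⟩, fun _ h => Continuous.integrableOn_cell2 h,
    fun _ h1 h2 j => integral_cell2_fderiv_eq_zero h1 h2 j⟩

lemma isCell_cell3 : IsCell e3 cell3 :=
  ⟨volume_cell3, measurableSet_cell3, ⟨_, isCompact_Icc_space, cell3_subset_Icc⟩, fun _ h => Continuous.integrableOn_cell3 h,
    fun _ h1 h2 j => integral_cell3_fderiv_eq_zero h1 h2 j⟩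

variable {E : Type} [NormedAddCommGroup E] [NormedSpace ℝ E] [MeasureSpace E] {d : ℕ}
  {e : Fin d → E} {Y : Set E}

/-- Up to the nonzero factor `2πi l(e j)`, the wave is its own derivative in the direction `e j`,
and derivatives of periodic functions have mean zero. -/
lemma IsCell.integral_planeWave (hY : IsCell e Y) {l : E →L[ℝ] ℝ}
    (hl : ∀ j, ∃ m : ℤ, l (e j) = m) {j : Fin d} (hj : l (e j) ≠ 0) :
    ∫ y in Y, planeWave l y = 0 := by
  have h := hY.integral_fderiv (planeWave l) (contDiff_planeWave l) (fun k y => by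
    obtain ⟨m, hm⟩ := hl k
    exact planeWave_add_int l y _ m hm) j
  simp_rw [fderiv_planeWave] at h
  rw [integral_const_mul] at h
  refine (mul_eq_zero.1 h).resolve_left ?_
  simp [Real.pi_ne_zero, hj]

lemma IsCell.integral_planeWave_mul_fderiv (hY : IsCell e Y) {l : E →L[ℝ] ℝ}
    (hl : ∀ j, ∃ m : ℤ, l (e j) = m) {φ : E → ℝ} (hφ : ContDiff ℝ ∞ φ)
    (hper : ∀ k y, φ (y + e k) = φ y) (j : Fin d) :
    ∫ y in Y, planeWave l y * (fderiv ℝ φ y (e j) : ℝ)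
      = -∫ y in Y, 2 * Real.pi * Complex.I * (l (e j) : ℝ) * planeWave l y * (φ y : ℝ) := by
  have hφ1 : ContDiff ℝ 1 φ := hφ.of_le (by exact_mod_cast le_top)
  have hφc : ContDiff ℝ 1 (fun y => (φ y : ℂ)) := Complex.ofRealCLM.contDiff.comp hφ1
  have h := hY.integral_fderiv (fun y => planeWave l y * (φ y : ℂ))
    ((contDiff_planeWave l).mul hφc) (fun k y => by
      obtain ⟨m, hm⟩ := hl k
      rw [planeWave_add_int l y _ m hm, hper]) j
  have hder : ∀ y, fderiv ℝ (fun y => planeWave l y * (φ y : ℂ)) y (e j)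
      = planeWave l y * (fderiv ℝ φ y (e j) : ℝ)
        + 2 * Real.pi * Complex.I * (l (e j) : ℝ) * planeWave l y * (φ y : ℝ) := by
    intro y
    have h1 : HasFDerivAt (fun y => (φ y : ℂ)) (Complex.ofRealCLM.comp (fderiv ℝ φ y)) y :=
      Complex.ofRealCLM.hasFDerivAt.comp y (hφ1.differentiable one_ne_zero y).hasFDerivAt
    have h2 : HasFDerivAt (planeWave l) (fderiv ℝ (planeWave l) y) y :=
      ((contDiff_planeWave l (n := 1)).differentiable one_ne_zero y).hasFDerivAt
    have h3 : fderiv ℝ (fun y => planeWave l y * (φ y : ℂ)) y = _ := (h2.mul h1).fderiv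
    rw [h3]
    simp [fderiv_planeWave]
    ring
  simp_rw [hder] at h
  rw [integral_add] at h
  · exact eq_neg_of_add_eq_zero_left h
  · refine hY.integrable _ ((continuous_planeWave l).mul (Complex.continuous_ofReal.comp ?_))
    exact (hφ1.continuous_fderiv one_ne_zero).clm_apply continuous_const
  · exact hY.integrable _ ((continuous_const.mul (continuous_planeWave l)).mul
      (Complex.continuous_ofReal.comp hφ.continuous))

end Cells

/-! ### Orthogonal series in `L²(μ × ν)` with amplitudes in `L²(μ)`. -/

section WaveSystem

variable {X Y : Type*} [MeasurableSpace X] [MeasurableSpace Y] {ι : Type*}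

/-- A family of functions of modulus one, orthogonal in `L²(ν)`. -/
structure WaveSystem (ι : Type*) (ν : Measure Y) where
  wave : ι → Y → ℂ
  stronglyMeasurable : ∀ k, StronglyMeasurable (wave k)
  norm_eq_one : ∀ k y, ‖wave k y‖ = 1
  orthogonal : ∀ k l, k ≠ l → ∫ y, starRingEnd ℂ (wave k y) * wave l y ∂ν = 0

variable {ν : Measure Y} [IsProbabilityMeasure ν] (χ : WaveSystem ι ν) (μ : Measure X)

lemma WaveSystem.memLp (k : ι) {a : X → ℂ} (ha : MemLp a 2 μ) :
    MemLp (fun p : X × Y => a p.1 * χ.wave k p.2) 2 (μ.prod ν) := by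
  have h : MemLp (fun p : X × Y => a p.1) 2 (μ.prod ν) :=
    ha.comp_measurePreserving measurePreserving_fst
  refine h.of_le (h.1.mul ((χ.stronglyMeasurable k).comp_measurable measurable_snd).aestronglyMeasurable)
    (Eventually.of_forall fun p => ?_)
  rw [norm_mul, χ.norm_eq_one, mul_one]

/-- The isometry `a ↦ a(x) χ_k(y)` of `L²(μ)` into `L²(μ × ν)`. -/
noncomputable def WaveSystem.tensor (k : ι) : Lp ℂ 2 μ →ₗᵢ[ℂ] Lp ℂ 2 (μ.prod ν) where
  toFun a := (χ.memLp μ k (Lp.memLp a)).toLp _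
  map_add' a b := by
    rw [← MemLp.toLp_add]
    refine MemLp.toLp_congr _ _ ?_
    have h := (measurePreserving_fst (μ := μ) (ν := ν)).quasiMeasurePreserving.ae
      (Lp.coeFn_add a b)
    filter_upwards [h] with p hp
    rw [hp]
    simp [add_mul]
  map_smul' r a := by
    simp only [RingHom.id_apply]
    rw [← MemLp.toLp_const_smul]
    refine MemLp.toLp_congr _ _ ?_
    have h := (measurePreserving_fst (μ := μ) (ν := ν)).quasiMeasurePreserving.ae
      (Lp.coeFn_smul r a)
    filter_upwards [h] with p hp
    simp [hp, mul_assoc]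
  norm_map' a := by
    simp only [LinearMap.coe_mk, AddHom.coe_mk]
    rw [Lp.norm_toLp, Lp.norm_def]
    congr 1
    rw [← eLpNorm_comp_measurePreserving (Lp.aestronglyMeasurable a)
      (measurePreserving_fst (μ := μ) (ν := ν))]
    refine eLpNorm_congr_norm_ae (Eventually.of_forall fun p => ?_)
    simp [χ.norm_eq_one]

lemma WaveSystem.coeFn_tensor (k : ι) (a : Lp ℂ 2 μ) :
    χ.tensor μ k a =ᵐ[μ.prod ν] fun p => a p.1 * χ.wave k p.2 :=
  MemLp.coeFn_toLp (χ.memLp μ k (Lp.memLp a))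

lemma WaveSystem.orthogonalFamily [SFinite μ] :
    OrthogonalFamily ℂ (fun _ : ι => Lp ℂ 2 μ) (χ.tensor μ) := by
  intro k l hkl a b
  rw [L2.inner_def]
  have : ∀ᵐ p ∂(μ.prod ν), inner ℂ (χ.tensor μ k a p) (χ.tensor μ l b p)
      = (starRingEnd ℂ (a p.1) * b p.1) * (starRingEnd ℂ (χ.wave k p.2) * χ.wave l p.2) := by
    filter_upwards [χ.coeFn_tensor μ k a, χ.coeFn_tensor μ l b] with p h1 h2
    rw [h1, h2, RCLike.inner_apply]
    simp
    ring
  rw [integral_congr_ae this, integral_prod_mul (fun x => starRingEnd ℂ (a x) * b x)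
    (fun y => starRingEnd ℂ (χ.wave k y) * χ.wave l y), χ.orthogonal k l hkl, mul_zero]

/-- The sum `∑ₖ cₖ(x) χ_k(y)` in `L²(μ × ν)`. -/
noncomputable def WaveSystem.sum (c : ι → Lp ℂ 2 μ) : Lp ℂ 2 (μ.prod ν) :=
  ∑' k, χ.tensor μ k (c k)

variable {μ}

lemma WaveSystem.hasSum [SFinite μ] {c : ι → Lp ℂ 2 μ} (hc : Summable fun k => ‖c k‖ ^ 2) :
    HasSum (fun k => χ.tensor μ k (c k)) (χ.sum μ c) :=
  (((χ.orthogonalFamily μ).summable_iff_norm_sq_summable c).2 hc).hasSum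

lemma WaveSystem.sum_add [SFinite μ] {c d : ι → Lp ℂ 2 μ} (hc : Summable fun k => ‖c k‖ ^ 2)
    (hd : Summable fun k => ‖d k‖ ^ 2) :
    χ.sum μ (fun k => c k + d k) = χ.sum μ c + χ.sum μ d := by
  rw [← ((χ.hasSum hc).add (χ.hasSum hd)).tsum_eq]
  simp [WaveSystem.sum]

lemma WaveSystem.sum_single [DecidableEq ι] (k : ι) (a : Lp ℂ 2 μ) :
    χ.sum μ (fun l => if l = k then a else 0) = χ.tensor μ k a := by
  rw [WaveSystem.sum, tsum_eq_single k]
  · simp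
  · intro l hl
    simp [hl]

lemma summable_sq_single [DecidableEq ι] (k : ι) (a : Lp ℂ 2 μ) :
    Summable fun l => ‖(if l = k then a else 0 : Lp ℂ 2 μ)‖ ^ 2 := by
  refine summable_of_ne_finset_zero (s := {k}) fun l hl => ?_
  simp [Finset.mem_singleton.not.1 hl]

/-- Orthogonality leaves only the term `k`. Amplitudes are thereby recovered from the sum, which is
how the limit functional is identified. -/
lemma WaveSystem.inner_sum_tensor [SFinite μ] {c : ι → Lp ℂ 2 μ} (hc : Summable fun k => ‖c k‖ ^ 2) (k : ι)
    (a : Lp ℂ 2 μ) : inner ℂ (χ.sum μ c) (χ.tensor μ k a) = inner ℂ (c k) a := by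
  have h := (χ.hasSum hc).mapL (innerSL ℂ (χ.tensor μ k a))
  have h2 : ∀ l, l ≠ k → (innerSL ℂ (χ.tensor μ k a)) (χ.tensor μ l (c l)) = 0 := fun l hl => by
    rw [innerSL_apply_apply]
    exact (χ.orthogonalFamily μ) (Ne.symm hl) _ _
  have h3 := h.unique (hasSum_single k h2)
  rw [innerSL_apply_apply, innerSL_apply_apply, LinearIsometry.inner_map_map] at h3
  rw [← inner_conj_symm, h3, inner_conj_symm]

end WaveSystem

/-! ### Evaluation of test functions with values in continuous functions. -/

section Eval

variable {X Z T : Type*} [MeasurableSpace X] [MeasurableSpace Z] [TopologicalSpace T]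
  [CompactSpace T] {μ : Measure X} {m : Measure Z} {π : Z → X} {q : Z → T}

/-- Pointwise the evaluation is at most the supremum norm of `ψ (π z)`, whatever `q` is. Hence the
bound on oscillating test functions is uniform in the scales. -/
lemma memLp_eval (hπ : MeasurePreserving π m μ) (hq : StronglyMeasurable q) {ψ : X → C(T, ℂ)}
    (hψ : MemLp ψ 2 μ) : MemLp (fun z => ψ (π z) (q z)) 2 m := by
  have h := hψ.comp_measurePreserving hπ
  refine h.norm.of_le ?_ (Eventually.of_forall fun z => ?_)
  · exact continuous_eval.comp_aestronglyMeasurable (h.1.prodMk hq.aestronglyMeasurable)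
  · simpa using (ψ (π z)).norm_coe_le_norm (q z)

/-- The evaluation `ψ ↦ (z ↦ ψ(π z)(q z))` from `L²(μ; C(T))` to `L²(m)`. -/
noncomputable def evalLp (hπ : MeasurePreserving π m μ) (hq : StronglyMeasurable q) :
    Lp C(T, ℂ) 2 μ →L[ℂ] Lp ℂ 2 m :=
  LinearMap.mkContinuous
    { toFun := fun ψ => (memLp_eval hπ hq (Lp.memLp ψ)).toLp _
      map_add' := fun a b => by
        rw [← MemLp.toLp_add]
        refine MemLp.toLp_congr _ _ ?_
        filter_upwards [hπ.quasiMeasurePreserving.ae (Lp.coeFn_add a b)] with p hp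
        rw [hp]
        simp
      map_smul' := fun r a => by
        simp only [RingHom.id_apply]
        rw [← MemLp.toLp_const_smul]
        refine MemLp.toLp_congr _ _ ?_
        filter_upwards [hπ.quasiMeasurePreserving.ae (Lp.coeFn_smul r a)] with p hp
        simp [hp] } 1 (fun ψ => by
    simp only [LinearMap.coe_mk, AddHom.coe_mk, one_mul]
    rw [Lp.norm_toLp, Lp.norm_def]
    refine ENNReal.toReal_mono (Lp.eLpNorm_ne_top ψ) ?_
    rw [← eLpNorm_comp_measurePreserving (Lp.aestronglyMeasurable ψ) hπ]
    exact eLpNorm_mono fun z => (ψ (π z)).norm_coe_le_norm (q z))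

lemma coeFn_evalLp (hπ : MeasurePreserving π m μ) (hq : StronglyMeasurable q)
    (ψ : Lp C(T, ℂ) 2 μ) : evalLp hπ hq ψ =ᵐ[m] fun z => ψ (π z) (q z) :=
  MemLp.coeFn_toLp (memLp_eval hπ hq (Lp.memLp ψ))

lemma norm_evalLp_le (hπ : MeasurePreserving π m μ) (hq : StronglyMeasurable q)
    (ψ : Lp C(T, ℂ) 2 μ) : ‖evalLp hπ hq ψ‖ ≤ ‖ψ‖ := by
  simpa using (evalLp hπ hq).le_of_opNorm_le (LinearMap.mkContinuous_norm_le _ zero_le_one _) ψ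

end Eval

/-! ### The characters as orthogonal systems on the two cells. -/

section Instances

variable {E : Type} [NormedAddCommGroup E] [NormedSpace ℝ E] [MeasureSpace E]
  [OpensMeasurableSpace E] {d : ℕ} {e : Fin d → E} {Y : Set E}

/-- The wave system of a family of integral linear forms that are separated by the lattice basis. -/
noncomputable def IsCell.waveSystem (hY : IsCell e Y) {ι : Type*} (l : ι → E →L[ℝ] ℝ)
    (hl : ∀ k j, ∃ m : ℤ, l k (e j) = m) (hinj : ∀ k k', k ≠ k' → ∃ j, l k (e j) ≠ l k' (e j)) :
    WaveSystem ι (volume.restrict Y) where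
  wave k := planeWave (l k)
  stronglyMeasurable k := (continuous_planeWave (l k)).stronglyMeasurable
  norm_eq_one k y := norm_planeWave (l k) y
  orthogonal k k' h := by
    simp_rw [conj_planeWave_mul]
    obtain ⟨j, hj⟩ := hinj k k' h
    refine hY.integral_planeWave (fun j => ?_) (j := j) ?_
    · obtain ⟨m, hm⟩ := hl k j
      obtain ⟨m', hm'⟩ := hl k' j
      exact ⟨m' - m, by simp [hm, hm']⟩
    · simpa [sub_eq_zero] using Ne.symm hj

lemma freq2_integral (k : Fin 2 → ℤ) (j : Fin 2) : ∃ m : ℤ, freq2 k (e2 j) = m :=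
  ⟨k j, freq2_e2 k j⟩

lemma phase_integral (k : Mode) (j : Fin 3) : ∃ m : ℤ, phase 1 1 k (e3 j) = m :=
  ⟨k.entry j, by rw [phase_e3]; fin_cases j <;> simp⟩

/-- The characters of the two-dimensional torus, on its cell. -/
noncomputable def waves2 : WaveSystem (Fin 2 → ℤ) (volume.restrict cell2) :=
  isCell_cell2.waveSystem freq2 freq2_integral fun k k' h => by
    obtain ⟨j, hj⟩ := Function.ne_iff.1 h
    exact ⟨j, by simpa [freq2_e2] using hj⟩

/-- The characters of the three-dimensional torus, on its cell. -/
noncomputable def waves3 : WaveSystem Mode (volume.restrict cell3) :=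
  isCell_cell3.waveSystem (phase 1 1) phase_integral fun k k' h => by
    obtain ⟨j, hj⟩ := Mode.exists_entry_ne_zero (sub_ne_zero.2 h)
    refine ⟨j, fun h0 => hj ?_⟩
    have h1 : phase 1 1 (k - k') (e3 j) = 0 := by
      rw [← phase_sub]
      simp [h0]
    rw [phase_e3] at h1
    have h2 : (![(1 : ℝ), 1, 1] j) = 1 := by fin_cases j <;> simp
    rw [h2, one_mul] at h1
    exact_mod_cast h1

lemma waves2_wave (k : Fin 2 → ℤ) : waves2.wave k = planeWave (freq2 k) := rfl

lemma waves3_wave (k : Mode) : waves3.wave k = planeWave (phase 1 1 k) := rfl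

end Instances

/-! ### Two-scale compactness through Fourier modes. -/

section Compactness

variable (μ : Measure Space)

/-- The evaluation `ψ ↦ ψ(x, y)` from `L²(μ; C(𝒴³))` to `L²(μ × Y³)`. -/
noncomputable def unfoldLp : Lp C(Torus3, ℂ) 2 μ →L[ℂ] Lp ℂ 2 (μ.prod (volume.restrict cell3)) :=
  evalLp (π := Prod.fst) (q := fun p : Space × Space => toTorus p.2) measurePreserving_fst
    (continuous_toTorus.comp continuous_snd).stronglyMeasurable

/-- The evaluation `ψ ↦ ψ(x, a x', b x₃)` from `L²(μ; C(𝒴³))` to `L²(μ)`. -/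
noncomputable def oscLp (a b : ℝ) : Lp C(Torus3, ℂ) 2 μ →L[ℂ] Lp ℂ 2 μ :=
  evalLp (π := id) (q := fun x : Space => toTorus (a • x.1, b * x.2)) (MeasurePreserving.id μ)
    (continuous_toTorus.comp (by fun_prop)).stronglyMeasurable

/-- The test functions `g(x) e_k(y)`. -/
noncomputable def modeTest (k : Mode) : Lp ℂ 2 μ →L[ℂ] Lp C(Torus3, ℂ) 2 μ :=
  (ContinuousLinearMap.toSpanSingleton ℂ (torusChar k)).compLpL 2 μ

variable {μ}

lemma coeFn_modeTest (k : Mode) (g : Lp ℂ 2 μ) :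
    modeTest μ k g =ᵐ[μ] fun x => g x • torusChar k :=
  ContinuousLinearMap.coeFn_compLpL _ g

lemma unfoldLp_modeTest (k : Mode) (g : Lp ℂ 2 μ) :
    unfoldLp μ (modeTest μ k g) = waves3.tensor μ k g := by
  refine Lp.ext ?_
  filter_upwards [coeFn_evalLp (π := Prod.fst) (q := fun p : Space × Space => toTorus p.2)
    (measurePreserving_fst (μ := μ) (ν := volume.restrict cell3))
    (continuous_toTorus.comp continuous_snd).stronglyMeasurable (modeTest μ k g),
    waves3.coeFn_tensor μ k g, (measurePreserving_fst (μ := μ)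
      (ν := volume.restrict cell3)).quasiMeasurePreserving.ae (coeFn_modeTest k g)] with p h1 h2 h3
  rw [unfoldLp, h1, h2, h3, waves3_wave]
  simp [torusChar_toTorus']

lemma coeFn_oscLp (a b : ℝ) (ψ : Lp C(Torus3, ℂ) 2 μ) :
    oscLp μ a b ψ =ᵐ[μ] fun x => ψ x (toTorus (a • x.1, b * x.2)) :=
  coeFn_evalLp _ _ ψ

lemma coeFn_oscLp_modeTest (a b : ℝ) (k : Mode) (g : Lp ℂ 2 μ) :
    oscLp μ a b (modeTest μ k g) =ᵐ[μ] fun x => g x * planeWave (phase a b k) x := by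
  filter_upwards [coeFn_oscLp a b (modeTest μ k g), coeFn_modeTest k g] with x h1 h2
  rw [h1, h2]
  simp [torusChar_toTorus]

lemma norm_oscLp_le (a b : ℝ) (ψ : Lp C(Torus3, ℂ) 2 μ) : ‖oscLp μ a b ψ‖ ≤ ‖ψ‖ :=
  norm_evalLp_le _ _ ψ

/-- A continuous functional on `L²(μ; C(𝒴³))` is determined by its values on modes. -/
lemma eq_zero_of_modeTest (L : Lp C(Torus3, ℂ) 2 μ →L[ℂ] ℂ)
    (h : ∀ k g, L (modeTest μ k g) = 0) (ψ : Lp C(Torus3, ℂ) 2 μ) : L ψ = 0 := by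
  induction ψ using Lp.induction (ENNReal.ofNat_ne_top (n := 2)) with
  | @indicatorConst c s hs hμs =>
    rw [Lp.simpleFunc.coe_indicatorConst]
    -- For fixed `s` of finite measure, `c ↦ L (1_s c)` is a continuous functional on `C(Torus3,
    -- ℂ)`. It vanishes on characters, whose span is dense.
    let M : C(Torus3, ℂ) →ₗ[ℂ] ℂ :=
      { toFun := fun c => L (indicatorConstLp 2 hs hμs.ne c)
        map_add' := fun c c' => by rw [← map_add, indicatorConstLp_add]
        map_smul' := fun r c => by
          rw [RingHom.id_apply, ← map_smul]
          congr 1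
          refine Lp.ext ?_
          filter_upwards [indicatorConstLp_coeFn (p := 2) (hs := hs) (hμs := hμs.ne) (c := r • c),
            Lp.coeFn_smul r (indicatorConstLp 2 hs hμs.ne c),
            indicatorConstLp_coeFn (p := 2) (hs := hs) (hμs := hμs.ne) (c := c)] with x h1 h2 h3
          rw [h1, h2, Pi.smul_apply, h3]
          by_cases hx : x ∈ s <;> simp [hx] }
    let M' : C(Torus3, ℂ) →L[ℂ] ℂ := M.mkContinuous (‖L‖ * μ.real s ^ (1 / (2 : ENNReal).toReal))
      fun c => by
        refine (L.le_opNorm _).trans ?_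
        rw [mul_assoc, mul_comm (_ ^ _)]
        gcongr
        exact norm_indicatorConstLp_le
    have hle : Submodule.span ℂ (range torusChar) ≤ M'.ker := by
      rw [Submodule.span_le]
      rintro _ ⟨k, rfl⟩
      change L (indicatorConstLp 2 hs hμs.ne (torusChar k)) = 0
      rw [← h k (indicatorConstLp 2 hs hμs.ne 1)]
      congr 1
      refine Lp.ext ?_
      filter_upwards [indicatorConstLp_coeFn (p := 2) (hs := hs) (hμs := hμs.ne)
        (c := torusChar k), coeFn_modeTest k (indicatorConstLp 2 hs hμs.ne (1 : ℂ)),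
        indicatorConstLp_coeFn (p := 2) (hs := hs) (hμs := hμs.ne) (c := (1 : ℂ))]
        with x h1 h2 h3
      rw [h1, h2, h3]
      by_cases hx : x ∈ s
      · simp [hx]
      · simp only [hx, not_false_eq_true, indicator_of_notMem]
        exact (zero_smul ℂ (torusChar k)).symm
    have htop := Submodule.topologicalClosure_minimal _ hle M'.isClosed_ker
    rw [span_torusChar_closure_eq_top] at htop
    exact htop (Submodule.mem_top (x := c))
  | add hf hg _ h1 h2 => rw [map_add, h1, h2, add_zero]
  | isClosed => exact isClosed_eq L.continuous continuous_const

/-- Riemann–Lebesgue lemma: if `k ≠ 0`, the linear forms `phase (a n) (b n) k` leave every compact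
set of the dual, since their value at some basis vector tends to infinity in absolute value. -/
lemma tendsto_integral_mul_planeWave {Ω : Set Space} (hΩ : MeasurableSet Ω) (f : Space → ℂ)
    {a b : ℕ → ℝ} (ha : Tendsto a atTop atTop) (hb : Tendsto b atTop atTop) {k : Mode}
    (hk : k ≠ 0) :
    Tendsto (fun n => ∫ x in Ω, f x * planeWave (phase (a n) (b n) k) x) atTop (𝓝 0) := by
  have hinf : Tendsto (fun n => -phase (a n) (b n) k) atTop (cocompact (StrongDual ℝ Space)) := by
    have : ProperSpace (StrongDual ℝ Space) := FiniteDimensional.proper ℝ _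
    rw [← Metric.cobounded_eq_cocompact, ← comap_norm_atTop, tendsto_comap_iff]
    obtain ⟨j, hj⟩ := Mode.exists_entry_ne_zero hk
    have h1 : ∀ n, |![a n, a n, b n] j| * |(k.entry j : ℝ)|
        ≤ (norm ∘ fun n => -phase (a n) (b n) k) n * ‖e3 j‖ := by
      intro n
      rw [← abs_mul, ← phase_e3, Function.comp_apply, norm_neg]
      exact (phase (a n) (b n) k).le_opNorm (e3 j)
    have h2 : Tendsto (fun n => |![a n, a n, b n] j| * |(k.entry j : ℝ)|) atTop atTop := by
      refine Tendsto.atTop_mul_const (by simpa using hj) (tendsto_abs_atTop_atTop.comp ?_)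
      fin_cases j
      · exact ha
      · exact ha
      · exact hb
    have h3 := tendsto_atTop_mono h1 h2
    have hpos : 0 < ‖e3 j‖ := by
      rw [norm_pos_iff]
      intro h0
      have := phase_e3 1 1 k j
      rw [h0, map_zero] at this
      have h2 : (![(1 : ℝ), 1, 1] j) = 1 := by fin_cases j <;> simp
      rw [h2, one_mul] at this
      exact hj (by exact_mod_cast this.symm)
    exact (tendsto_mul_const_atTop_of_pos hpos).1 h3
  have : (volume : Measure Space).IsAddHaarMeasure := by
    rw [Measure.volume_eq_prod]
    infer_instance
  have h := (tendsto_integral_exp_smul_cocompact (Ω.indicator f) volume).comp hinf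
  refine h.congr fun n => ?_
  rw [Function.comp_apply, ← integral_indicator hΩ]
  refine integral_congr_ae (Eventually.of_forall fun x => ?_)
  by_cases hx : x ∈ Ω
  · simp [hx, planeWave_eq_fourierChar, Circle.smul_def, mul_comm]
  · simp [hx]

/-- Asymptotic orthogonality, the source of the Bessel inequality: the two waves combine into the
wave of the mode `l - k`, which is constant or rapidly oscillating. -/
lemma tendsto_inner_oscLp_modeTest {Ω : Set Space} (hΩ : MeasurableSet Ω)
    (hμ : μ = volume.restrict Ω) {a b : ℕ → ℝ} (ha : Tendsto a atTop atTop)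
    (hb : Tendsto b atTop atTop) (k l : Mode) (f g : Lp ℂ 2 μ) :
    Tendsto (fun n => inner ℂ (oscLp μ (a n) (b n) (modeTest μ k f))
        (oscLp μ (a n) (b n) (modeTest μ l g))) atTop
      (𝓝 (if k = l then inner ℂ f g else 0)) := by
  have key : ∀ n, inner ℂ (oscLp μ (a n) (b n) (modeTest μ k f))
      (oscLp μ (a n) (b n) (modeTest μ l g))
      = ∫ x, inner ℂ (f x) (g x) * planeWave (phase (a n) (b n) (l - k)) x ∂μ := by
    intro n
    rw [L2.inner_def]
    refine integral_congr_ae ?_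
    filter_upwards [coeFn_oscLp_modeTest (a n) (b n) k f, coeFn_oscLp_modeTest (a n) (b n) l g]
      with x h1 h2
    rw [h1, h2, ← phase_sub, ← conj_planeWave_mul, RCLike.inner_apply, RCLike.inner_apply, map_mul]
    ring
  simp_rw [key]
  split_ifs with h
  · subst h
    have h0 : ∀ n x, planeWave (phase (a n) (b n) (k - k)) x = 1 := by
      intro n x
      rw [← phase_sub, sub_self, planeWave_zero]
    simp_rw [h0, mul_one, L2.inner_def]
    exact tendsto_const_nhds
  · have h0 := tendsto_integral_mul_planeWave hΩ (fun x => inner ℂ (f x) (g x)) ha hb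
      (sub_ne_zero.2 (Ne.symm h))
    rwa [← hμ] at h0

/-- Two-scale compactness: a bounded sequence in `L²` has a subsequence with a two-scale limit,
which is given by its modes. -/
theorem exists_modes {Ω : Set Space} (hΩ : MeasurableSet Ω) (hμ : μ = volume.restrict Ω)
    {a b : ℕ → ℝ} (ha : Tendsto a atTop atTop) (hb : Tendsto b atTop atTop)
    (V : ℕ → Lp ℂ 2 μ) {C : ℝ} (hV : ∀ n, ‖V n‖ ≤ C) :
    ∃ (κ : ℕ → ℕ) (c : Mode → Lp ℂ 2 μ), StrictMono κ ∧ (Summable fun k => ‖c k‖ ^ 2) ∧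
      ∀ ψ : Lp C(Torus3, ℂ) 2 μ,
        Tendsto (fun n => inner ℂ (V (κ n)) (oscLp μ (a (κ n)) (b (κ n)) ψ)) atTop
          (𝓝 (inner ℂ (waves3.sum μ c) (unfoldLp μ ψ))) := by
  have hsf : SFinite μ := by rw [hμ]; infer_instance
  -- Separability makes closed balls of the dual sequentially compact for the weak-* topology.
  have hsep : TopologicalSpace.SeparableSpace (Lp C(Torus3, ℂ) 2 μ) := by
    have : Fact ((2 : ENNReal) ≠ ⊤) := ⟨by simp⟩
    infer_instance
  let L : ℕ → StrongDual ℂ (Lp C(Torus3, ℂ) 2 μ) := fun n =>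
    (innerSL ℂ (V n)).comp (oscLp μ (a n) (b n))
  have hC0 : 0 ≤ C := (norm_nonneg _).trans (hV 0)
  have hL : ∀ n, ‖L n‖ ≤ C := by
    intro n
    refine ContinuousLinearMap.opNorm_le_bound _ hC0 fun ψ => ?_
    calc ‖inner ℂ (V n) (oscLp μ (a n) (b n) ψ)‖ ≤ ‖V n‖ * ‖oscLp μ (a n) (b n) ψ‖ :=
          norm_inner_le_norm _ _
      _ ≤ C * ‖ψ‖ := by gcongr; exacts [hV n, norm_oscLp_le _ _ _]
  obtain ⟨L0, -, κ, hκ, hlim⟩ := WeakDual.isSeqCompact_closedBall ℂ (Lp C(Torus3, ℂ) 2 μ) 0 C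
    (x := fun n => StrongDual.toWeakDual (L n)) (fun n => by simpa using hL n)
  have hlim' : ∀ ψ, Tendsto (fun n => inner ℂ (V (κ n)) (oscLp μ (a (κ n)) (b (κ n)) ψ)) atTop
      (𝓝 (L0 ψ)) := fun ψ => ((WeakDual.eval_continuous ψ).tendsto L0).comp hlim
  let L' : Lp C(Torus3, ℂ) 2 μ →L[ℂ] ℂ := WeakDual.toStrongDual L0
  let c : Mode → Lp ℂ 2 μ := fun k =>
    (InnerProductSpace.toDual ℂ (Lp ℂ 2 μ)).symm (L'.comp (modeTest μ k))
  have hc : ∀ k g, inner ℂ (c k) g = L0 (modeTest μ k g) := fun k g => by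
    rw [InnerProductSpace.toDual_symm_apply]
    rfl
  have haκ := ha.comp hκ.tendsto_atTop
  have hbκ := hb.comp hκ.tendsto_atTop
  have hbessel : ∀ s : Finset Mode, ∑ k ∈ s, ‖c k‖ ^ 2 ≤ C ^ 2 := by
    intro s
    -- With `σ = ∑ ‖c k‖ ^ 2` over `s`, both `⟨V, z⟩` and `⟨z, z⟩` tend to `σ`. Cauchy–Schwarz then
    -- gives `σ ^ 2 ≤ C ^ 2 * σ` in the limit.
    let z : ℕ → Lp ℂ 2 μ := fun n =>
      ∑ k ∈ s, oscLp μ (a (κ n)) (b (κ n)) (modeTest μ k (c k))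
    have h1 : Tendsto (fun n => inner ℂ (V (κ n)) (z n)) atTop
        (𝓝 (((∑ k ∈ s, ‖c k‖ ^ 2 : ℝ)) : ℂ)) := by
      simp_rw [z, inner_sum]
      rw [Complex.ofReal_sum]
      refine tendsto_finsetSum _ fun k _ => ?_
      have := hlim' (modeTest μ k (c k))
      rwa [← hc, inner_self_eq_norm_sq_to_K, ← RCLike.ofReal_pow] at this
    have h2 : Tendsto (fun n => inner ℂ (z n) (z n)) atTop
        (𝓝 (((∑ k ∈ s, ‖c k‖ ^ 2 : ℝ)) : ℂ)) := by
      simp_rw [z, inner_sum, sum_inner]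
      rw [Complex.ofReal_sum]
      refine tendsto_finsetSum _ fun k hk => ?_
      have := tendsto_finsetSum s fun l (_ : l ∈ s) =>
        tendsto_inner_oscLp_modeTest hΩ hμ haκ hbκ l k (c l) (c k)
      rw [Finset.sum_ite_eq' s k, if_pos hk, inner_self_eq_norm_sq_to_K, ← RCLike.ofReal_pow]
        at this
      exact this
    have h3 := (h1.norm.pow 2)
    have h4 := (h2.norm.const_mul (C ^ 2))
    have h5 := le_of_tendsto_of_tendsto' h3 h4 fun n => by
      rw [inner_self_eq_norm_sq_to_K, norm_pow, RCLike.norm_ofReal, abs_norm, ← mul_pow]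
      gcongr
      exact (norm_inner_le_norm _ _).trans (by gcongr; exact hV _)
    have hnn : 0 ≤ ∑ k ∈ s, ‖c k‖ ^ 2 := Finset.sum_nonneg fun k _ => by positivity
    rw [Complex.norm_real, Real.norm_of_nonneg hnn] at h5
    rcases hnn.eq_or_lt with h0 | hpos
    · rw [← h0]; positivity
    · rw [pow_two] at h5
      exact le_of_mul_le_mul_right h5 hpos
  have hsum : Summable fun k => ‖c k‖ ^ 2 :=
    summable_of_sum_le (fun k => by positivity) hbessel
  refine ⟨κ, c, hκ, hsum, fun ψ => ?_⟩
  have hzero := eq_zero_of_modeTest (L' - (innerSL ℂ (waves3.sum μ c)).comp (unfoldLp μ))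
    (fun k g => by
      have : (innerSL ℂ (waves3.sum μ c)).comp (unfoldLp μ) (modeTest μ k g)
        = inner ℂ (c k) g := by
        rw [ContinuousLinearMap.comp_apply, unfoldLp_modeTest, innerSL_apply_apply,
          waves3.inner_sum_tensor hsum]
      rw [sub_apply, this, hc]
      exact sub_self _) ψ
  rw [sub_apply, sub_eq_zero] at hzero
  have : inner ℂ (waves3.sum μ c) (unfoldLp μ ψ) = L0 ψ := hzero.symm
  rw [this]
  exact hlim' ψ

end Compactness

/-! ### Two-scale limits of real sequences and extraction of subsequences. -/

section TwoScale

/-- The pairing of `f` with the oscillating test function `φ(x) exp (2πi ℓ(x))`. -/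
noncomputable def oscIntegral (Ω : Set Space) (f φ : Space → ℝ) (l : Space →L[ℝ] ℝ) : ℂ :=
  ∫ x in Ω, (f x : ℂ) * φ x * planeWave l x

/-- The modes `c` of the two-scale limit of the sequence `v`, and the limit itself. -/
structure HasModes (Ω : Set Space) (ε₁ ε₂ : ℕ → ℝ) (v : ℕ → Space → ℝ)
    (c : Mode → Lp ℂ 2 (volume.restrict Ω)) : Prop where
  summable : Summable fun k => ‖c k‖ ^ 2
  tendsto_mode : ∀ k (φ : Space → ℝ), Continuous φ → HasCompactSupport φ →
    Tendsto (fun n => oscIntegral Ω (v n) φ (phase (ε₁ n)⁻¹ (ε₂ n)⁻¹ k)) atTop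
      (𝓝 (∫ x in Ω, starRingEnd ℂ (c k x) * φ x))
  twoScale : ∀ V : Space × Space → ℝ,
    V =ᵐ[volume.restrict (Ω ×ˢ cell3)] (fun p => (waves3.sum (volume.restrict Ω) c p).re) →
    TwoScaleConverges Ω ε₁ ε₂ v V

lemma TwoScaleConverges.comp {Ω : Set Space} {ε₁ ε₂ : ℕ → ℝ} {v : ℕ → Space → ℝ}
    {V : Space × Space → ℝ} (h : TwoScaleConverges Ω ε₁ ε₂ v V) {κ : ℕ → ℕ} (hκ : StrictMono κ) :
    TwoScaleConverges Ω (ε₁ ∘ κ) (ε₂ ∘ κ) (v ∘ κ) V where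
  memLp _ := h.memLp _
  bounded := h.bounded.imp fun _ hC _ => hC _
  memLp_lim := h.memLp_lim
  tendsto ψ h1 h2 h3 := (h.tendsto ψ h1 h2 h3).comp hκ.tendsto_atTop

lemma HasModes.comp {Ω : Set Space} {ε₁ ε₂ : ℕ → ℝ} {v : ℕ → Space → ℝ}
    {c : Mode → Lp ℂ 2 (volume.restrict Ω)} (h : HasModes Ω ε₁ ε₂ v c) {κ : ℕ → ℕ}
    (hκ : StrictMono κ) : HasModes Ω (ε₁ ∘ κ) (ε₂ ∘ κ) (v ∘ κ) c where
  summable := h.summable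
  tendsto_mode k φ h1 h2 := (h.tendsto_mode k φ h1 h2).comp hκ.tendsto_atTop
  twoScale V hV := (h.twoScale V hV).comp hκ

lemma volume_restrict_prod {E F : Type*} [MeasureSpace E] [MeasureSpace F]
    [SFinite (volume : Measure E)] [SFinite (volume : Measure F)] (s : Set E) (t : Set F) :
    (volume : Measure (E × F)).restrict (s ×ˢ t)
      = (volume.restrict s).prod (volume.restrict t) := by
  rw [Measure.volume_eq_prod, Measure.prod_restrict]

lemma norm_toLp_ofReal_sq {X : Type*} [MeasurableSpace X] {μ : Measure X} {f : X → ℝ}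
    (hf : MemLp (fun x => (f x : ℂ)) 2 μ) : ‖hf.toLp _‖ ^ 2 = ∫ x, f x ^ 2 ∂μ := by
  have h : ((‖hf.toLp _‖ ^ 2 : ℝ) : ℂ) = inner ℂ (hf.toLp _) (hf.toLp _) := by
    rw [inner_self_eq_norm_sq_to_K, ← RCLike.ofReal_pow]
    rfl
  rw [L2.inner_def] at h
  have h2 : ∫ x, inner ℂ (hf.toLp _ x) (hf.toLp _ x) ∂μ = ∫ x, ((f x ^ 2 : ℝ) : ℂ) ∂μ := by
    refine integral_congr_ae ?_
    filter_upwards [hf.coeFn_toLp] with x hx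
    rw [hx, RCLike.inner_apply, Complex.conj_ofReal]
    push_cast
    ring
  rw [h2, integral_complex_ofReal] at h
  exact_mod_cast h

/-- The complex compactness theorem is applied to the complexified sequence. Against real test
functions the integrals along the sequence are real, so taking real parts leaves them unchanged and
replaces the limit by the real part of the mode sum. -/
theorem exists_hasModes {Ω : Set Space} (hΩ : MeasurableSet Ω) {ε₁ ε₂ : ℕ → ℝ}
    (hε₁ : Tendsto ε₁ atTop (𝓝[>] 0)) (hε₂ : Tendsto ε₂ atTop (𝓝[>] 0)) {v : ℕ → Space → ℝ}
    (hv : ∀ n, MemLp (v n) 2 (volume.restrict Ω)) {C : ℝ} (hC : ∀ n, ∫ x in Ω, v n x ^ 2 ≤ C) :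
    ∃ (κ : ℕ → ℕ) (c : Mode → Lp ℂ 2 (volume.restrict Ω)), StrictMono κ ∧
      HasModes Ω (ε₁ ∘ κ) (ε₂ ∘ κ) (v ∘ κ) c := by
  have hvc : ∀ n, MemLp (fun x => (v n x : ℂ)) 2 (volume.restrict Ω) := fun n => (hv n).ofReal
  obtain ⟨κ, c, hκ, hsum, hlim⟩ := exists_modes hΩ rfl (tendsto_inv_nhdsGT_zero.comp hε₁)
    (tendsto_inv_nhdsGT_zero.comp hε₂) (fun n => (hvc n).toLp _) (C := Real.sqrt C) (fun n => by
      refine Real.le_sqrt_of_sq_le ?_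
      rw [norm_toLp_ofReal_sq]
      exact hC n)
  refine ⟨κ, c, hκ, hsum, fun k φ hφ hφc => ?_, fun V hV => ⟨fun n => hv _, ⟨C, fun n => hC _⟩,
    ?_, fun ψ hψ hψc _ => ?_⟩⟩
  · have hφ2 : MemLp (fun x => (φ x : ℂ)) 2 (volume.restrict Ω) :=
      (hφ.memLp_of_hasCompactSupport hφc).ofReal
    have h := hlim (modeTest _ k (hφ2.toLp _))
    rw [unfoldLp_modeTest, waves3.inner_sum_tensor hsum] at h
    have h2 : inner ℂ (c k) (hφ2.toLp _) = ∫ x in Ω, starRingEnd ℂ (c k x) * φ x := by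
      rw [L2.inner_def]
      refine integral_congr_ae ?_
      filter_upwards [hφ2.coeFn_toLp] with x hx
      rw [hx, RCLike.inner_apply, mul_comm]
    rw [h2] at h
    refine h.congr fun n => ?_
    rw [L2.inner_def, oscIntegral]
    refine integral_congr_ae ?_
    filter_upwards [hφ2.coeFn_toLp, (hvc (κ n)).coeFn_toLp, coeFn_oscLp_modeTest
      ((fun x => x⁻¹) ∘ ε₁ <| κ n) ((fun x => x⁻¹) ∘ ε₂ <| κ n) k (hφ2.toLp _)] with x h1 h2 h3
    rw [h2, h3, h1, RCLike.inner_apply, Complex.conj_ofReal]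
    simp only [Function.comp_apply]
    ring
  · refine MemLp.ae_eq hV.symm ?_
    rw [volume_restrict_prod]
    exact (Lp.memLp (waves3.sum (volume.restrict Ω) c)).re
  · let J : C(Torus3, ℝ) →L[ℝ] C(Torus3, ℂ) :=
      ContinuousLinearMap.compLeftContinuous ℝ Torus3 Complex.ofRealCLM
    have hJ : ∀ f t, J f t = (f t : ℂ) := fun f t => rfl
    have hψ2 : MemLp (fun x => J (ψ x)) 2 (volume.restrict Ω) :=
      (J.continuous.comp hψ.continuous).memLp_of_hasCompactSupport
        (hψc.comp_left (g := J) (map_zero J))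
    have h := (Complex.continuous_re.tendsto _).comp (hlim (hψ2.toLp _))
    have hre : (inner ℂ (waves3.sum (volume.restrict Ω) c)
        (unfoldLp (volume.restrict Ω) (hψ2.toLp _))).re
        = ∫ p in Ω ×ˢ cell3, V p * ψ p.1 (toTorus p.2) := by
      rw [volume_restrict_prod] at hV ⊢
      rw [L2.inner_def]
      have h1 := integral_re (L2.integrable_inner (𝕜 := ℂ) (waves3.sum (volume.restrict Ω) c)
        (unfoldLp (volume.restrict Ω) (hψ2.toLp _)))
      refine h1.symm.trans (integral_congr_ae ?_)
      filter_upwards [hV, coeFn_evalLp (π := Prod.fst)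
        (q := fun p : Space × Space => toTorus p.2)
        (measurePreserving_fst (μ := volume.restrict Ω) (ν := volume.restrict cell3))
        (continuous_toTorus.comp continuous_snd).stronglyMeasurable (hψ2.toLp _),
        (measurePreserving_fst (μ := volume.restrict Ω)
          (ν := volume.restrict cell3)).quasiMeasurePreserving.ae hψ2.coeFn_toLp] with p h1 h2 h3
      rw [unfoldLp, h2, h3, h1, hJ, RCLike.inner_apply]
      simp [mul_comm]
    rw [hre] at h
    refine h.congr fun n => ?_
    rw [Function.comp_apply, L2.inner_def, ← Complex.ofReal_re (∫ x in Ω, _), ← integral_complex_ofReal]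
    congr 1
    refine integral_congr_ae ?_
    filter_upwards [hψ2.coeFn_toLp, (hvc (κ n)).coeFn_toLp, coeFn_oscLp
      ((fun x => x⁻¹) ∘ ε₁ <| κ n) ((fun x => x⁻¹) ∘ ε₂ <| κ n) (hψ2.toLp _)] with x h1 h2 h3
    rw [h2, h3, h1, RCLike.inner_apply, Complex.conj_ofReal, hJ]
    simp [mul_comm]

/-- Successive extraction of subsequences for finitely many properties. -/
lemma exists_common_subsequence {ι : Type*} [Finite ι] (P : ι → (ℕ → ℕ) → Prop)
    (hex : ∀ i κ, StrictMono κ → ∃ l : ℕ → ℕ, StrictMono l ∧ P i (κ ∘ l))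
    (hsub : ∀ i κ (l : ℕ → ℕ), StrictMono l → P i κ → P i (κ ∘ l)) :
    ∃ κ, StrictMono κ ∧ ∀ i, P i κ := by
  classical
  have := Fintype.ofFinite ι
  suffices h : ∀ s : Finset ι, ∃ κ, StrictMono κ ∧ ∀ i ∈ s, P i κ by
    obtain ⟨κ, h1, h2⟩ := h Finset.univ
    exact ⟨κ, h1, fun i => h2 i (Finset.mem_univ i)⟩
  intro s
  induction s using Finset.induction_on with
  | empty => exact ⟨id, strictMono_id, by simp⟩
  | insert i s _ ih =>
    obtain ⟨κ, h1, h2⟩ := ih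
    obtain ⟨l, h3, h4⟩ := hex i κ h1
    refine ⟨κ ∘ l, h1.comp h3, fun j hj => ?_⟩
    rcases Finset.mem_insert.1 hj with rfl | hj
    · exact h4
    · exact hsub _ _ _ h3 (h2 j hj)

end TwoScale

/-! ### Slices of `L²` functions on products. -/

section Slices

lemma eLpNorm_two_sq {Z F : Type*} [MeasurableSpace Z] [NormedAddCommGroup F] (g : Z → F)
    (m : Measure Z) : eLpNorm g 2 m ^ 2 = ∫⁻ z, ‖g z‖ₑ ^ 2 ∂m := by
  have := eLpNorm_nnreal_pow_eq_lintegral (f := g) (μ := m) (p := 2) two_ne_zero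
  simpa using this

variable {X Y : Type*} [MeasurableSpace X] [MeasurableSpace Y] {μ : Measure X} {ν : Measure Y}

lemma lintegral_eLpNorm_slice_sq {F : Type*} [NormedAddCommGroup F] [SFinite ν] {f : X × Y → F}
    (hf : AEStronglyMeasurable f (μ.prod ν)) :
    ∫⁻ x, eLpNorm (fun y => f (x, y)) 2 ν ^ 2 ∂μ = eLpNorm f 2 (μ.prod ν) ^ 2 := by
  simp_rw [eLpNorm_two_sq]
  rw [lintegral_prod]
  exact hf.enorm.pow_const 2

lemma ae_memLp_slice {F : Type*} [NormedAddCommGroup F] [SFinite ν] {f : X × Y → F} (hf : MemLp f 2 (μ.prod ν)) :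
    ∀ᵐ x ∂μ, MemLp (fun y => f (x, y)) 2 ν := by
  have h := lintegral_eLpNorm_slice_sq hf.1
  have hm : AEMeasurable (fun x => eLpNorm (fun y => f (x, y)) 2 ν ^ 2) μ := by
    simp_rw [eLpNorm_two_sq]
    exact (hf.1.enorm.pow_const 2).lintegral_prod_right'
  have hlt := ae_lt_top' hm (by rw [h]; exact ENNReal.pow_ne_top hf.2.ne)
  filter_upwards [hlt, hf.1.prodMk_left] with x h1 h2
  refine ⟨h2, ?_⟩
  by_contra h3
  rw [not_lt, top_le_iff] at h3
  simp [h3] at h1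

/-- A convergent sequence in `L²(μ × ν)` has a subsequence whose slices converge in `L²(ν)`. -/
lemma exists_slice_subseq [SFinite ν] {f : ℕ → Lp ℂ 2 (μ.prod ν)} {g : Lp ℂ 2 (μ.prod ν)}
    (hf : Tendsto f atTop (𝓝 g)) :
    ∃ κ : ℕ → ℕ, StrictMono κ ∧ ∀ᵐ x ∂μ,
      Tendsto (fun n => eLpNorm (fun y => f (κ n) (x, y) - g (x, y)) 2 ν) atTop (𝓝 0) := by
  -- A geometric rate makes the squared slice norms summable after integration in `x`. For a.e. `x`
  -- their series is therefore finite and its terms tend to zero.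
  have h1 : ∀ n : ℕ, ∀ᶠ k in atTop, ‖f k - g‖ₑ ≤ (2⁻¹ : ENNReal) ^ n := by
    intro n
    have := tendsto_iff_edist_tendsto_0.1 hf
    have hpos : (0 : ENNReal) < 2⁻¹ ^ n := ENNReal.pow_pos (by simp) n
    have h2 := this.eventually (Iic_mem_nhds hpos)
    filter_upwards [h2] with k hk
    rwa [← edist_eq_enorm_sub]
  obtain ⟨κ, hκ, h2⟩ := extraction_forall_of_eventually h1
  refine ⟨κ, hκ, ?_⟩
  let G : ℕ → X → ENNReal := fun n x => eLpNorm (fun y => (f (κ n) - g) (x, y)) 2 ν ^ 2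
  have hG : ∀ n, AEMeasurable (G n) μ := by
    intro n
    simp_rw [G, eLpNorm_two_sq]
    exact ((Lp.aestronglyMeasurable (f (κ n) - g)).enorm.pow_const 2).lintegral_prod_right'
  have hsum : ∫⁻ x, ∑' n, G n x ∂μ ≠ ⊤ := by
    rw [lintegral_tsum hG]
    have hle : ∀ n, ∫⁻ x, G n x ∂μ ≤ (2⁻¹ : ENNReal) ^ n := by
      intro n
      simp_rw [G]
      rw [lintegral_eLpNorm_slice_sq (Lp.aestronglyMeasurable _), ← Lp.enorm_def]
      refine (pow_le_pow_left₀ (zero_le) (h2 n) 2).trans ?_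
      rw [← pow_mul]
      exact pow_le_pow_of_le_one zero_le (by simp [ENNReal.inv_le_one]) (by omega)
    refine ne_top_of_le_ne_top ?_ (ENNReal.tsum_le_tsum hle)
    rw [ENNReal.tsum_geometric]
    simp
  have hfin := ae_lt_top' (AEMeasurable.tsum hG) hsum
  have hsub : ∀ᵐ x ∂μ, ∀ n, ∀ᵐ y ∂ν, (f (κ n) - g) (x, y) = f (κ n) (x, y) - g (x, y) := by
    rw [ae_all_iff]
    intro n
    exact Measure.ae_ae_of_ae_prod (Lp.coeFn_sub (f (κ n)) g)
  filter_upwards [hfin, hsub] with x hx hx2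
  have h3 : Tendsto (fun n => G n x) atTop (𝓝 0) :=
    ENNReal.tendsto_atTop_zero_of_tsum_ne_top hx.ne
  have h4 := ((ENNReal.continuous_rpow_const (y := (1 / 2 : ℝ))).tendsto 0).comp h3
  rw [ENNReal.zero_rpow_of_pos (by norm_num)] at h4
  refine h4.congr fun n => ?_
  simp only [G, Function.comp_apply]
  rw [← ENNReal.rpow_natCast, ← ENNReal.rpow_mul, eLpNorm_congr_ae (hx2 n)]
  norm_num

/-- On a probability space convergence in `L²` implies convergence in `L¹`, and multiplication by a
bounded function preserves the latter. -/
lemma tendsto_integral_mul_of_eLpNorm [IsProbabilityMeasure ν] {h : ℕ → Y → ℂ} {h0 : Y → ℂ}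
    (hh : ∀ n, MemLp (h n) 2 ν) (hh0 : MemLp h0 2 ν)
    (hlim : Tendsto (fun n => eLpNorm (fun y => h n y - h0 y) 2 ν) atTop (𝓝 0)) {ψ : Y → ℂ}
    (hψ : AEStronglyMeasurable ψ ν) {M : ℝ} (hM : ∀ᵐ y ∂ν, ‖ψ y‖ ≤ M) :
    Tendsto (fun n => ∫ y, h n y * ψ y ∂ν) atTop (𝓝 (∫ y, h0 y * ψ y ∂ν)) := by
  have hInt : ∀ {k : Y → ℂ}, MemLp k 2 ν → Integrable (fun y => k y * ψ y) ν := fun hk =>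
    (hk.integrable one_le_two).mul_bdd hψ hM
  refine tendsto_integral_of_L1' _ (hInt hh0).1 (Eventually.of_forall fun n => hInt (hh n)) ?_
  have hle : ∀ n, eLpNorm ((fun y => h n y * ψ y) - fun y => h0 y * ψ y) 1 ν
      ≤ ENNReal.ofReal M * eLpNorm (fun y => h n y - h0 y) 2 ν := by
    intro n
    refine (eLpNorm_le_mul_eLpNorm_of_ae_le_mul (g := fun y => h n y - h0 y) (c := M) ?_ 1).trans ?_
    · filter_upwards [hM] with y hy
      rw [Pi.sub_apply, ← sub_mul, norm_mul, mul_comm]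
      gcongr
    · gcongr
      exact eLpNorm_le_eLpNorm_of_exponent_le one_le_two ((hh n).1.sub hh0.1)
  have hz : Tendsto (fun n => ENNReal.ofReal M * eLpNorm (fun y => h n y - h0 y) 2 ν) atTop
      (𝓝 0) := by
    simpa using ENNReal.Tendsto.const_mul hlim (Or.inr ENNReal.ofReal_ne_top)
  exact tendsto_of_tendsto_of_tendsto_of_le_of_le tendsto_const_nhds hz (fun _ => zero_le) hle

variable {ι : Type*} [Countable ι]

lemma WaveSystem.coeFn_partialSum [IsProbabilityMeasure ν] (χ : WaveSystem ι ν)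
    (c : ι → Lp ℂ 2 μ) (s : Finset ι) :
    (∑ k ∈ s, χ.tensor μ k (c k) : Lp ℂ 2 (μ.prod ν))
      =ᵐ[μ.prod ν] fun p => ∑ k ∈ s, c k p.1 * χ.wave k p.2 := by
  have h : ∀ᵐ p ∂(μ.prod ν), ∀ k, χ.tensor μ k (c k) p = c k p.1 * χ.wave k p.2 :=
    ae_all_iff.2 fun k => χ.coeFn_tensor μ k (c k)
  filter_upwards [h, Lp.coeFn_finsetSum s fun k => χ.tensor μ k (c k)] with p h1 h2
  rw [h2]
  simp [h1]

end Slices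

/-! ### Differentiation of mode sums in the fast variable. -/

section PeriodicDerivative

variable {E : Type} [NormedAddCommGroup E] [NormedSpace ℝ E] [MeasureSpace E]
  [OpensMeasurableSpace E] {d : ℕ} {e : Fin d → E} {Y : Set E}
  [IsProbabilityMeasure ((volume : Measure E).restrict Y)] {ι : Type*} [Countable ι]
  {X : Type*} [MeasurableSpace X] {μ : Measure X} [SFinite μ]

/-- Term by term differentiation of a sum of modes with respect to the periodic variable. -/
theorem WaveSystem.ae_hasPeriodicWeakDeriv (hY : IsCell e Y)
    (χ : WaveSystem ι ((volume : Measure E).restrict Y))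
    {l : ι → E →L[ℝ] ℝ} (hχ : ∀ k, χ.wave k = planeWave (l k))
    (hl : ∀ k j, ∃ m : ℤ, l k (e j) = m) {c c' : ι → Lp ℂ 2 μ}
    (hc : Summable fun k => ‖c k‖ ^ 2) (hc' : Summable fun k => ‖c' k‖ ^ 2) (j : Fin d)
    (hcc' : ∀ k, c' k = (2 * Real.pi * Complex.I * (l k (e j) : ℝ) : ℂ) • c k) :
    ∀ᵐ x ∂μ, HasPeriodicWeakDeriv e Y (e j) (fun y => (χ.sum μ c (x, y)).re)
      (fun y => (χ.sum μ c' (x, y)).re) := by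
  obtain ⟨s, hs⟩ := exists_seq_tendsto (atTop : Filter (Finset ι))
  have h1 := (χ.hasSum hc).comp hs
  have h2 := (χ.hasSum hc').comp hs
  obtain ⟨κ₁, hκ₁, hlim₁⟩ := exists_slice_subseq h1
  -- The second extraction runs along the first, so that one subsequence of partial sums serves both
  -- series.
  obtain ⟨κ₂, hκ₂, hlim₂⟩ := exists_slice_subseq (h2.comp hκ₁.tendsto_atTop)
  have hp : ∀ b : ι → Lp ℂ 2 μ, ∀ᵐ x ∂μ, ∀ n, ∀ᵐ y ∂(volume.restrict Y),
      (∑ k ∈ s n, χ.tensor μ k (b k) : Lp ℂ 2 (μ.prod (volume.restrict Y))) (x, y)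
        = ∑ k ∈ s n, b k x * χ.wave k y := fun b => by
    rw [ae_all_iff]
    exact fun n => Measure.ae_ae_of_ae_prod (χ.coeFn_partialSum b (s n))
  have hm : ∀ b : ι → Lp ℂ 2 μ, ∀ᵐ x ∂μ, ∀ n, MemLp (fun y =>
      (∑ k ∈ s n, χ.tensor μ k (b k) : Lp ℂ 2 (μ.prod (volume.restrict Y))) (x, y)) 2
      (volume.restrict Y) := fun b => by
    rw [ae_all_iff]
    exact fun n => ae_memLp_slice (Lp.memLp _)
  have hcc'x : ∀ᵐ x ∂μ, ∀ k, c' k x = (2 * Real.pi * Complex.I * (l k (e j) : ℝ) : ℂ) * c k x := by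
    rw [ae_all_iff]
    intro k
    rw [hcc' k]
    filter_upwards [Lp.coeFn_smul (2 * Real.pi * Complex.I * (l k (e j) : ℝ) : ℂ) (c k)] with x hx
    rw [hx]
    simp
  -- The exceptional set of `x` is fixed before `φ` is introduced, so it does not depend on the test
  -- function.
  filter_upwards [hlim₁, hlim₂, hp c, hp c', hm c, hm c', ae_memLp_slice (Lp.memLp (χ.sum μ c)),
    ae_memLp_slice (Lp.memLp (χ.sum μ c')), hcc'x] with x a1 a2 p1 p2 m1 m2 w1 w2 hx φ hφ hper
  obtain ⟨K, hK, hYK⟩ := hY.exists_compact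
  have hbd : ∀ ψ : E → ℝ, Continuous ψ → ∃ M, ∀ᵐ y ∂(volume.restrict Y), ‖(ψ y : ℂ)‖ ≤ M := by
    intro ψ hψ
    obtain ⟨M, hM⟩ := hK.exists_bound_of_continuousOn hψ.continuousOn
    refine ⟨M, (ae_restrict_iff' hY.measurableSet).2 (Eventually.of_forall fun y hy => ?_)⟩
    rw [Complex.norm_real]
    exact hM y (hYK hy)
  have hcφ : Continuous fun y => fderiv ℝ φ y (e j) :=
    (hφ.continuous_fderiv (by simp)).clm_apply continuous_const
  obtain ⟨M₁, hM₁⟩ := hbd _ hcφ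
  obtain ⟨M₂, hM₂⟩ := hbd _ hφ.continuous
  have hms : ∀ ψ : E → ℝ, Continuous ψ →
      AEStronglyMeasurable (fun y => (ψ y : ℂ)) (volume.restrict Y) := fun ψ hψ =>
    (Complex.continuous_ofReal.comp hψ).stronglyMeasurable.aestronglyMeasurable
  have t1 := tendsto_integral_mul_of_eLpNorm (fun n => m1 (κ₁ (κ₂ n))) w1
    (a1.comp hκ₂.tendsto_atTop) (hms _ hcφ) hM₁
  have t2 := tendsto_integral_mul_of_eLpNorm (fun n => m2 (κ₁ (κ₂ n))) w2 a2
    (hms _ hφ.continuous) hM₂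
  have hfin : ∀ n, ∫ y in Y, (∑ k ∈ s n, χ.tensor μ k (c k) :
        Lp ℂ 2 (μ.prod (volume.restrict Y))) (x, y) * (fderiv ℝ φ y (e j) : ℝ)
      = -∫ y in Y, (∑ k ∈ s n, χ.tensor μ k (c' k) :
        Lp ℂ 2 (μ.prod (volume.restrict Y))) (x, y) * (φ y : ℝ) := by
    intro n
    have e1 : ∫ y in Y, (∑ k ∈ s n, χ.tensor μ k (c k) :
        Lp ℂ 2 (μ.prod (volume.restrict Y))) (x, y) * (fderiv ℝ φ y (e j) : ℝ)
        = ∫ y in Y, ∑ k ∈ s n, c k x * (planeWave (l k) y * (fderiv ℝ φ y (e j) : ℝ)) := by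
      refine integral_congr_ae ?_
      filter_upwards [p1 n] with y hy
      rw [hy, Finset.sum_mul]
      exact Finset.sum_congr rfl fun k _ => by rw [hχ]; ring
    have e2 : ∫ y in Y, (∑ k ∈ s n, χ.tensor μ k (c' k) :
        Lp ℂ 2 (μ.prod (volume.restrict Y))) (x, y) * (φ y : ℝ)
        = ∫ y in Y, ∑ k ∈ s n, c k x *
          (2 * Real.pi * Complex.I * (l k (e j) : ℝ) * planeWave (l k) y * (φ y : ℝ)) := by
      refine integral_congr_ae ?_
      filter_upwards [p2 n] with y hy
      rw [hy, Finset.sum_mul]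
      exact Finset.sum_congr rfl fun k _ => by rw [hχ, hx]; ring
    rw [e1, e2, integral_finsetSum, integral_finsetSum, ← Finset.sum_neg_distrib]
    · refine Finset.sum_congr rfl fun k _ => ?_
      rw [integral_const_mul, integral_const_mul,
        hY.integral_planeWave_mul_fderiv (hl k) hφ hper j, mul_neg]
    · exact fun k _ => (hY.integrable _ ((continuous_const.mul (continuous_planeWave _)).mul
        (Complex.continuous_ofReal.comp hφ.continuous))).const_mul _
    · exact fun k _ => (hY.integrable _ ((continuous_planeWave _).mul
        (Complex.continuous_ofReal.comp hcφ))).const_mul _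
  have heq := tendsto_nhds_unique t1 ((t2.neg).congr fun n => (hfin _).symm)
  have hInt : ∀ {w : E → ℂ} {ψ : E → ℝ} {M : ℝ}, MemLp w 2 (volume.restrict Y) →
      Continuous ψ → (∀ᵐ y ∂(volume.restrict Y), ‖(ψ y : ℂ)‖ ≤ M) →
      ∫ y in Y, (w y).re * ψ y = (∫ y in Y, w y * (ψ y : ℂ)).re := by
    intro w ψ M hw hψ hM
    have hi : Integrable (fun y => w y * (ψ y : ℂ)) (volume.restrict Y) :=
      (hw.integrable one_le_two).mul_bdd (hms ψ hψ) hM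
    have := integral_re hi
    simpa using this
  rw [hInt w1 hcφ hM₁, hInt w2 hφ.continuous hM₂, heq, Complex.neg_re]

end PeriodicDerivative

/-! ### Modes that are constant, or oscillate, in `y₃`. -/

section Lift

variable {μ : Measure Space}

instance : IsProbabilityMeasure ((volume : Measure ℝ).restrict (Ico (0 : ℝ) 1)) :=
  ⟨by rw [Measure.restrict_apply_univ]; simp⟩

lemma volume_restrict_cell3 : (volume : Measure Space).restrict cell3
    = (volume.restrict cell2).prod (volume.restrict (Ico (0 : ℝ) 1)) :=
  volume_restrict_prod _ _

lemma measurePreserving_dropLast [SFinite μ] :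
    MeasurePreserving (fun p : Space × Space => (p.1, p.2.1))
      (μ.prod (volume.restrict cell3)) (μ.prod (volume.restrict cell2)) := by
  rw [volume_restrict_cell3]
  exact (MeasurePreserving.id μ).prod measurePreserving_fst

lemma lift_tensor [SFinite μ] (k : Fin 2 → ℤ) (a : Lp ℂ 2 μ) :
    Lp.compMeasurePreserving _ (measurePreserving_dropLast (μ := μ)) (waves2.tensor μ k a)
      = waves3.tensor μ (k, 0) a := by
  refine Lp.ext ?_
  filter_upwards [Lp.coeFn_compMeasurePreserving (waves2.tensor μ k a)
    (measurePreserving_dropLast (μ := μ)), waves3.coeFn_tensor μ (k, 0) a,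
    (measurePreserving_dropLast (μ := μ)).quasiMeasurePreserving.ae (waves2.coeFn_tensor μ k a)]
    with p h1 h2 h3
  rw [h1, h2, Function.comp_apply, h3, waves2_wave, waves3_wave, planeWave, planeWave,
    freq2_apply, phase_apply]
  simp

/-- A sum of modes that do not depend on `y₃` is a function of `(x, y')`. -/
theorem lift_sum [SFinite μ] {c : Mode → Lp ℂ 2 μ} (hc : Summable fun k => ‖c k‖ ^ 2)
    (h0 : ∀ k, k.2 ≠ 0 → c k = 0) :
    waves3.sum μ c =ᵐ[μ.prod (volume.restrict cell3)]
      fun p => waves2.sum μ (fun k => c (k, 0)) (p.1, p.2.1) := by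
  have hinj : Function.Injective (fun k : Fin 2 → ℤ => ((k, 0) : Mode)) := fun k l h =>
    congrArg Prod.fst h
  have hc2 : Summable fun k : Fin 2 → ℤ => ‖c (k, 0)‖ ^ 2 := hc.comp_injective hinj
  let R := Lp.compMeasurePreservingₗᵢ (E := ℂ) (p := 2) ℂ _ (measurePreserving_dropLast (μ := μ))
  have h1 := (waves2.hasSum hc2).mapL R.toContinuousLinearMap
  have h2 : ∀ k, R.toContinuousLinearMap (waves2.tensor μ k (c (k, 0)))
      = waves3.tensor μ (k, 0) (c (k, 0)) := fun k => lift_tensor k _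
  simp_rw [h2] at h1
  have h3 : HasSum (fun k => waves3.tensor μ k (c k)) (R (waves2.sum μ fun k => c (k, 0))) := by
    refine (hinj.hasSum_iff fun k hk => ?_).1 h1
    have : k.2 ≠ 0 := fun h => hk ⟨k.1, Prod.ext rfl h.symm⟩
    rw [h0 k this, map_zero]
  have h4 : waves3.sum μ c = R (waves2.sum μ fun k => c (k, 0)) := h3.tsum_eq
  rw [h4]
  exact Lp.coeFn_compMeasurePreserving _ (measurePreserving_dropLast (μ := μ))

lemma integral_planeWave_last (k : Mode) (hk : k.2 ≠ 0) (y' : Plane) :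
    ∫ s in Ico (0 : ℝ) 1, planeWave (phase 1 1 k) (y', s) = 0 := by
  have h : ∀ s : ℝ, planeWave (phase 1 1 k) (y', s)
      = planeWave (freq2 k.1) y' * Complex.exp ((2 * Real.pi * Complex.I * k.2) * s) := by
    intro s
    rw [planeWave, planeWave, ← Complex.exp_add, phase_apply, freq2_apply]
    congr 1
    push_cast
    ring
  have hne : (2 * Real.pi * Complex.I * k.2 : ℂ) ≠ 0 := by
    simp [Real.pi_ne_zero, hk]
  simp_rw [h]
  rw [integral_const_mul, integral_Ico_eq_integral_Ioc,
    ← intervalIntegral.integral_of_le zero_le_one, integral_exp_mul_complex hne]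
  have : (2 * Real.pi * Complex.I * k.2 : ℂ) * ((1 : ℝ) : ℂ) = k.2 * (2 * Real.pi * Complex.I) := by
    push_cast
    ring
  rw [this, Complex.exp_int_mul_two_pi_mul_I]
  simp

/-- Regrouping makes `(x, y')` the base variable and `y₃` the fibre, so that the slice lemmas give
information for a.e. `(x, y')`. -/
lemma measurePreserving_regroup :
    MeasurePreserving (fun p : (Space × Plane) × ℝ => (p.1.1, (p.1.2, p.2)))
      ((μ.prod (volume.restrict cell2)).prod (volume.restrict (Ico (0 : ℝ) 1)))
      (μ.prod (volume.restrict cell3)) := by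
  rw [volume_restrict_cell3]
  exact measurePreserving_prodAssoc μ _ _

/-- A sum of modes that oscillate in `y₃` has mean zero with respect to `y₃`. -/
theorem integral_sum_last_eq_zero [SFinite μ] {c : Mode → Lp ℂ 2 μ} (hc : Summable fun k => ‖c k‖ ^ 2)
    (h0 : ∀ k, k.2 = 0 → c k = 0) :
    ∀ᵐ q ∂(μ.prod (volume.restrict cell2)),
      ∫ s in Ico (0 : ℝ) 1, (waves3.sum μ c (q.1, (q.2, s))).re = 0 := by
  obtain ⟨s, hs⟩ := exists_seq_tendsto (atTop : Filter (Finset Mode))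
  let R := Lp.compMeasurePreservingₗᵢ (E := ℂ) (p := 2) ℂ _ (measurePreserving_regroup (μ := μ))
  have h1 : Tendsto (fun n => R (∑ k ∈ s n, waves3.tensor μ k (c k))) atTop
      (𝓝 (R (waves3.sum μ c))) := (R.continuous.tendsto _).comp ((waves3.hasSum hc).comp hs)
  obtain ⟨κ, hκ, hlim⟩ := exists_slice_subseq h1
  have hcoe : ∀ f : Lp ℂ 2 (μ.prod (volume.restrict cell3)),
      ∀ᵐ q ∂(μ.prod (volume.restrict cell2)), ∀ᵐ r ∂(volume.restrict (Ico (0 : ℝ) 1)),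
        R f (q, r) = f (q.1, (q.2, r)) := fun f =>
    Measure.ae_ae_of_ae_prod (Lp.coeFn_compMeasurePreserving f measurePreserving_regroup)
  have hp : ∀ᵐ q ∂(μ.prod (volume.restrict cell2)), ∀ n,
      ∀ᵐ r ∂(volume.restrict (Ico (0 : ℝ) 1)), R (∑ k ∈ s n, waves3.tensor μ k (c k)) (q, r)
        = ∑ k ∈ s n, c k q.1 * planeWave (phase 1 1 k) (q.2, r) := by
    rw [ae_all_iff]
    intro n
    have := (measurePreserving_regroup (μ := μ)).quasiMeasurePreserving.ae
      (waves3.coeFn_partialSum c (s n))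
    filter_upwards [hcoe (∑ k ∈ s n, waves3.tensor μ k (c k)), Measure.ae_ae_of_ae_prod this]
      with q h2 h3
    filter_upwards [h2, h3] with r h4 h5
    rw [h4, h5]
    rfl
  have hm : ∀ᵐ q ∂(μ.prod (volume.restrict cell2)), ∀ n, MemLp (fun r =>
      R (∑ k ∈ s n, waves3.tensor μ k (c k)) (q, r)) 2 (volume.restrict (Ico (0 : ℝ) 1)) := by
    rw [ae_all_iff]
    exact fun n => ae_memLp_slice (Lp.memLp _)
  have hc0 : ∀ᵐ q ∂(μ.prod (volume.restrict cell2)), ∀ k : Mode, k.2 = 0 → c k q.1 = 0 := by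
    rw [ae_all_iff]
    intro k
    by_cases hk : k.2 = 0
    · have h2 : ∀ᵐ x ∂μ, c k x = 0 := by
        rw [h0 k hk]
        exact Lp.coeFn_zero ℂ 2 μ
      filter_upwards [(measurePreserving_fst (μ := μ)
        (ν := volume.restrict cell2)).quasiMeasurePreserving.ae h2] with q hq _
      exact hq
    · exact Eventually.of_forall fun q h => absurd h hk
  filter_upwards [hlim, hp, hm, ae_memLp_slice (Lp.memLp (R (waves3.sum μ c))),
    hcoe (waves3.sum μ c), hc0] with q a1 a2 a3 a4 a5 a6
  have t := tendsto_integral_mul_of_eLpNorm (fun n => a3 (κ n)) a4 a1 (ψ := fun _ => 1)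
    aestronglyMeasurable_const (M := 1) (Eventually.of_forall fun r => by simp)
  simp only [mul_one] at t
  have hz : ∀ n, ∫ r in Ico (0 : ℝ) 1, R (∑ k ∈ s n, waves3.tensor μ k (c k)) (q, r) = 0 := by
    intro n
    rw [integral_congr_ae (a2 n), integral_finsetSum]
    · refine Finset.sum_eq_zero fun k _ => ?_
      rw [integral_const_mul]
      by_cases hk : k.2 = 0
      · rw [a6 k hk, zero_mul]
      · rw [integral_planeWave_last k hk, mul_zero]
    · intro k _
      refine Integrable.const_mul ?_ _
      refine Integrable.of_bound (C := 1) ?_ (Eventually.of_forall fun r => ?_)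
      · exact ((continuous_planeWave _).comp (by fun_prop)).aestronglyMeasurable
      · rw [norm_planeWave]
  simp_rw [hz] at t
  have h2 := tendsto_nhds_unique t tendsto_const_nhds
  have h3 := integral_re (a4.integrable one_le_two)
  rw [h2] at h3
  refine Eq.trans (integral_congr_ae ?_) (h3.trans (by simp))
  filter_upwards [a5] with r hr
  rw [hr]
  rfl

end Lift

/-! ### Differentiation of mode sums in the slow variable. -/

section PlateDerivative

lemma isClosedEmbedding_prodMk {X Y : Type*} [TopologicalSpace X] [TopologicalSpace Y] [T1Space Y]
    (y : Y) : Topology.IsClosedEmbedding (fun x : X => (x, y)) := by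
  refine ⟨isEmbedding_prodMkLeft y, ?_⟩
  have : range (fun x : X => (x, y)) = Prod.snd ⁻¹' {y} := by
    ext ⟨a, b⟩
    simp [eq_comm]
  rw [this]
  exact isClosed_singleton.preimage continuous_snd

/-- `g` is the weak derivative of the complex function `f` in the direction `v` on `U`. -/
def HasWeakDerivC (U : Set Space) (v : Space) (f g : Space → ℂ) : Prop :=
  ∀ φ : Space → ℝ, ContDiff ℝ ∞ φ → HasCompactSupport φ → tsupport φ ⊆ U →
    ∫ x in U, f x * (fderiv ℝ φ x v : ℝ) = -∫ x in U, g x * (φ x : ℝ)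

/-- Pairing with `ψ` is a continuous functional, applied here to the mode series. Fubini is taken
with `y` outside, so that derivatives of the amplitudes in `x` can be used with `y` frozen. -/
lemma integral_sum_mul {Ω : Set Space} {c : (Fin 2 → ℤ) → Lp ℂ 2 (volume.restrict Ω)}
    (hc : Summable fun k => ‖c k‖ ^ 2) {ψ : Space × Plane → ℝ} (hψ : Continuous ψ)
    (hψc : HasCompactSupport ψ) :
    HasSum (fun k => ∫ y in cell2, planeWave (freq2 k) y * ∫ x in Ω, c k x * (ψ (x, y) : ℝ))
      (∫ p, waves2.sum (volume.restrict Ω) c p * (ψ p : ℝ)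
        ∂((volume.restrict Ω).prod (volume.restrict cell2))) := by
  have hψ2 : MemLp (fun p => (ψ p : ℂ)) 2
      ((volume.restrict Ω).prod (volume.restrict cell2)) := by
    rw [← volume_restrict_prod]
    exact (hψ.memLp_of_hasCompactSupport hψc).ofReal
  have h := (waves2.hasSum hc).mapL (innerSL ℂ (hψ2.toLp _))
  have key : ∀ f : Lp ℂ 2 ((volume.restrict Ω).prod (volume.restrict cell2)),
      innerSL ℂ (hψ2.toLp _) f
        = ∫ p, f p * (ψ p : ℝ) ∂((volume.restrict Ω).prod (volume.restrict cell2)) := by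
    intro f
    rw [innerSL_apply_apply, L2.inner_def]
    refine integral_congr_ae ?_
    filter_upwards [hψ2.coeFn_toLp] with p hp
    rw [hp, RCLike.inner_apply, Complex.conj_ofReal]
  simp_rw [key] at h
  refine h.congr_fun fun k => ?_
  have hi : Integrable (fun p => c k p.1 * waves2.wave k p.2 * (ψ p : ℂ))
      ((volume.restrict Ω).prod (volume.restrict cell2)) :=
    (waves2.memLp _ k (Lp.memLp (c k))).integrable_mul hψ2
  have h2 : ∫ p, (waves2.tensor (volume.restrict Ω) k (c k)) p * (ψ p : ℝ)
        ∂((volume.restrict Ω).prod (volume.restrict cell2))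
      = ∫ p, c k p.1 * waves2.wave k p.2 * (ψ p : ℂ)
        ∂((volume.restrict Ω).prod (volume.restrict cell2)) := by
    refine integral_congr_ae ?_
    filter_upwards [waves2.coeFn_tensor _ k (c k)] with p hp
    rw [hp]
  rw [h2, integral_prod_symm _ hi]
  refine integral_congr_ae (Eventually.of_forall fun y => ?_)
  dsimp only
  rw [← integral_const_mul, waves2_wave]
  refine integral_congr_ae (Eventually.of_forall fun x => ?_)
  dsimp only
  ring

/-- Term by term differentiation of a sum of modes with respect to `x`. -/
theorem hasWeakDeriv_sum {Ω : Set Space} (hΩ : MeasurableSet Ω) (v : Space)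
    {c c' : (Fin 2 → ℤ) → Lp ℂ 2 (volume.restrict Ω)} (hc : Summable fun k => ‖c k‖ ^ 2)
    (hc' : Summable fun k => ‖c' k‖ ^ 2) (hd : ∀ k, HasWeakDerivC Ω v (c k) (c' k)) :
    HasWeakDeriv (Ω ×ˢ interior cell2) (v, (0 : Plane))
      (fun p => (waves2.sum (volume.restrict Ω) c p).re)
      (fun p => (waves2.sum (volume.restrict Ω) c' p).re) := by
  intro Φ hΦ hΦc hΦU
  have hdΦ : Continuous fun p => fderiv ℝ Φ p (v, (0 : Plane)) :=
    (hΦ.continuous_fderiv (by simp)).clm_apply continuous_const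
  have hdΦc : HasCompactSupport fun p => fderiv ℝ Φ p (v, (0 : Plane)) :=
    hΦc.fderiv_apply ℝ _
  have hset : ∀ (f : Lp ℂ 2 ((volume.restrict Ω).prod (volume.restrict cell2)))
      (ψ : Space × Plane → ℝ), Continuous ψ → HasCompactSupport ψ → tsupport ψ ⊆ tsupport Φ →
      ∫ p in Ω ×ˢ interior cell2, (f p).re * ψ p
        = (∫ p, f p * (ψ p : ℝ) ∂((volume.restrict Ω).prod (volume.restrict cell2))).re := by
    intro f ψ hψ hψc hsub
    have hψ2 : MemLp (fun p => (ψ p : ℂ)) 2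
        ((volume.restrict Ω).prod (volume.restrict cell2)) := by
      rw [← volume_restrict_prod]
      exact (hψ.memLp_of_hasCompactSupport hψc).ofReal
    have h1 := integral_re ((Lp.memLp f).integrable_mul hψ2)
    -- The domains differ only where `ψ` vanishes, because its support lies in that of `Φ`.
    have h2 : ∫ p in Ω ×ˢ interior cell2, (f p).re * ψ p
        = ∫ p in Ω ×ˢ cell2, (f p).re * ψ p := by
      symm
      refine setIntegral_eq_of_subset_of_forall_sdiff_eq_zero (hΩ.prod measurableSet_cell2)
        (prod_mono le_rfl interior_subset) fun p hp => ?_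
      have : p ∉ tsupport ψ := fun h => hp.2 (hΦU (hsub h))
      rw [image_eq_zero_of_notMem_tsupport this, mul_zero]
    rw [h2, volume_restrict_prod]
    refine Eq.trans (integral_congr_ae (Eventually.of_forall fun p => ?_)) h1
    simp
  rw [hset _ _ hdΦ hdΦc (tsupport_fderiv_apply_subset ℝ _), hset _ _ hΦ.continuous hΦc le_rfl]
  have s1 := integral_sum_mul hc hdΦ hdΦc
  have s2 := (integral_sum_mul hc' hΦ.continuous hΦc).neg
  have hterm : ∀ k, ∫ y in cell2, planeWave (freq2 k) y
        * ∫ x in Ω, c k x * (fderiv ℝ Φ (x, y) (v, (0 : Plane)) : ℝ)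
      = -∫ y in cell2, planeWave (freq2 k) y * ∫ x in Ω, c' k x * (Φ (x, y) : ℝ) := by
    intro k
    rw [← integral_neg]
    refine integral_congr_ae (Eventually.of_forall fun y => ?_)
    dsimp only
    have hcl : Topology.IsClosedEmbedding (fun x : Space => (x, y)) :=
      isClosedEmbedding_prodMk y
    -- For each `y` the slice of `Φ` is an admissible test function on `Ω`; its support is compact
    -- because slices are closed in the product.
    have hslice := hd k (fun x => Φ (x, y)) (hΦ.comp (contDiff_id.prodMk contDiff_const))
      (hΦc.comp_isClosedEmbedding hcl) (fun x hx => by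
        have h1 : tsupport (fun x => Φ (x, y)) ⊆ (fun x : Space => (x, y)) ⁻¹' tsupport Φ :=
          tsupport_comp_subset_preimage Φ hcl.continuous
        exact (hΦU (h1 hx)).1)
    have hfd : ∀ x, fderiv ℝ (fun x => Φ (x, y)) x v = fderiv ℝ Φ (x, y) (v, (0 : Plane)) := by
      intro x
      have h1 : HasFDerivAt (fun x : Space => (x, y)) (ContinuousLinearMap.inl ℝ Space Plane) x :=
        hasFDerivAt_prodMk_left x y
      have h2 := (hΦ.differentiable (by simp) (x, y)).hasFDerivAt.comp x h1
      have h3 : fderiv ℝ (fun x => Φ (x, y)) x = _ := h2.fderiv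
      simp [h3]
    simp_rw [hfd] at hslice
    rw [hslice, mul_neg]
  simp_rw [hterm] at s1
  rw [s1.unique s2, Complex.neg_re]

end PlateDerivative

/-! ### Weak convergence in `H¹` as weak convergence in a product of `L²` spaces. -/

section WeakConvergence

/-- Uniform boundedness principle, applied to the functionals `⟨U n, ·⟩`. -/
lemma norm_le_of_forall_tendsto_inner {H : Type*} [NormedAddCommGroup H] [InnerProductSpace ℝ H]
    [CompleteSpace H] {U : ℕ → H} {U0 : H}
    (h : ∀ g, Tendsto (fun n => inner ℝ (U n) g) atTop (𝓝 (inner ℝ U0 g))) :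
    ∃ C, ∀ n, ‖U n‖ ≤ C := by
  obtain ⟨C, hC⟩ := banach_steinhaus (g := fun n => innerSL ℝ (U n)) fun g => by
    obtain ⟨C, hC⟩ := (Metric.isBounded_range_of_tendsto _ (h g)).exists_norm_le
    exact ⟨C, fun n => by simpa using hC _ ⟨n, rfl⟩⟩
  exact ⟨C, fun n => by simpa using hC n⟩

lemma exists_mem_orthogonal_inner_eq {H : Type*} [NormedAddCommGroup H] [InnerProductSpace ℝ H]
    [CompleteSpace H] (M : Submodule ℝ H) (g : H) :
    ∃ p ∈ Mᗮ, ∀ v ∈ Mᗮ, inner ℝ v g = inner ℝ v p := by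
  refine ⟨Mᗮ.starProjection g, Mᗮ.starProjection_apply_mem g, fun v hv => ?_⟩
  have h := Mᗮ.starProjection_inner_eq_zero g v hv
  rw [inner_sub_left, sub_eq_zero] at h
  rw [real_inner_comm, h, real_inner_comm]

variable {X : Type*} [MeasurableSpace X] {μ : Measure X}

lemma inner_toLp_real {f g : X → ℝ} (hf : MemLp f 2 μ) (hg : MemLp g 2 μ) :
    inner ℝ (hf.toLp f) (hg.toLp g) = ∫ x, f x * g x ∂μ := by
  rw [L2.inner_def]
  refine integral_congr_ae ?_
  filter_upwards [hf.coeFn_toLp, hg.coeFn_toLp] with x h1 h2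
  rw [h1, h2, RCLike.inner_apply, conj_trivial, mul_comm]

lemma norm_toLp_real_sq {f : X → ℝ} (hf : MemLp f 2 μ) :
    ‖hf.toLp f‖ ^ 2 = ∫ x, f x ^ 2 ∂μ := by
  rw [← real_inner_self_eq_norm_sq, inner_toLp_real]
  simp_rw [pow_two]

/-- The Hilbert space `L²(Ω)³ × L²(Ω)^{3×3}`, which contains `H¹(Ω; ℝ³)`. -/
abbrev GradSpace (Ω : Set Space) : Type :=
  PiLp 2 fun _ : Fin 3 ⊕ (Fin 3 × Fin 3) => Lp ℝ 2 ((volume : Measure Space).restrict Ω)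

/-- A function of `H¹` together with its gradient, as an element of `GradSpace`. -/
noncomputable def IsH1.toGradSpace {Ω : Set Space} {f : Space → Fin 3 → ℝ}
    {Df : Space → Fin 3 → Fin 3 → ℝ} (h : IsH1 e3 Ω f Df) : GradSpace Ω :=
  WithLp.toLp 2 (Sum.elim (fun i => (h.memLp i).toLp _) fun p => (h.memLp_grad p.1 p.2).toLp _)

lemma IsH1.inner_toGradSpace {Ω : Set Space} {f g : Space → Fin 3 → ℝ}
    {Df Dg : Space → Fin 3 → Fin 3 → ℝ} (hf : IsH1 e3 Ω f Df) (hg : IsH1 e3 Ω g Dg) :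
    inner ℝ hf.toGradSpace hg.toGradSpace = innerH1 Ω f Df g Dg := by
  rw [PiLp.inner_apply, Fintype.sum_sum_type, innerH1, Fintype.sum_prod_type,
    integral_finsetSum, integral_finsetSum]
  · congr 1
    · exact Finset.sum_congr rfl fun i _ => inner_toLp_real (hf.memLp i) (hg.memLp i)
    · refine Finset.sum_congr rfl fun i _ => ?_
      rw [integral_finsetSum]
      · exact Finset.sum_congr rfl fun j _ =>
          inner_toLp_real (hf.memLp_grad i j) (hg.memLp_grad i j)
      · exact fun j _ => (hf.memLp_grad i j).integrable_mul (hg.memLp_grad i j)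
  · exact fun i _ => integrable_finsetSum _ fun j _ =>
      (hf.memLp_grad i j).integrable_mul (hg.memLp_grad i j)
  · exact fun i _ => (hf.memLp i).integrable_mul (hg.memLp i)

lemma inner_single_gradSpace {Ω : Set Space} (i : Fin 3 ⊕ (Fin 3 × Fin 3))
    (a : Lp ℝ 2 ((volume : Measure Space).restrict Ω)) (v : GradSpace Ω) :
    inner ℝ (PiLp.single 2 i a : GradSpace Ω) v = inner ℝ a (v i) := by
  rw [PiLp.inner_apply, Finset.sum_eq_single i]
  · rw [PiLp.single_eq_same]
  · intro j _ hj
    rw [PiLp.single_eq_of_ne _ hj, inner_zero_left]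
  · simp

/-- The vectors orthogonal to `H¹` given by test functions. -/
def testVectors (Ω : Set Space) : Set (GradSpace Ω) :=
  {z | ∃ (i j : Fin 3) (φ : Space → ℝ) (h1 : MemLp (fun x => fderiv ℝ φ x (e3 j)) 2
    ((volume : Measure Space).restrict Ω)) (h2 : MemLp φ 2 ((volume : Measure Space).restrict Ω)),
    ContDiff ℝ ∞ φ ∧ HasCompactSupport φ ∧ tsupport φ ⊆ Ω ∧
    z = PiLp.single 2 (Sum.inl i) (h1.toLp _) + PiLp.single 2 (Sum.inr (i, j)) (h2.toLp _)}

/-- Orthogonality to a test vector is exactly one instance of the integration by parts that defines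
the weak gradient. With the converse `isH1_of_mem_orthogonal`, this exhibits `H¹` as an orthogonal
complement, hence as a closed subspace of `GradSpace Ω`. -/
lemma IsH1.mem_orthogonal {Ω : Set Space} {f : Space → Fin 3 → ℝ}
    {Df : Space → Fin 3 → Fin 3 → ℝ} (h : IsH1 e3 Ω f Df) :
    h.toGradSpace ∈ (Submodule.span ℝ (testVectors Ω))ᗮ := by
  rw [Submodule.mem_orthogonal]
  intro z hz
  induction hz using Submodule.span_induction with
  | mem z hz =>
    obtain ⟨i, j, φ, h1, h2, hφ, hφc, hφΩ, rfl⟩ := hz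
    have hw := h.weak_grad i j φ hφ hφc hφΩ
    rw [inner_add_left, inner_single_gradSpace, inner_single_gradSpace]
    have a1 : inner ℝ (h1.toLp _) (h.toGradSpace (Sum.inl i)) = _ :=
      inner_toLp_real h1 (h.memLp i)
    have a2 : inner ℝ (h2.toLp _) (h.toGradSpace (Sum.inr (i, j))) = _ :=
      inner_toLp_real h2 (h.memLp_grad i j)
    rw [a1, a2]
    simp_rw [mul_comm] at hw ⊢
    rw [hw]
    ring
  | zero => simp
  | add x y _ _ hx hy => rw [inner_add_left, hx, hy, add_zero]
  | smul r x _ hx => rw [inner_smul_left, hx, mul_zero]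

lemma isH1_of_mem_orthogonal {Ω : Set Space} {p : GradSpace Ω}
    (hp : p ∈ (Submodule.span ℝ (testVectors Ω))ᗮ) :
    IsH1 e3 Ω (fun x i => p (Sum.inl i) x) (fun x i j => p (Sum.inr (i, j)) x) where
  memLp i := Lp.memLp _
  memLp_grad i j := Lp.memLp _
  weak_grad i j φ hφ hφc hφΩ := by
    have h1 : MemLp (fun x => fderiv ℝ φ x (e3 j)) 2 ((volume : Measure Space).restrict Ω) :=
      ((hφ.continuous_fderiv (by simp)).clm_apply continuous_const).memLp_of_hasCompactSupport
        (hφc.fderiv_apply ℝ _)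
    have h2 : MemLp φ 2 ((volume : Measure Space).restrict Ω) :=
      hφ.continuous.memLp_of_hasCompactSupport hφc
    have h := (Submodule.mem_orthogonal _ _).1 hp _
      (Submodule.subset_span ⟨i, j, φ, h1, h2, hφ, hφc, hφΩ, rfl⟩)
    rw [inner_add_left, inner_single_gradSpace, inner_single_gradSpace,
      ← Lp.toLp_coeFn (p (Sum.inl i)) (Lp.memLp _),
      ← Lp.toLp_coeFn (p (Sum.inr (i, j))) (Lp.memLp _), inner_toLp_real, inner_toLp_real] at h
    simp_rw [mul_comm] at h ⊢
    exact eq_neg_of_add_eq_zero_left h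

lemma toGradSpace_isH1_of_mem_orthogonal {Ω : Set Space} {p : GradSpace Ω}
    (hp : p ∈ (Submodule.span ℝ (testVectors Ω))ᗮ) :
    (isH1_of_mem_orthogonal hp).toGradSpace = p := by
  ext1 i
  rcases i with i | i
  · exact Lp.toLp_coeFn (p (Sum.inl i)) (Lp.memLp _)
  · exact Lp.toLp_coeFn (p (Sum.inr i)) (Lp.memLp _)

variable {Ω : Set Space} {u : ℝ → Space → Fin 3 → ℝ} {Du : ℝ → Space → Fin 3 → Fin 3 → ℝ}
  {ulim : Space → Fin 3 → ℝ} {Dulim : Space → Fin 3 → Fin 3 → ℝ}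

/-- The hypothesis tests only with elements of `H¹`. An arbitrary `g` has the same inner products
with `H¹` as its orthogonal projection onto `H¹`, which is an admissible test element. -/
lemma WeaklyConvergesH1.tendsto_inner (hweak : WeaklyConvergesH1 Ω u Du ulim Dulim)
    {t : ℕ → ℝ} (ht : ∀ n, 0 < t n) (ht0 : Tendsto t atTop (𝓝 0)) (g : GradSpace Ω) :
    Tendsto (fun n => inner ℝ (hweak.mem (t n) (ht n)).toGradSpace g) atTop
      (𝓝 (inner ℝ hweak.mem_lim.toGradSpace g)) := by
  obtain ⟨p, hmem, hproj⟩ := exists_mem_orthogonal_inner_eq (Submodule.span ℝ (testVectors Ω)) g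
  have hH := isH1_of_mem_orthogonal hmem
  have ht' : Tendsto t atTop (𝓝[>] 0) :=
    tendsto_nhdsWithin_iff.2 ⟨ht0, Eventually.of_forall ht⟩
  have h := (hweak.tendsto _ _ hH).comp ht'
  rw [← hweak.mem_lim.inner_toGradSpace hH, toGradSpace_isH1_of_mem_orthogonal hmem,
    ← hproj _ hweak.mem_lim.mem_orthogonal] at h
  refine h.congr fun n => ?_
  rw [Function.comp_apply, ← (hweak.mem (t n) (ht n)).inner_toGradSpace hH,
    toGradSpace_isH1_of_mem_orthogonal hmem, ← hproj _ (hweak.mem (t n) (ht n)).mem_orthogonal]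

/-- Weak convergence in `H¹` implies weak convergence of the gradients in `L²`. -/
theorem WeaklyConvergesH1.tendsto_integral_grad (hweak : WeaklyConvergesH1 Ω u Du ulim Dulim)
    {t : ℕ → ℝ} (ht : ∀ n, 0 < t n) (ht0 : Tendsto t atTop (𝓝 0)) (i j : Fin 3) {g : Space → ℝ}
    (hg : MemLp g 2 (volume.restrict Ω)) :
    Tendsto (fun n => ∫ x in Ω, Du (t n) x i j * g x) atTop
      (𝓝 (∫ x in Ω, Dulim x i j * g x)) := by
  have h := hweak.tendsto_inner ht ht0 (PiLp.single 2 (Sum.inr (i, j)) (hg.toLp g))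
  have key : ∀ {f Df} (hf : IsH1 e3 Ω f Df),
      inner ℝ hf.toGradSpace (PiLp.single 2 (Sum.inr (i, j)) (hg.toLp g))
        = ∫ x in Ω, Df x i j * g x :=
    fun hf => by
      rw [real_inner_comm, inner_single_gradSpace, real_inner_comm]
      exact inner_toLp_real (hf.memLp_grad i j) hg
  rw [key] at h
  exact h.congr fun n => key _

theorem WeaklyConvergesH1.exists_bound (hweak : WeaklyConvergesH1 Ω u Du ulim Dulim)
    {t : ℕ → ℝ} (ht : ∀ n, 0 < t n) (ht0 : Tendsto t atTop (𝓝 0)) :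
    ∃ C, ∀ n i, ∫ x in Ω, u (t n) x i ^ 2 ≤ C := by
  obtain ⟨C, hC⟩ := norm_le_of_forall_tendsto_inner (hweak.tendsto_inner ht ht0)
  refine ⟨C ^ 2, fun n i => ?_⟩
  rw [← norm_toLp_real_sq ((hweak.mem (t n) (ht n)).memLp i)]
  gcongr
  exact (PiLp.norm_apply_le (hweak.mem (t n) (ht n)).toGradSpace (Sum.inl i)).trans (hC n)

end WeakConvergence

/-! ### Averages over fibres. -/

section FiberIntegral

variable {X Y F : Type*} [MeasurableSpace X] [MeasurableSpace Y] {μ : Measure X} {ν : Measure Y}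
  [NormedAddCommGroup F] [NormedSpace ℝ F]

/-- On fibres of measure one the `L¹` norm is at most the `L²` norm; Tonelli integrates the squares.
-/
lemma memLp_integral_fiber [IsProbabilityMeasure ν] {h : X × Y → F} (hh : MemLp h 2 (μ.prod ν)) :
    MemLp (fun x => ∫ y, h (x, y) ∂ν) 2 μ := by
  refine ⟨hh.1.integral_prod_right', ?_⟩
  have h1 : eLpNorm (fun x => ∫ y, h (x, y) ∂ν) 2 μ ^ 2 ≤ eLpNorm h 2 (μ.prod ν) ^ 2 := by
    rw [← lintegral_eLpNorm_slice_sq hh.1, eLpNorm_two_sq]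
    refine lintegral_mono_ae ?_
    filter_upwards [hh.1.prodMk_left] with x hx
    gcongr
    refine (enorm_integral_le_lintegral_enorm _).trans ?_
    rw [← eLpNorm_one_eq_lintegral_enorm]
    exact eLpNorm_le_eLpNorm_of_exponent_le one_le_two hx
  by_contra h2
  rw [not_lt, top_le_iff] at h2
  rw [h2] at h1
  have h3 : eLpNorm h 2 (μ.prod ν) ^ 2 < ⊤ := ENNReal.pow_lt_top hh.2
  exact absurd (h1.trans_lt h3) (by simp)

end FiberIntegral

/-! ### Primitives in the vertical variable. -/

section Interval

/-- The interval `(-1/2, 1/2)`. -/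
abbrev interval : Set ℝ := Ioo (-(1 / 2) : ℝ) (1 / 2)

instance : IsProbabilityMeasure ((volume : Measure ℝ).restrict interval) :=
  ⟨by rw [Measure.restrict_apply_univ, Real.volume_Ioo]; norm_num⟩

lemma volume_restrict_plate (S : Set Plane) : (volume : Measure Space).restrict (plate S)
    = (volume.restrict S).prod (volume.restrict interval) :=
  volume_restrict_prod _ _

lemma isOpen_plate {S : Set Plane} (hS : IsOpen S) : IsOpen (plate S) := hS.prod isOpen_Ioo

lemma setIntegral_interval {F : Type*} [NormedAddCommGroup F] [NormedSpace ℝ F] (g : ℝ → F) :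
    ∫ s in interval, g s = ∫ s in (-(1 / 2) : ℝ)..(1 / 2), g s := by
  rw [intervalIntegral.integral_of_le (by norm_num), integral_Ioc_eq_integral_Ioo]

/-- Fubini on the triangle `s < r`: the inner integral of `ψ'` from `s` to `1/2` is `-ψ s`, since
`ψ` vanishes at the upper end. No regularity of `g` beyond integrability is needed. -/
lemma integral_primitive_mul_deriv {g : ℝ → ℂ} (hg : Integrable g (volume.restrict interval))
    {ψ ψ' : ℝ → ℝ} (hψ : ∀ s, HasDerivAt ψ (ψ' s) s) (hψ' : Continuous ψ') (h0 : ψ (1 / 2) = 0) :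
    ∫ r in interval, (∫ s in interval, (Iio r).indicator g s) * (ψ' r : ℝ)
      = -∫ s in interval, g s * (ψ s : ℝ) := by
  have hψi : Integrable (fun r => (ψ' r : ℂ)) (volume.restrict interval) :=
    ((Complex.continuous_ofReal.comp hψ').continuousOn.integrableOn_compact
      isCompact_Icc).mono_set Ioo_subset_Icc_self
  have hprod : Integrable (fun z : ℝ × ℝ => (ψ' z.1 : ℂ) * g z.2)
      ((volume.restrict interval).prod (volume.restrict interval)) := hψi.mul_prod hg
  have hms : MeasurableSet {z : ℝ × ℝ | z.2 < z.1} := measurableSet_lt measurable_snd measurable_fst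
  have hInt : Integrable (Function.uncurry fun r s => (Iio r).indicator g s * (ψ' r : ℂ))
      ((volume.restrict interval).prod (volume.restrict interval)) := by
    refine (hprod.indicator hms).congr (Eventually.of_forall fun z => ?_)
    by_cases hz : z.2 < z.1 <;> simp [Function.uncurry, hz, mul_comm]
  simp_rw [← integral_mul_const]
  rw [integral_integral_swap hInt, ← integral_neg]
  refine setIntegral_congr_fun measurableSet_Ioo fun s hs => ?_
  have h1 : ∀ r, (Iio r).indicator g s * (ψ' r : ℂ)
      = (Ioi s).indicator (fun r => g s * (ψ' r : ℂ)) r := by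
    intro r
    by_cases hr : s < r <;> simp [hr]
  have hset : interval ∩ Ioi s = Ioo s (1 / 2) := by
    ext r
    simp only [mem_inter_iff, mem_Ioo, mem_Ioi]
    constructor
    · rintro ⟨⟨_, h2⟩, h3⟩
      exact ⟨h3, h2⟩
    · rintro ⟨h2, h3⟩
      exact ⟨⟨hs.1.trans h2, h3⟩, h2⟩
  simp_rw [h1]
  rw [setIntegral_indicator measurableSet_Ioi, hset, integral_const_mul, integral_complex_ofReal,
    ← integral_Ioc_eq_integral_Ioo, ← intervalIntegral.integral_of_le hs.2.le,
    intervalIntegral.integral_eq_sub_of_hasDerivAt (fun r _ => hψ r)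
      (hψ'.intervalIntegrable _ _), h0]
  push_cast
  ring

lemma hasDerivAt_vertical {φ : Space → ℝ} (hφ : ContDiff ℝ ∞ φ) (x' : Plane) (s : ℝ) :
    HasDerivAt (fun s => φ (x', s)) (fderiv ℝ φ (x', s) (e3 2)) s := by
  have h1 : HasDerivAt (fun s : ℝ => (x', s)) ((0 : Plane), (1 : ℝ)) s :=
    (hasDerivAt_const s x').prodMk (hasDerivAt_id s)
  exact (hφ.differentiable (by simp) (x', s)).hasFDerivAt.comp_hasDerivAt s h1

lemma continuous_fderiv_apply {E : Type*} [NormedAddCommGroup E] [NormedSpace ℝ E] {φ : E → ℝ}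
    (hφ : ContDiff ℝ ∞ φ) (v : E) : Continuous fun x => fderiv ℝ φ x v :=
  (hφ.continuous_fderiv (by simp)).clm_apply continuous_const

lemma contDiff_fderiv_apply {E : Type*} [NormedAddCommGroup E] [NormedSpace ℝ E] {φ : E → ℝ}
    (hφ : ContDiff ℝ ∞ φ) (v : E) : ContDiff ℝ ∞ fun x => fderiv ℝ φ x v :=
  (hφ.fderiv_right (by simp)).clm_apply contDiff_const

lemma eq_zero_of_notMem_plate {S : Set Plane} {φ : Space → ℝ} (h : tsupport φ ⊆ plate S)
    {x : Space} (hx : x ∉ plate S) : φ x = 0 :=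
  image_eq_zero_of_notMem_tsupport fun h' => hx (h h')

/-- Every function of `L²(Ω)` has a primitive in `L²(Ω)` with respect to `x₃`. -/
lemma exists_primitive_of_memLp (S : Set Plane) {f : Space → ℂ}
    (hf : MemLp f 2 ((volume : Measure Space).restrict (plate S))) :
    ∃ F : Space → ℂ, MemLp F 2 ((volume : Measure Space).restrict (plate S)) ∧
      HasWeakDerivC (plate S) (e3 2) F f := by
  -- The primitive is the integral of `f (x', ·)` from `-1/2` to `x₃`, written as the fibre integral
  -- of `H` over the interval so that `memLp_integral_fiber` applies.
  let H : Space × ℝ → ℂ := fun z => (Iio z.1.2).indicator (fun s => f (z.1.1, s)) z.2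
  rw [volume_restrict_plate] at hf
  have hπ : MeasurePreserving (fun z : Space × ℝ => (z.1.1, z.2))
      (((volume.restrict S).prod (volume.restrict interval)).prod (volume.restrict interval))
      ((volume.restrict S).prod (volume.restrict interval)) :=
    measurePreserving_fst.prod (MeasurePreserving.id _)
  have hH : MemLp H 2
      (((volume.restrict S).prod (volume.restrict interval)).prod (volume.restrict interval)) := by
    have h1 := hf.comp_measurePreserving hπ
    have hms : MeasurableSet {z : Space × ℝ | z.2 < z.1.2} :=
      measurableSet_lt measurable_snd (measurable_snd.comp measurable_fst)
    refine (h1.indicator hms).ae_eq (Eventually.of_forall fun z => ?_)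
    by_cases hz : z.2 < z.1.2 <;> simp [H, hz]
  have hF := memLp_integral_fiber hH
  refine ⟨_, by rwa [volume_restrict_plate], fun φ hφ hφc hφΩ => ?_⟩
  have hd := continuous_fderiv_apply hφ (e3 2)
  have hd2 : MemLp (fun x => ((fderiv ℝ φ x (e3 2) : ℝ) : ℂ)) 2
      ((volume.restrict S).prod (volume.restrict interval)) := by
    rw [← volume_restrict_plate]
    exact (hd.memLp_of_hasCompactSupport (hφc.fderiv_apply ℝ _)).ofReal
  have hφ2 : MemLp (fun x => (φ x : ℂ)) 2
      ((volume.restrict S).prod (volume.restrict interval)) := by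
    rw [← volume_restrict_plate]
    exact (hφ.continuous.memLp_of_hasCompactSupport hφc).ofReal
  have hi1 : Integrable (fun x => (∫ s in interval, H (x, s)) * ((fderiv ℝ φ x (e3 2) : ℝ) : ℂ))
      ((volume.restrict S).prod (volume.restrict interval)) := hF.integrable_mul hd2
  have hi2 : Integrable (fun x => f x * (φ x : ℂ))
      ((volume.restrict S).prod (volume.restrict interval)) := hf.integrable_mul hφ2
  rw [volume_restrict_plate, integral_prod _ hi1, integral_prod _ hi2, ← integral_neg]
  refine integral_congr_ae ?_
  filter_upwards [ae_memLp_slice hf] with x' hx'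
  exact integral_primitive_mul_deriv (hx'.integrable one_le_two)
    (fun s => hasDerivAt_vertical hφ x' s) (hd.comp (by fun_prop))
    (eq_zero_of_notMem_plate hφΩ (by simp [plate]))

theorem exists_primitive (S : Set Plane)
    (f : Lp ℂ 2 ((volume : Measure Space).restrict (plate S))) :
    ∃ F : Lp ℂ 2 ((volume : Measure Space).restrict (plate S)),
      HasWeakDerivC (plate S) (e3 2) F f := by
  obtain ⟨F, hF, h⟩ := exists_primitive_of_memLp S (Lp.memLp f)
  refine ⟨hF.toLp F, fun φ h1 h2 h3 => ?_⟩
  rw [← h φ h1 h2 h3]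
  refine integral_congr_ae ?_
  filter_upwards [hF.coeFn_toLp] with x hx
  rw [hx]

/-- A smooth function has a smooth primitive with respect to the last variable. -/
lemma contDiff_primitive {φ : Space → ℝ} (hφ : ContDiff ℝ ∞ φ)
    (h0 : ∀ p s, s ∉ interval → φ (p, s) = 0) :
    ContDiff ℝ ∞ (fun q : Space => ∫ s in (-(1 / 2) : ℝ)..q.2, φ (q.1, s)) := by
  -- The primitive is the convolution in the last variable with the Heaviside function, so
  -- smoothness follows from that of convolutions with a parameter.
  have hloc : LocallyIntegrable ((Ioi (0 : ℝ)).indicator fun _ => (1 : ℝ)) volume :=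
    (locallyIntegrable_const (1 : ℝ)).indicator measurableSet_Ioi
  have h := contDiffOn_convolution_right_with_param (n := ⊤) (ContinuousLinearMap.mul ℝ ℝ)
    (g := fun p s => φ (p, s)) (s := (univ : Set Plane)) isOpen_univ
    (isCompact_Icc (a := (-(1 / 2) : ℝ)) (b := 1 / 2))
    (fun p s _ hs => h0 p s fun h' => hs (Ioo_subset_Icc_self h')) hloc
    (hφ.contDiffOn : ContDiffOn ℝ _ _ _)
  rw [univ_prod_univ, contDiffOn_univ] at h
  convert h using 2 with q
  rw [convolution_def]
  have hcont : Continuous fun s => φ (q.1, s) := hφ.continuous.comp (by fun_prop)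
  have hcs : HasCompactSupport fun s => φ (q.1, s) :=
    HasCompactSupport.intro (isCompact_Icc (a := (-(1 / 2) : ℝ)) (b := 1 / 2))
      fun s hs => h0 _ s fun h' => hs (Ioo_subset_Icc_self h')
  have hInt : Integrable fun s => φ (q.1, s) := hcont.integrable_of_hasCompactSupport hcs
  have h1 : ∫ t, (ContinuousLinearMap.mul ℝ ℝ) ((Ioi (0 : ℝ)).indicator (fun _ => (1 : ℝ)) t)
      (φ (q.1, q.2 - t)) = ∫ s, (Iio q.2).indicator (fun s => φ (q.1, s)) s := by
    rw [← integral_sub_left_eq_self (fun s => (Iio q.2).indicator (fun s => φ (q.1, s)) s)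
      volume q.2]
    refine integral_congr_ae (Eventually.of_forall fun t => ?_)
    by_cases ht : 0 < t <;> simp [ht]
  rw [h1, integral_indicator measurableSet_Iio, ← integral_Iic_eq_integral_Iio,
    ← intervalIntegral.integral_Iic_sub_Iic (a := (-(1 / 2) : ℝ)) hInt.integrableOn
      hInt.integrableOn,
    setIntegral_eq_zero_of_forall_eq_zero (t := Iic (-(1 / 2) : ℝ)), sub_zero]
  exact fun s hs => h0 _ s fun h' => absurd h'.1 (not_lt.2 hs)

lemma exists_unit_bump : ∃ η : ℝ → ℝ, ContDiff ℝ ∞ η ∧ HasCompactSupport η ∧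
    tsupport η ⊆ interval ∧ ∫ s in interval, η s = 1 := by
  let b : ContDiffBump (0 : ℝ) := ⟨1 / 8, 1 / 4, by norm_num, by norm_num⟩
  have hsub : tsupport (b.normed volume) ⊆ interval := by
    rw [b.tsupport_normed_eq, Real.closedBall_eq_Icc]
    exact Icc_subset_Ioo (by norm_num [b]) (by norm_num [b])
  refine ⟨b.normed volume, b.contDiff_normed, b.hasCompactSupport_normed, hsub, ?_⟩
  rw [setIntegral_eq_integral_of_forall_compl_eq_zero, b.integral_normed]
  exact fun s hs => image_eq_zero_of_notMem_tsupport fun h => hs (hsub h)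

lemma exists_Icc_of_isCompact {C : Set ℝ} (hC : IsCompact C) (h : C ⊆ interval) :
    ∃ a b, -(1 / 2) < a ∧ b < 1 / 2 ∧ C ⊆ Icc a b := by
  -- The point `0` makes the set nonempty, so that it has a least and a greatest element.
  have hC' : IsCompact (insert 0 C) := hC.insert 0
  have h' : insert 0 C ⊆ interval := insert_subset (by norm_num [interval]) h
  obtain ⟨a, ha, ha'⟩ := hC'.exists_isLeast ⟨0, mem_insert _ _⟩
  obtain ⟨b, hb, hb'⟩ := hC'.exists_isGreatest ⟨0, mem_insert _ _⟩
  exact ⟨a, b, (h' ha).1, (h' hb).2, fun x hx =>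
    ⟨ha' (mem_insert_of_mem _ hx), hb' (mem_insert_of_mem _ hx)⟩⟩

/-- The part of a test function with vanishing vertical mean is the vertical derivative of a
test function. -/
lemma exists_vertical_primitive {S : Set Plane} {φ : Space → ℝ} (hφ : ContDiff ℝ ∞ φ)
    (hφc : HasCompactSupport φ) (hφS : tsupport φ ⊆ plate S) {η : ℝ → ℝ} (hη : ContDiff ℝ ∞ η)
    (hηc : HasCompactSupport η) (hηI : tsupport η ⊆ interval) (hη1 : ∫ s in interval, η s = 1) :
    ∃ Φ : Space → ℝ, ContDiff ℝ ∞ Φ ∧ HasCompactSupport Φ ∧ tsupport Φ ⊆ plate S ∧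
      ∀ x, fderiv ℝ Φ x (e3 2) = φ x - (∫ s in interval, φ (x.1, s)) * η x.2 := by
  have hφ0 : ∀ p s, s ∉ interval → φ (p, s) = 0 := fun p s hs =>
    eq_zero_of_notMem_plate hφS fun h => hs h.2
  have hη0 : ∀ s, s ∉ interval → η s = 0 := fun s hs =>
    image_eq_zero_of_notMem_tsupport fun h => hs (hηI h)
  let P : Space → ℝ := fun q => ∫ s in (-(1 / 2) : ℝ)..q.2, φ (q.1, s)
  let Q : Space → ℝ := fun q => ∫ s in (-(1 / 2) : ℝ)..q.2, η s
  have hP : ContDiff ℝ ∞ P := contDiff_primitive hφ hφ0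
  have hηs : ContDiff ℝ ∞ fun x : Space => η x.2 := hη.comp contDiff_snd
  have hQ : ContDiff ℝ ∞ Q := contDiff_primitive hηs fun _ s hs => hη0 s hs
  -- Subtracting the total integral of `φ (p, ·)` times the primitive of `η` makes `Φ` vanish above
  -- the supports as well as below: there `P` equals its value at `1/2` and `Q` equals `1`.
  let Φ : Space → ℝ := fun q => P q - P (q.1, 1 / 2) * Q q
  have hΦ : ContDiff ℝ ∞ Φ :=
    hP.sub ((hP.comp (contDiff_fst.prodMk contDiff_const)).mul hQ)
  have hmean : ∀ p, P (p, 1 / 2) = ∫ s in interval, φ (p, s) := fun p =>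
    (setIntegral_interval _).symm
  obtain ⟨a, b, ha, hb, hab⟩ := exists_Icc_of_isCompact
    ((hφc.isCompact.image continuous_snd).union hηc.isCompact)
    (union_subset (by rintro _ ⟨x, hx, rfl⟩; exact (hφS hx).2) hηI)
  have hφab : ∀ p s, s ∉ Icc a b → φ (p, s) = 0 := fun p s hs =>
    image_eq_zero_of_notMem_tsupport fun h => hs (hab (Or.inl ⟨_, h, rfl⟩))
  have hηab : ∀ s, s ∉ Icc a b → η s = 0 := fun s hs =>
    image_eq_zero_of_notMem_tsupport fun h => hs (hab (Or.inr h))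
  have hlow : ∀ (g : ℝ → ℝ), (∀ s, s ∉ Icc a b → g s = 0) → ∀ r, r < a →
      ∫ s in (-(1 / 2) : ℝ)..r, g s = 0 := by
    intro g hg r hr
    refine intervalIntegral.integral_zero_ae (Eventually.of_forall fun s hs => hg s fun h => ?_)
    rcases le_total (-(1 / 2)) r with h1 | h1
    · rw [uIoc_of_le h1] at hs
      linarith [hs.2, h.1]
    · rw [uIoc_of_ge h1] at hs
      linarith [hs.2, h.1]
  have hhigh : ∀ (g : ℝ → ℝ), Continuous g → (∀ s, s ∉ Icc a b → g s = 0) → ∀ r, b < r →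
      ∫ s in (-(1 / 2) : ℝ)..r, g s = ∫ s in (-(1 / 2) : ℝ)..(1 / 2), g s := by
    intro g hgc hg r hr
    rw [← sub_eq_zero, intervalIntegral.integral_interval_sub_left (hgc.intervalIntegrable _ _)
      (hgc.intervalIntegrable _ _)]
    refine intervalIntegral.integral_zero_ae (Eventually.of_forall fun s hs => hg s fun h => ?_)
    rcases le_total (1 / 2) r with h1 | h1
    · rw [uIoc_of_le h1] at hs
      linarith [hs.1, h.2]
    · rw [uIoc_of_ge h1] at hs
      linarith [hs.1, h.2]
  have hη1' : ∫ s in (-(1 / 2) : ℝ)..(1 / 2), η s = 1 := by rw [← setIntegral_interval, hη1]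
  have hzero : ∀ x, x ∉ (Prod.fst '' tsupport φ) ×ˢ Icc a b → Φ x = 0 := by
    rintro ⟨p, r⟩ hx
    by_cases hp : p ∈ Prod.fst '' tsupport φ
    · have hr : r ∉ Icc a b := fun h => hx ⟨hp, h⟩
      rw [mem_Icc, not_and_or, not_le, not_le] at hr
      rcases hr with hr | hr
      · simp only [Φ, P, Q]
        rw [hlow _ (hφab p) r hr, hlow _ hηab r hr]
        ring
      · simp only [Φ, P, Q]
        rw [hhigh (fun s => φ (p, s)) (hφ.continuous.comp (by fun_prop)) (hφab p) r hr,
          hhigh _ hη.continuous hηab r hr, hη1']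
        ring
    · have h0 : ∀ s, φ (p, s) = 0 := fun s =>
        image_eq_zero_of_notMem_tsupport fun h => hp ⟨_, h, rfl⟩
      simp [Φ, P, h0]
  have hcpt : IsCompact ((Prod.fst '' tsupport φ) ×ˢ Icc a b) :=
    (hφc.isCompact.image continuous_fst).prod isCompact_Icc
  refine ⟨Φ, hΦ, HasCompactSupport.intro hcpt hzero, ?_, fun x => ?_⟩
  · refine (closure_minimal ?_ hcpt.isClosed).trans ?_
    · intro x hx
      by_contra h
      exact hx (hzero x h)
    · rintro ⟨p, r⟩ ⟨⟨x, hx, rfl⟩, hr⟩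
      exact ⟨(hφS hx).1, ha.trans_le hr.1, hr.2.trans_lt hb⟩
  · obtain ⟨p, r⟩ := x
    have h1 := hasDerivAt_vertical hΦ p r
    have hprim : ∀ g : ℝ → ℝ, Continuous g →
        HasDerivAt (fun r => ∫ s in (-(1 / 2) : ℝ)..r, g s) (g r) r := fun g hg =>
      intervalIntegral.integral_hasDerivAt_right (hg.intervalIntegrable _ _)
        (hg.stronglyMeasurableAtFilter _ _) hg.continuousAt
    have h2 : HasDerivAt (fun r => Φ (p, r)) (φ (p, r) - P (p, 1 / 2) * η r) r :=
      (hprim _ (hφ.continuous.comp (by fun_prop : Continuous fun s : ℝ => (p, s)))).sub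
        ((hprim η hη.continuous).const_mul (P (p, 1 / 2)))
    rw [h1.unique h2, hmean]

end Interval

/-! ### Functions with vanishing vertical derivative. -/

section VerticalMean

lemma ae_eq_zero_of_forall_test {F : Type*} [NormedAddCommGroup F] [NormedSpace ℝ F]
    [CompleteSpace F] {E : Type*} [NormedAddCommGroup E] [NormedSpace ℝ E]
    [FiniteDimensional ℝ E] [MeasureSpace E] [BorelSpace E]
    [IsLocallyFiniteMeasure (volume : Measure E)] {U : Set E} (hU : IsOpen U) {f : E → F}
    (hf : MemLp f 2 (volume.restrict U))
    (h : ∀ φ : E → ℝ, ContDiff ℝ ∞ φ → HasCompactSupport φ → tsupport φ ⊆ U →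
      ∫ x in U, φ x • f x = 0) : ∀ᵐ x ∂(volume.restrict U), f x = 0 := by
  rw [ae_restrict_iff' hU.measurableSet]
  refine hU.ae_eq_zero_of_integral_contDiff_smul_eq_zero
    (locallyIntegrableOn_of_locallyIntegrable_restrict (hf.locallyIntegrable one_le_two))
    fun φ h1 h2 h3 => ?_
  rw [← h φ h1 h2 h3]
  symm
  refine setIntegral_eq_integral_of_forall_compl_eq_zero fun x hx => ?_
  rw [image_eq_zero_of_notMem_tsupport fun h' => hx (h3 h'), zero_smul]

variable {S : Set Plane} {η : ℝ → ℝ}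

lemma memLp_vertical_mean {f : Space → ℝ} (hf : MemLp f 2 (volume.restrict (plate S)))
    (hη : Continuous η) (hηc : HasCompactSupport η) :
    MemLp (fun x' => ∫ s in interval, f (x', s) * η s) 2 (volume.restrict S) := by
  rw [volume_restrict_plate] at hf
  obtain ⟨M, hM⟩ := hη.bounded_above_of_compact_support hηc
  refine memLp_integral_fiber (h := fun x : Space => f x * η x.2) ?_
  refine hf.of_le_mul (c := M) (hf.1.mul (hη.comp continuous_snd).aestronglyMeasurable)
    (Eventually.of_forall fun x => ?_)
  rw [norm_mul, mul_comm]
  gcongr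
  exact hM x.2

/-- A function with vanishing weak vertical derivative is equal to its weighted vertical mean. -/
theorem ae_eq_vertical_mean (hS : IsOpen S) (hη : ContDiff ℝ ∞ η)
    (hηc : HasCompactSupport η) (hηI : tsupport η ⊆ interval) (hη1 : ∫ s in interval, η s = 1)
    {f : Space → ℝ} (hf : MemLp f 2 (volume.restrict (plate S)))
    (h : ∀ φ : Space → ℝ, ContDiff ℝ ∞ φ → HasCompactSupport φ → tsupport φ ⊆ plate S →
      ∫ x in plate S, f x * fderiv ℝ φ x (e3 2) = 0) :
    ∀ᵐ x ∂(volume.restrict (plate S)), f x = ∫ s in interval, f (x.1, s) * η s := by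
  let m : Plane → ℝ := fun x' => ∫ s in interval, f (x', s) * η s
  have hm : MemLp m 2 (volume.restrict S) := memLp_vertical_mean hf hη.continuous hηc
  have hm' : MemLp (fun x : Space => m x.1) 2 (volume.restrict (plate S)) := by
    rw [volume_restrict_plate]
    exact hm.comp_measurePreserving measurePreserving_fst
  have key := ae_eq_zero_of_forall_test (isOpen_plate hS) (hf.sub hm') fun φ h1 h2 h3 => by
    obtain ⟨Φ, hΦ, hΦc, hΦS, hΦd⟩ := exists_vertical_primitive h1 h2 h3 hη hηc hηI hη1
    have hz := h Φ hΦ hΦc hΦS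
    have hφ2 : MemLp φ 2 (volume.restrict (plate S)) :=
      h1.continuous.memLp_of_hasCompactSupport h2
    have hΦ2 : MemLp (fun x => fderiv ℝ Φ x (e3 2)) 2 (volume.restrict (plate S)) :=
      (continuous_fderiv_apply hΦ _).memLp_of_hasCompactSupport (hΦc.fderiv_apply ℝ _)
    have i1 : Integrable (fun x => f x * φ x) (volume.restrict (plate S)) :=
      hf.integrable_mul hφ2
    have i2 : Integrable (fun x => f x * fderiv ℝ Φ x (e3 2)) (volume.restrict (plate S)) :=
      hf.integrable_mul hΦ2
    have i3 : Integrable (fun x => m x.1 * φ x) (volume.restrict (plate S)) :=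
      hm'.integrable_mul hφ2
    have i4 : Integrable (fun x => f x * ((∫ s in interval, φ (x.1, s)) * η x.2))
        (volume.restrict (plate S)) := by
      refine (i1.sub i2).congr (Eventually.of_forall fun x => ?_)
      simp only [Pi.sub_apply, hΦd]
      ring
    -- The difference of the two sides is the pairing of `f` with `∂₃Φ`, which vanishes by
    -- hypothesis.
    have e1 : ∫ x in plate S, f x * φ x
        = ∫ x in plate S, f x * ((∫ s in interval, φ (x.1, s)) * η x.2) := by
      rw [← sub_eq_zero, ← integral_sub i1 i4, ← hz]
      refine integral_congr_ae (Eventually.of_forall fun x => ?_)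
      simp only [hΦd]
      ring
    -- By Fubini the weight `η` passes from the vertical mean of `φ` to that of `f`.
    have e2 : ∫ x in plate S, f x * ((∫ s in interval, φ (x.1, s)) * η x.2)
        = ∫ x in plate S, m x.1 * φ x := by
      rw [volume_restrict_plate] at i3 i4 ⊢
      rw [integral_prod _ i4, integral_prod _ i3]
      refine integral_congr_ae (Eventually.of_forall fun x' => ?_)
      simp only [m]
      rw [integral_const_mul, mul_comm, ← integral_const_mul]
      refine integral_congr_ae (Eventually.of_forall fun s => ?_)
      dsimp only
      ring
    have : ∀ x, φ x • (f - fun x : Space => m x.1) x = f x * φ x - m x.1 * φ x := fun x => by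
      simp only [Pi.sub_apply, smul_eq_mul]
      ring
    simp_rw [this]
    rw [integral_sub i1 i3, e1, e2, sub_self]
  filter_upwards [key] with x hx
  exact sub_eq_zero.1 hx

lemma fderiv_fderiv_comm {φ : Space → ℝ} (hφ : ContDiff ℝ ∞ φ) (x v w : Space) :
    fderiv ℝ (fun y => fderiv ℝ φ y v) x w = fderiv ℝ (fun y => fderiv ℝ φ y w) x v := by
  have hd : DifferentiableAt ℝ (fderiv ℝ φ) x :=
    (hφ.fderiv_right (m := 1) (by norm_cast)).differentiable one_ne_zero x
  have hsymm : IsSymmSndFDerivAt ℝ φ x :=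
    hφ.contDiffAt.isSymmSndFDerivAt (by rw [minSmoothness_of_isRCLikeNormedField]; norm_cast)
  rw [fderiv_clm_apply hd (differentiableAt_const v), fderiv_clm_apply hd (differentiableAt_const w)]
  simpa using hsymm w v

/-- An `H¹` function on the plate with vanishing vertical derivative is an `H¹` function of the
in-plane variables. -/
theorem exists_planar (hS : IsOpen S) {f : Space → Fin 3 → ℝ} {Df : Space → Fin 3 → Fin 3 → ℝ}
    (hf : IsH1 e3 (plate S) f Df)
    (h : ∀ i, ∀ φ : Space → ℝ, ContDiff ℝ ∞ φ → HasCompactSupport φ → tsupport φ ⊆ plate S →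
      ∫ x in plate S, Df x i 2 * φ x = 0) :
    ∃ (u0 : Plane → Fin 3 → ℝ) (Du0 : Plane → Fin 3 → Fin 2 → ℝ), IsH1 e2 S u0 Du0 ∧
      (∀ᵐ x ∂(volume.restrict (plate S)), f x = u0 x.1) ∧
      ∀ i j, ∀ᵐ x ∂(volume.restrict (plate S)), Df x i (Fin.castSucc j) = Du0 x.1 i j := by
  obtain ⟨η, hη, hηc, hηI, hη1⟩ := exists_unit_bump
  have he : ∀ j : Fin 2, e3 (Fin.castSucc j) = (e2 j, 0) := fun j => by
    fin_cases j <;> rfl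
  have hf3 : ∀ i, ∀ φ : Space → ℝ, ContDiff ℝ ∞ φ → HasCompactSupport φ → tsupport φ ⊆ plate S →
      ∫ x in plate S, f x i * fderiv ℝ φ x (e3 2) = 0 := fun i φ h1 h2 h3 => by
    rw [hf.weak_grad i 2 φ h1 h2 h3, h i φ h1 h2 h3, neg_zero]
  -- The gradient has no vertical derivative either: on the test function `∂_j` and `∂₃` commute,
  -- and `f` is already known to be annihilated by `∂₃` of test functions.
  have hDf3 : ∀ i j, ∀ φ : Space → ℝ, ContDiff ℝ ∞ φ → HasCompactSupport φ →
      tsupport φ ⊆ plate S → ∫ x in plate S, Df x i j * fderiv ℝ φ x (e3 2) = 0 :=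
    fun i j φ h1 h2 h3 => by
      have hsub : ∀ v, tsupport (fun x => fderiv ℝ φ x v) ⊆ plate S := fun v =>
        (tsupport_fderiv_apply_subset ℝ v).trans h3
      have a1 := hf.weak_grad i j _ (contDiff_fderiv_apply h1 (e3 2)) (h2.fderiv_apply ℝ _) (hsub _)
      have a2 := hf3 i _ (contDiff_fderiv_apply h1 (e3 j)) (h2.fderiv_apply ℝ _) (hsub _)
      simp_rw [fderiv_fderiv_comm h1 _ (e3 2) (e3 j)] at a1
      rw [a2] at a1
      linarith
  refine ⟨fun x' i => ∫ s in interval, f (x', s) i * η s,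
    fun x' i j => ∫ s in interval, Df (x', s) i (Fin.castSucc j) * η s, ⟨fun i => ?_,
    fun i j => ?_, fun i j α hα hαc hαS => ?_⟩, ?_, fun i j => ?_⟩
  · exact memLp_vertical_mean (hf.memLp i) hη.continuous hηc
  · exact memLp_vertical_mean (hf.memLp_grad i _) hη.continuous hηc
  · let φ : Space → ℝ := fun x => α x.1 * η x.2
    have hφ : ContDiff ℝ ∞ φ := (hα.comp contDiff_fst).mul (hη.comp contDiff_snd)
    have hsupp : ∀ x, x ∉ tsupport α ×ˢ tsupport η → φ x = 0 := by
      intro x hx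
      by_cases h1 : x.1 ∈ tsupport α
      · have h2 : x.2 ∉ tsupport η := fun h2 => hx ⟨h1, h2⟩
        simp [φ, image_eq_zero_of_notMem_tsupport h2]
      · simp [φ, image_eq_zero_of_notMem_tsupport h1]
    have hcpt : IsCompact (tsupport α ×ˢ tsupport η) := hαc.isCompact.prod hηc.isCompact
    have hφc : HasCompactSupport φ := HasCompactSupport.intro hcpt hsupp
    have hφS : tsupport φ ⊆ plate S := by
      refine (closure_minimal ?_ hcpt.isClosed).trans (prod_mono hαS hηI)
      intro x hx
      by_contra h'
      exact hx (hsupp x h')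
    have hder : ∀ x, fderiv ℝ φ x (e3 (Fin.castSucc j)) = fderiv ℝ α x.1 (e2 j) * η x.2 := by
      intro x
      have d1 : HasFDerivAt (fun x : Space => α x.1)
          ((fderiv ℝ α x.1).comp (ContinuousLinearMap.fst ℝ Plane ℝ)) x :=
        (hα.differentiable (by simp) x.1).hasFDerivAt.comp x hasFDerivAt_fst
      have d2 : HasFDerivAt (fun x : Space => η x.2)
          ((fderiv ℝ η x.2).comp (ContinuousLinearMap.snd ℝ Plane ℝ)) x :=
        (hη.differentiable (by simp) x.2).hasFDerivAt.comp x hasFDerivAt_snd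
      have d3 : fderiv ℝ φ x = _ := (d1.mul d2).fderiv
      rw [d3, he]
      simp
      ring
    have hw := hf.weak_grad i (Fin.castSucc j) φ hφ hφc hφS
    simp_rw [hder] at hw
    have i1 : Integrable (fun x : Space => f x i * (fderiv ℝ α x.1 (e2 j) * η x.2))
        (volume.restrict (plate S)) := by
      simp_rw [← hder]
      have hd2 : MemLp (fun x => fderiv ℝ φ x (e3 (Fin.castSucc j))) 2
          (volume.restrict (plate S)) :=
        (continuous_fderiv_apply hφ _).memLp_of_hasCompactSupport (hφc.fderiv_apply ℝ _)
      exact (hf.memLp i).integrable_mul hd2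
    have i2 : Integrable (fun x : Space => Df x i (Fin.castSucc j) * φ x)
        (volume.restrict (plate S)) := by
      have hφ2 : MemLp φ 2 (volume.restrict (plate S)) :=
        hφ.continuous.memLp_of_hasCompactSupport hφc
      exact (hf.memLp_grad i _).integrable_mul hφ2
    rw [volume_restrict_plate] at hw i1 i2
    rw [integral_prod _ i1, integral_prod _ i2] at hw
    refine Eq.trans ?_ (hw.trans ?_)
    · refine integral_congr_ae (Eventually.of_forall fun x' => ?_)
      dsimp only
      rw [← integral_mul_const]
      refine integral_congr_ae (Eventually.of_forall fun s => ?_)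
      dsimp only
      ring
    · congr 1
      refine integral_congr_ae (Eventually.of_forall fun x' => ?_)
      dsimp only
      rw [← integral_mul_const]
      refine integral_congr_ae (Eventually.of_forall fun s => ?_)
      dsimp only [φ]
      ring
  · have := fun i => ae_eq_vertical_mean hS hη hηc hηI hη1 (hf.memLp i) (hf3 i)
    filter_upwards [ae_all_iff.2 this] with x hx
    ext i
    exact hx i
  · exact ae_eq_vertical_mean hS hη hηc hηI hη1 (hf.memLp_grad i _) (hDf3 i _)

end VerticalMean

/-! ### Integration by parts against oscillating test functions. -/

section Oscillation

/-- Smooth functions with compact support in `Ω`. -/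
structure IsTest (Ω : Set Space) (φ : Space → ℝ) : Prop where
  contDiff : ContDiff ℝ ∞ φ
  hasCompactSupport : HasCompactSupport φ
  tsupport_subset : tsupport φ ⊆ Ω

variable {Ω : Set Space}

lemma IsTest.fderiv {φ : Space → ℝ} (h : IsTest Ω φ) (v : Space) :
    IsTest Ω fun x => fderiv ℝ φ x v :=
  ⟨contDiff_fderiv_apply h.contDiff v, h.hasCompactSupport.fderiv_apply ℝ v,
    (tsupport_fderiv_apply_subset ℝ v).trans h.tsupport_subset⟩

lemma IsTest.memLp {φ : Space → ℝ} (h : IsTest Ω φ) : MemLp φ 2 (volume.restrict Ω) :=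
  h.contDiff.continuous.memLp_of_hasCompactSupport h.hasCompactSupport

lemma integrable_osc {f φ : Space → ℝ} (hf : MemLp f 2 (volume.restrict Ω))
    (hφ : MemLp φ 2 (volume.restrict Ω)) (l : Space →L[ℝ] ℝ) :
    Integrable (fun x => (f x : ℂ) * φ x * planeWave l x) (volume.restrict Ω) := by
  have h1 : Integrable (fun x => (f x : ℂ) * (φ x : ℂ)) (volume.restrict Ω) :=
    hf.ofReal.integrable_mul hφ.ofReal
  exact h1.mul_bdd (continuous_planeWave l).aestronglyMeasurable
    (Eventually.of_forall fun x => (norm_planeWave l x).le)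

/-- The crude bound `|f φ| ≤ f ^ 2 + φ ^ 2` suffices; what matters is uniformity in the frequency
`l`. -/
lemma norm_oscIntegral_le {f φ : Space → ℝ} (hf : MemLp f 2 (volume.restrict Ω))
    (hφ : MemLp φ 2 (volume.restrict Ω)) (l : Space →L[ℝ] ℝ) :
    ‖oscIntegral Ω f φ l‖ ≤ (∫ x in Ω, f x ^ 2) + ∫ x in Ω, φ x ^ 2 := by
  rw [oscIntegral, ← integral_add hf.integrable_sq hφ.integrable_sq]
  refine norm_integral_le_of_norm_le (hf.integrable_sq.add hφ.integrable_sq)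
    (Eventually.of_forall fun x => ?_)
  rw [norm_mul, norm_mul, norm_planeWave, mul_one, Complex.norm_real, Complex.norm_real,
    Real.norm_eq_abs, Real.norm_eq_abs]
  have h1 := sq_nonneg (|f x| - |φ x|)
  have h2 := sq_abs (f x)
  have h3 := sq_abs (φ x)
  nlinarith [sq_nonneg (|f x| + |φ x|)]

lemma oscIntegral_const_mul (r : ℝ) (f φ : Space → ℝ) (l : Space →L[ℝ] ℝ) :
    oscIntegral Ω (fun x => r * f x) φ l = r * oscIntegral Ω f φ l := by
  rw [oscIntegral, oscIntegral, ← integral_const_mul]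
  refine integral_congr_ae (Eventually.of_forall fun x => ?_)
  push_cast
  ring

/-- Integration by parts against an oscillating test function. -/
lemma oscIntegral_ibp {f g φ : Space → ℝ} {v : Space} (hf : MemLp f 2 (volume.restrict Ω))
    (hg : MemLp g 2 (volume.restrict Ω)) (hφ : IsTest Ω φ) (h : HasWeakDeriv Ω v f g)
    (l : Space →L[ℝ] ℝ) :
    2 * Real.pi * Complex.I * (l v : ℝ) * oscIntegral Ω f φ l
      = -oscIntegral Ω g φ l - oscIntegral Ω f (fun x => fderiv ℝ φ x v) l := by
  let D : Space → ℂ := fun x =>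
    (fderiv ℝ φ x v : ℝ) * planeWave l x + 2 * Real.pi * Complex.I * (l v : ℝ) * φ x * planeWave l x
  -- Weak derivatives are tested with real functions only, so a real-linear functional `L` is
  -- applied to `φ` times the wave. The choices `L = Re` and `L = Im` recover the complex identity.
  have hpart : ∀ L : ℂ →L[ℝ] ℝ,
      ∫ x in Ω, f x * L (D x) = -∫ x in Ω, g x * L (φ x * planeWave l x) := by
    intro L
    let Φ : Space → ℝ := fun x => L (φ x * planeWave l x)
    have hΦ : ContDiff ℝ ∞ Φ := L.contDiff.comp
      ((Complex.ofRealCLM.contDiff.comp hφ.contDiff).mul (contDiff_planeWave l))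
    have hzero : ∀ x, x ∉ tsupport φ → Φ x = 0 := fun x hx => by
      simp [Φ, image_eq_zero_of_notMem_tsupport hx]
    have hder : ∀ x, fderiv ℝ Φ x v = L (D x) := by
      intro x
      have d1 : HasFDerivAt (fun x => (φ x : ℂ)) (Complex.ofRealCLM.comp (fderiv ℝ φ x)) x :=
        Complex.ofRealCLM.hasFDerivAt.comp x
          (hφ.contDiff.differentiable (by simp) x).hasFDerivAt
      have d2 : HasFDerivAt (planeWave l) (fderiv ℝ (planeWave l) x) x :=
        ((contDiff_planeWave l (n := 1)).differentiable one_ne_zero x).hasFDerivAt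
      have d3 : fderiv ℝ Φ x = _ := (L.hasFDerivAt.comp x (d1.mul d2)).fderiv
      rw [d3]
      simp only [ContinuousLinearMap.comp_apply, add_apply, smul_apply, D, fderiv_planeWave,
        smul_eq_mul, Complex.ofRealCLM_apply]
      congr 1
      ring
    have := h Φ hΦ (HasCompactSupport.intro hφ.hasCompactSupport.isCompact hzero)
      ((closure_minimal (fun x hx => by by_contra h'; exact hx (hzero x h'))
        (isClosed_tsupport φ)).trans hφ.tsupport_subset)
    simp_rw [hder] at this
    exact this
  have i1 := integrable_osc hf (hφ.fderiv v).memLp l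
  have i2 := integrable_osc hf hφ.memLp l
  have i3 := integrable_osc hg hφ.memLp l
  have iD : Integrable (fun x => (f x : ℂ) * D x) (volume.restrict Ω) := by
    refine (i1.add (i2.const_mul (2 * Real.pi * Complex.I * (l v : ℝ)))).congr
      (Eventually.of_forall fun x => ?_)
    simp only [D, Pi.add_apply]
    ring
  have hfD : ∫ x in Ω, (f x : ℂ) * D x = -oscIntegral Ω g φ l := by
    have hmul : ∀ (r : ℝ) (z : ℂ) (L : ℂ →L[ℝ] ℝ), L (r * z) = r * L z := fun r z L => by
      rw [← Complex.real_smul, map_smul, smul_eq_mul]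
    have hL : ∀ L : ℂ →L[ℝ] ℝ, L (∫ x in Ω, (f x : ℂ) * D x) = L (-oscIntegral Ω g φ l) := by
      intro L
      rw [← L.integral_comp_comm iD, map_neg, oscIntegral, ← L.integral_comp_comm i3]
      simp_rw [mul_assoc, hmul]
      have := hpart L
      simp_rw [hmul] at this
      exact this
    exact Complex.ext (hL Complex.reCLM) (hL Complex.imCLM)
  have hsplit : ∫ x in Ω, (f x : ℂ) * D x = oscIntegral Ω f (fun x => fderiv ℝ φ x v) l
      + 2 * Real.pi * Complex.I * (l v : ℝ) * oscIntegral Ω f φ l := by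
    rw [oscIntegral, oscIntegral, ← integral_const_mul, ← integral_add i1 (i2.const_mul _)]
    refine integral_congr_ae (Eventually.of_forall fun x => ?_)
    simp only [D]
    ring
  rw [hsplit] at hfD
  linear_combination hfD

end Oscillation

/-! ### Amplitudes tested with smooth functions. -/

section Pairing

variable {Ω : Set Space}

/-- The pairing of a mode with a test function. -/
noncomputable def pairing (c : Lp ℂ 2 ((volume : Measure Space).restrict Ω)) (φ : Space → ℝ) : ℂ :=
  ∫ x in Ω, starRingEnd ℂ (c x) * φ x

lemma pairing_eq_inner (c : Lp ℂ 2 ((volume : Measure Space).restrict Ω)) {φ : Space → ℝ}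
    (hφ : MemLp (fun x => (φ x : ℂ)) 2 (volume.restrict Ω)) :
    pairing c φ = inner ℂ c (hφ.toLp _) := by
  rw [L2.inner_def]
  refine integral_congr_ae ?_
  filter_upwards [hφ.coeFn_toLp] with x hx
  rw [hx, RCLike.inner_apply, mul_comm]

lemma pairing_smul (r : ℂ) (c : Lp ℂ 2 ((volume : Measure Space).restrict Ω)) {φ : Space → ℝ}
    (hφ : IsTest Ω φ) : pairing (r • c) φ = starRingEnd ℂ r * pairing c φ := by
  have h : MemLp (fun x => (φ x : ℂ)) 2 (volume.restrict Ω) := hφ.memLp.ofReal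
  rw [pairing_eq_inner _ h, pairing_eq_inner _ h, inner_smul_left]

lemma pairing_sub (c d : Lp ℂ 2 ((volume : Measure Space).restrict Ω)) {φ : Space → ℝ}
    (hφ : IsTest Ω φ) : pairing (c - d) φ = pairing c φ - pairing d φ := by
  have h : MemLp (fun x => (φ x : ℂ)) 2 (volume.restrict Ω) := hφ.memLp.ofReal
  rw [pairing_eq_inner _ h, pairing_eq_inner _ h, pairing_eq_inner _ h, inner_sub_left]

lemma eq_zero_of_pairing (hΩ : IsOpen Ω) {c : Lp ℂ 2 ((volume : Measure Space).restrict Ω)}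
    (h : ∀ φ, IsTest Ω φ → pairing c φ = 0) : c = 0 := by
  have hc : MemLp (fun x => starRingEnd ℂ (c x)) 2 (volume.restrict Ω) := (Lp.memLp c).star
  have key := ae_eq_zero_of_forall_test hΩ hc fun φ h1 h2 h3 => by
    rw [← h φ ⟨h1, h2, h3⟩, pairing]
    refine integral_congr_ae (Eventually.of_forall fun x => ?_)
    simp [mul_comm]
  rw [Lp.eq_zero_iff_ae_eq_zero]
  filter_upwards [key] with x hx
  simpa using hx

lemma eq_of_pairing (hΩ : IsOpen Ω) {c d : Lp ℂ 2 ((volume : Measure Space).restrict Ω)}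
    (h : ∀ φ, IsTest Ω φ → pairing c φ = pairing d φ) : c = d := by
  rw [← sub_eq_zero]
  refine eq_zero_of_pairing hΩ fun φ hφ => ?_
  rw [pairing_sub _ _ hφ, h φ hφ, sub_self]

end Pairing

/-! ### Asymptotic relations between the oscillating pairings of a scaled gradient. -/

section Relations

/-- A bounded sequence `w n` whose scaled gradients `G n` with respect to the thicknesses `t n`
are bounded. -/
structure ThinSequence (Ω : Set Space) (t : ℕ → ℝ) (w : ℕ → Space → ℝ)
    (G : Fin 3 → ℕ → Space → ℝ) (C : ℝ) : Prop where
  pos : ∀ n, 0 < t n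
  le : ∀ n, t n ≤ C
  one_le : 1 ≤ C
  memLp : ∀ n, MemLp (w n) 2 (volume.restrict Ω)
  memLp_grad : ∀ j n, MemLp (G j n) 2 (volume.restrict Ω)
  bound : ∀ n, ∫ x in Ω, w n x ^ 2 ≤ C
  bound_grad : ∀ j n, ∫ x in Ω, G j n x ^ 2 ≤ C
  weak : ∀ j n, HasWeakDeriv Ω (e3 j) (w n) (fun x => ![1, 1, t n] j * G j n x)

variable {Ω : Set Space} {t : ℕ → ℝ} {w : ℕ → Space → ℝ} {G : Fin 3 → ℕ → Space → ℝ} {C : ℝ}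
  {φ : Space → ℝ} {a b : ℕ → ℝ} {k : Mode}

namespace ThinSequence

/-- The identity from which all relations below are obtained by elimination. The factor `![1, 1, t
n] j` turns the scaled gradient back into the gradient. -/
lemma ibp (h : ThinSequence Ω t w G C) (hφ : IsTest Ω φ) (j : Fin 3) (n : ℕ) (a b : ℝ) (k : Mode) :
    2 * Real.pi * Complex.I * ((![a, a, b] j * k.entry j : ℝ) : ℂ)
        * oscIntegral Ω (w n) φ (phase a b k)
      = -((![1, 1, t n] j : ℝ) : ℂ) * oscIntegral Ω (G j n) φ (phase a b k)
        - oscIntegral Ω (w n) (fun x => fderiv ℝ φ x (e3 j)) (phase a b k) := by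
  have := oscIntegral_ibp (h.memLp n) ((h.memLp_grad j n).const_mul (![1, 1, t n] j)) hφ
    (h.weak j n) (phase a b k)
  rw [phase_e3, oscIntegral_const_mul] at this
  rw [this]
  ring

lemma exists_bound_w (h : ThinSequence Ω t w G C) (hφ : IsTest Ω φ) :
    ∃ M, ∀ n l, ‖oscIntegral Ω (w n) φ l‖ ≤ M :=
  ⟨C + ∫ x in Ω, φ x ^ 2, fun n l =>
    (norm_oscIntegral_le (h.memLp n) hφ.memLp l).trans (by gcongr; exact h.bound n)⟩

lemma exists_bound_G (h : ThinSequence Ω t w G C) (hφ : IsTest Ω φ) (j : Fin 3) :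
    ∃ M, ∀ n l, ‖oscIntegral Ω (G j n) φ l‖ ≤ M :=
  ⟨C + ∫ x in Ω, φ x ^ 2, fun n l =>
    (norm_oscIntegral_le (h.memLp_grad j n) hφ.memLp l).trans (by gcongr; exact h.bound_grad j n)⟩

/-- The right-hand side of `ibp` is bounded uniformly in the frequencies, so the pairing of `w n`
can absorb one factor of frequency. -/
lemma exists_bound_mul (h : ThinSequence Ω t w G C) (hφ : IsTest Ω φ) (j : Fin 3) (k : Mode) :
    ∃ M, ∀ n a b, ‖((![a, a, b] j * k.entry j : ℝ) : ℂ)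
      * oscIntegral Ω (w n) φ (phase a b k)‖ ≤ M := by
  obtain ⟨M₁, h1⟩ := h.exists_bound_G hφ j
  obtain ⟨M₂, h2⟩ := h.exists_bound_w (hφ.fderiv (e3 j))
  have hM : 0 ≤ C * M₁ + M₂ := add_nonneg
    (mul_nonneg (zero_le_one.trans h.one_le) ((norm_nonneg _).trans (h1 0 0)))
    ((norm_nonneg _).trans (h2 0 0))
  refine ⟨C * M₁ + M₂, fun n a b => ?_⟩
  have hσ : ‖((![1, 1, t n] j : ℝ) : ℂ)‖ ≤ C := by
    rw [Complex.norm_real]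
    fin_cases j
    · simpa using h.one_le
    · simpa using h.one_le
    · simpa [abs_of_pos (h.pos n)] using h.le n
  have hb : ‖2 * Real.pi * Complex.I * ((![a, a, b] j * k.entry j : ℝ) : ℂ)
        * oscIntegral Ω (w n) φ (phase a b k)‖ ≤ C * M₁ + M₂ := by
    rw [h.ibp hφ j n a b k]
    refine (norm_sub_le _ _).trans (add_le_add ?_ (h2 n _))
    rw [norm_mul, norm_neg]
    exact mul_le_mul hσ (h1 n _) (norm_nonneg _) (zero_le_one.trans h.one_le)
  rw [mul_assoc, norm_mul] at hb
  have hpi : 1 ≤ ‖(2 * Real.pi * Complex.I : ℂ)‖ := by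
    simp only [norm_mul, Complex.norm_ofNat, Complex.norm_real, Complex.norm_I, mul_one,
      Real.norm_eq_abs, abs_of_pos Real.pi_pos]
    linarith [Real.pi_gt_three]
  exact (le_mul_of_one_le_left (norm_nonneg _) hpi).trans hb

/-- Some entry of `k` is nonzero; division of the bound in `exists_bound_mul` by the corresponding
frequency, which tends to infinity, gives the claim. -/
lemma tendsto_zero (h : ThinSequence Ω t w G C) (hφ : IsTest Ω φ) (ha : Tendsto a atTop atTop)
    (hb : Tendsto b atTop atTop) (hk : k ≠ 0) :
    Tendsto (fun n => oscIntegral Ω (w n) φ (phase (a n) (b n) k)) atTop (𝓝 0) := by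
  obtain ⟨j, hj⟩ := Mode.exists_entry_ne_zero hk
  obtain ⟨M, hM⟩ := h.exists_bound_mul hφ j k
  have hinf : Tendsto (fun n => ![a n, a n, b n] j) atTop atTop := by
    fin_cases j
    · exact ha
    · exact ha
    · exact hb
  have hkj : (k.entry j : ℂ) ≠ 0 := by exact_mod_cast hj
  have hz : Tendsto (fun n => ((![a n, a n, b n] j)⁻¹ : ℝ) * (M * ‖(k.entry j : ℂ)‖⁻¹)) atTop
      (𝓝 0) := by
    simpa using (tendsto_inv_atTop_zero.comp hinf).mul_const (M * ‖(k.entry j : ℂ)‖⁻¹)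
  refine squeeze_zero_norm' ?_ hz
  filter_upwards [hinf.eventually_gt_atTop 0] with n hn
  have h1 := hM n (a n) (b n)
  push_cast at h1
  rw [norm_mul, norm_mul, Complex.norm_real, Real.norm_of_nonneg hn.le] at h1
  have hkn : 0 < ‖(k.entry j : ℂ)‖ := norm_pos_iff.2 hkj
  rw [← div_eq_mul_inv, ← div_eq_inv_mul, le_div_iff₀ hn, le_div_iff₀ hkn]
  linarith

/-- In the first regime the limit field is curl free with respect to `y`. -/
lemma tendsto_curl (h : ThinSequence Ω t w G C) (hφ : IsTest Ω φ) (ha : Tendsto a atTop atTop)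
    (hb : Tendsto b atTop atTop) (hab : ∀ n, b n = t n * a n) (k : Mode) (i j : Fin 3) :
    Tendsto (fun n => (k.entry i : ℂ) * oscIntegral Ω (G j n) φ (phase (a n) (b n) k)
      - (k.entry j : ℂ) * oscIntegral Ω (G i n) φ (phase (a n) (b n) k)) atTop (𝓝 0) := by
  by_cases hij : i = j
  · subst hij
    simp
  -- These are the remainders left by elimination. The delicate case is `j = 2`, with the factor `1
  -- / t n = a n / b n`: then `i` is planar, so `a n` is absorbed by `exists_bound_mul` and `1 / b
  -- n` still tends to zero.
  have hrem : ∀ i j : Fin 3, i ≠ j → Tendsto (fun n => (k.entry i : ℂ)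
      * (((![1, 1, t n] j)⁻¹ : ℝ) * oscIntegral Ω (w n) (fun x => fderiv ℝ φ x (e3 j))
        (phase (a n) (b n) k))) atTop (𝓝 0) := by
    intro i j hij
    by_cases hki : k.entry i = 0
    · simp [hki]
    have hk : k ≠ 0 := by
      rintro rfl
      exact hki (by fin_cases i <;> rfl)
    have h0 := (h.tendsto_zero (hφ.fderiv (e3 j)) ha hb hk).const_mul (k.entry i : ℂ)
    rw [mul_zero] at h0
    by_cases hj : j = 2
    · subst hj
      obtain ⟨M, hM⟩ := h.exists_bound_mul (hφ.fderiv (e3 2)) i k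
      have hz : Tendsto (fun n => (b n)⁻¹ * M) atTop (𝓝 0) := by
        simpa using (tendsto_inv_atTop_zero.comp hb).mul_const M
      refine squeeze_zero_norm' ?_ hz
      filter_upwards [hb.eventually_gt_atTop 0] with n hn
      have h1 := hM n (a n) (b n)
      have hi : ![a n, a n, b n] i = a n := by
        fin_cases i
        · rfl
        · rfl
        · exact absurd rfl hij
      rw [hi] at h1
      have ht := h.pos n
      have han : a n ≠ 0 := by
        rintro h0
        rw [hab n, h0, mul_zero] at hn
        exact lt_irrefl _ hn
      have e : (k.entry i : ℂ) * (((![1, 1, t n] 2)⁻¹ : ℝ)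
            * oscIntegral Ω (w n) (fun x => fderiv ℝ φ x (e3 2)) (phase (a n) (b n) k))
          = (((b n)⁻¹ : ℝ) : ℂ) * (((a n * k.entry i : ℝ) : ℂ)
            * oscIntegral Ω (w n) (fun x => fderiv ℝ φ x (e3 2)) (phase (a n) (b n) k)) := by
        have h3 : (![1, 1, t n] 2)⁻¹ = (b n)⁻¹ * a n := by
          rw [hab n]
          simp
          field_simp
        rw [h3]
        push_cast
        ring
      rw [e, norm_mul, Complex.norm_real, Real.norm_of_nonneg (inv_nonneg.2 hn.le)]
      gcongr
    · have hσ : ∀ n, (![1, 1, t n] j) = 1 := by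
        intro n
        fin_cases j
        · rfl
        · rfl
        · exact absurd rfl hj
      simpa [hσ] using h0
  -- Since `b n = t n * a n`, division by the scaling factor leaves the same frequency `a n *
  -- k.entry j` in all three directions. The terms with `w n` and `φ` then cancel in the curl.
  have hG : ∀ j n, oscIntegral Ω (G j n) φ (phase (a n) (b n) k)
      = -(2 * Real.pi * Complex.I * (a n * k.entry j) * oscIntegral Ω (w n) φ (phase (a n) (b n) k))
        - ((![1, 1, t n] j)⁻¹ : ℝ) * oscIntegral Ω (w n) (fun x => fderiv ℝ φ x (e3 j))
          (phase (a n) (b n) k) := by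
    intro j n
    have h1 := h.ibp hφ j n (a n) (b n) k
    have hσ : ![a n, a n, b n] j = ![1, 1, t n] j * a n := by
      fin_cases j
      · simp
      · simp
      · simpa using hab n
    have hne : ((![1, 1, t n] j : ℝ) : ℂ) ≠ 0 := by
      have ht := (h.pos n).ne'
      fin_cases j <;> simp [ht]
    rw [hσ] at h1
    push_cast at h1 ⊢
    field_simp
    linear_combination h1
  have := (hrem j i (Ne.symm hij)).sub (hrem i j hij)
  rw [sub_zero] at this
  refine this.congr fun n => ?_
  rw [hG i n, hG j n]
  ring

/-- In the second regime the first two columns of the limit do not oscillate in `y₃`. -/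
lemma tendsto_planar (h : ThinSequence Ω t w G C) (hφ : IsTest Ω φ) (ha : Tendsto a atTop atTop)
    (hb : Tendsto b atTop atTop) (hab : Tendsto (fun n => t n * a n) atTop (𝓝 1))
    (hk : k.2 ≠ 0) (j : Fin 2) :
    Tendsto (fun n => oscIntegral Ω (G (Fin.castSucc j) n) φ (phase (a n) (b n) k)) atTop
      (𝓝 0) := by
  have hk0 : k ≠ 0 := by
    rintro rfl
    exact hk rfl
  have hσ : ∀ n, (![1, 1, t n] (Fin.castSucc j)) = 1 := fun n => by fin_cases j <;> rfl
  have hσa : ∀ n, ![a n, a n, b n] (Fin.castSucc j) = a n := fun n => by fin_cases j <;> rfl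
  have h0 := h.tendsto_zero (hφ.fderiv (e3 (Fin.castSucc j))) ha hb hk0
  obtain ⟨M₁, hM₁⟩ := h.exists_bound_G hφ 2
  obtain ⟨M₂, hM₂⟩ := h.exists_bound_mul (hφ.fderiv (e3 2)) (Fin.castSucc j) k
  have hne : (2 * Real.pi * Complex.I * k.2 : ℂ) ≠ 0 := by
    simp [Real.pi_ne_zero, hk]
  -- `B n` is `a n * k_j` times the right-hand side of the vertical identity. Eliminating the
  -- pairing of `w n` with `φ` leaves `B n / (b n * k₃)` up to sign, and `B n` is bounded because `t
  -- n * a n` converges and `exists_bound_mul` absorbs the other `a n`.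
  let B : ℕ → ℂ := fun n => -((t n * a n : ℝ) * k.entry (Fin.castSucc j)
      * oscIntegral Ω (G 2 n) φ (phase (a n) (b n) k))
    - ((a n * k.entry (Fin.castSucc j) : ℝ) : ℂ)
      * oscIntegral Ω (w n) (fun x => fderiv ℝ φ x (e3 2)) (phase (a n) (b n) k)
  have hB : ∀ᶠ n in atTop, ‖B n‖ ≤ 2 * ‖(k.entry (Fin.castSucc j) : ℂ)‖ * M₁ + M₂ := by
    have h1 := hab.norm.eventually (Iic_mem_nhds (by norm_num : ‖(1 : ℝ)‖ < 2))
    filter_upwards [h1] with n hn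
    refine (norm_sub_le _ _).trans (add_le_add ?_ ?_)
    · rw [norm_neg, norm_mul, norm_mul, Complex.norm_real]
      have hM : 0 ≤ M₁ := (norm_nonneg _).trans (hM₁ n 0)
      have hn' : ‖t n * a n‖ ≤ 2 := hn
      have hM' := hM₁ n (phase (a n) (b n) k)
      gcongr
    · have := hM₂ n (a n) (b n)
      rwa [hσa n] at this
  have hz : Tendsto (fun n => (((b n)⁻¹ : ℝ) : ℂ) * B n) atTop (𝓝 0) := by
    have hb0 : Tendsto (fun n => (((b n)⁻¹ : ℝ) : ℂ)) atTop (𝓝 0) := by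
      have := (Complex.continuous_ofReal.tendsto 0).comp (tendsto_inv_atTop_zero.comp hb)
      simpa [Function.comp_def] using this
    exact hb0.zero_mul_isBoundedUnder_le ⟨_, eventually_map.2 hB⟩
  have hfin := (h0.neg).sub (hz.const_mul (2 * Real.pi * Complex.I / (2 * Real.pi * Complex.I * k.2)))
  rw [neg_zero, mul_zero, sub_zero] at hfin
  refine hfin.congr' ?_
  filter_upwards [hb.eventually_gt_atTop 0] with n hn
  have h1 := h.ibp hφ (Fin.castSucc j) n (a n) (b n) k
  have h2 := h.ibp hφ 2 n (a n) (b n) k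
  rw [hσ, hσa] at h1
  have e2 : ![1, 1, t n] 2 = t n := rfl
  have e3' : ![a n, a n, b n] 2 = b n := rfl
  have e4 : k.entry 2 = k.2 := rfl
  rw [e2, e3', e4] at h2
  have hbn : (b n : ℂ) ≠ 0 := by exact_mod_cast hn.ne'
  have hk2 : (k.2 : ℂ) ≠ 0 := by exact_mod_cast hk
  have hpi : (Real.pi : ℂ) ≠ 0 := by exact_mod_cast Real.pi_ne_zero
  simp only [B]
  push_cast at h1 h2 ⊢
  have hI := Complex.I_ne_zero
  field_simp
  linear_combination -(b n * k.2 : ℂ) * h1 + (a n * k.entry (Fin.castSucc j) : ℂ) * h2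

/-- In the second regime the first two columns are curl free with respect to `y'`. -/
lemma tendsto_planar_curl (h : ThinSequence Ω t w G C) (hφ : IsTest Ω φ)
    (ha : Tendsto a atTop atTop) (hb : Tendsto b atTop atTop) (k : Mode) (i j : Fin 2) :
    Tendsto (fun n => (k.1 i : ℂ) * oscIntegral Ω (G (Fin.castSucc j) n) φ (phase (a n) (b n) k)
      - (k.1 j : ℂ) * oscIntegral Ω (G (Fin.castSucc i) n) φ (phase (a n) (b n) k)) atTop
      (𝓝 0) := by
  have hent : ∀ j : Fin 2, k.entry (Fin.castSucc j) = k.1 j := fun j => by fin_cases j <;> rfl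
  by_cases hk : k = 0
  · subst hk
    simp
  have hG : ∀ j : Fin 2, ∀ n, oscIntegral Ω (G (Fin.castSucc j) n) φ (phase (a n) (b n) k)
      = -(2 * Real.pi * Complex.I * (a n * k.1 j) * oscIntegral Ω (w n) φ (phase (a n) (b n) k))
        - oscIntegral Ω (w n) (fun x => fderiv ℝ φ x (e3 (Fin.castSucc j)))
          (phase (a n) (b n) k) := by
    intro j n
    have h1 := h.ibp hφ (Fin.castSucc j) n (a n) (b n) k
    have hσ : (![1, 1, t n] (Fin.castSucc j)) = 1 := by fin_cases j <;> rfl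
    have hσa : ![a n, a n, b n] (Fin.castSucc j) = a n := by fin_cases j <;> rfl
    rw [hσ, hσa, hent] at h1
    push_cast at h1
    linear_combination h1
  have h1 := (h.tendsto_zero (hφ.fderiv (e3 (Fin.castSucc i))) ha hb hk).const_mul (k.1 j : ℂ)
  have h2 := (h.tendsto_zero (hφ.fderiv (e3 (Fin.castSucc j))) ha hb hk).const_mul (k.1 i : ℂ)
  have := h1.sub h2
  rw [mul_zero, mul_zero, sub_zero] at this
  refine this.congr fun n => ?_
  rw [hG i n, hG j n]
  ring

/-- In the second regime the third column is a vertical derivative. -/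
lemma tendsto_vertical (h : ThinSequence Ω t w G C) (hφ : IsTest Ω φ) (ha : Tendsto a atTop atTop)
    (hb : Tendsto b atTop atTop) (hk : k ≠ 0) (hk2 : k.2 = 0) (j : Fin 2) :
    Tendsto (fun n => 2 * Real.pi * Complex.I * (t n * a n : ℝ) * (k.1 j : ℂ)
        * oscIntegral Ω (G 2 n) φ (phase (a n) (b n) k)
      - oscIntegral Ω (G (Fin.castSucc j) n) (fun x => fderiv ℝ φ x (e3 2))
        (phase (a n) (b n) k)) atTop (𝓝 0) := by
  have hent : k.entry (Fin.castSucc j) = k.1 j := by fin_cases j <;> rfl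
  refine (h.tendsto_zero ((hφ.fderiv (e3 2)).fderiv (e3 (Fin.castSucc j))) ha hb hk).congr
    fun n => ?_
  -- The planar identity is tested with `∂₃φ`. As `k₃ = 0`, the vertical identity replaces the
  -- pairing of `w n` with `∂₃φ` by `-t n` times that of the third column with `φ`; only a second
  -- derivative term remains.
  have h1 := h.ibp (hφ.fderiv (e3 2)) (Fin.castSucc j) n (a n) (b n) k
  have h2 := h.ibp hφ 2 n (a n) (b n) k
  have hσ : (![1, 1, t n] (Fin.castSucc j)) = 1 := by fin_cases j <;> rfl
  have hσa : ![a n, a n, b n] (Fin.castSucc j) = a n := by fin_cases j <;> rfl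
  have e2 : ![1, 1, t n] 2 = t n := rfl
  have e4 : k.entry 2 = 0 := hk2
  rw [hσ, hσa, hent] at h1
  rw [e2, e4] at h2
  push_cast at h1 h2 ⊢
  linear_combination h1 - (2 * Real.pi * Complex.I * a n * k.1 j : ℂ) * h2

end ThinSequence

end Relations

/-! ### Potentials of curl free amplitudes. -/

section Potential

variable {H : Type*} [NormedAddCommGroup H] [NormedSpace ℂ H] {d : ℕ}

/-- The amplitude of the mode `m` of a potential of a curl free field with amplitudes `c j`. -/
noncomputable def potential (m : Fin d → ℤ) (c : Fin d → H) : H :=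
  (2 * Real.pi * Complex.I * ∑ j, (m j : ℂ) ^ 2)⁻¹ • ∑ j, (m j : ℂ) • c j

lemma sum_sq_ne_zero {m : Fin d → ℤ} (hm : m ≠ 0) : (∑ j, (m j : ℂ) ^ 2) ≠ 0 := by
  obtain ⟨j, hj⟩ := Function.ne_iff.1 hm
  have h : (0 : ℤ) < ∑ j, m j ^ 2 := Finset.sum_pos' (fun i _ => sq_nonneg _)
    ⟨j, Finset.mem_univ j, by have : m j ≠ 0 := hj; positivity⟩
  exact_mod_cast h.ne'

/-- The curl relation turns `m j • ∑ i, m i • c i` into `(∑ i, m i ^ 2) • c j`. -/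
lemma smul_potential {m : Fin d → ℤ} {c : Fin d → H} (hm : m ≠ 0)
    (hc : ∀ i j, (m i : ℂ) • c j = (m j : ℂ) • c i) (j : Fin d) :
    (2 * Real.pi * Complex.I * (m j : ℝ) : ℂ) • potential m c = c j := by
  have h0 := sum_sq_ne_zero hm
  have h1 : (m j : ℂ) • ∑ i, (m i : ℂ) • c i = (∑ i, (m i : ℂ) ^ 2) • c j := by
    rw [Finset.smul_sum, Finset.sum_smul]
    refine Finset.sum_congr rfl fun i _ => ?_
    rw [smul_comm, hc j i, smul_smul, pow_two]
  have hpi : (2 * Real.pi * Complex.I : ℂ) ≠ 0 := by simp [Real.pi_ne_zero]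
  rw [potential, smul_smul, show ((2 * Real.pi * Complex.I * (m j : ℝ) : ℂ)
      * (2 * Real.pi * Complex.I * ∑ j, (m j : ℂ) ^ 2)⁻¹)
    = (∑ j, (m j : ℂ) ^ 2)⁻¹ * (m j : ℂ) by
      push_cast
      field_simp, mul_smul, h1, smul_smul, inv_mul_cancel₀ h0, one_smul]

/-- A nonzero integer entry has modulus at least one, and `2π ≥ 1`, so the potential is no larger
than the corresponding amplitude. Square summability is thus inherited; at `m = 0` the potential is
zero. -/
lemma norm_potential_sq_le {m : Fin d → ℤ} {c : Fin d → H}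
    (hc : ∀ i j, (m i : ℂ) • c j = (m j : ℂ) • c i) :
    ‖potential m c‖ ^ 2 ≤ ∑ j, ‖c j‖ ^ 2 := by
  by_cases hm : m = 0
  · simp only [potential, hm, Pi.zero_apply, Int.cast_zero, zero_smul, Finset.sum_const_zero,
      smul_zero, norm_zero, zero_pow two_ne_zero]
    exact Finset.sum_nonneg fun i _ => sq_nonneg _
  obtain ⟨j, hj⟩ := Function.ne_iff.1 hm
  have h : ‖potential m c‖ ≤ ‖c j‖ := by
    rw [← smul_potential hm hc j, norm_smul]
    refine le_mul_of_one_le_left (norm_nonneg _) ?_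
    have h1 : (1 : ℝ) ≤ |(m j : ℝ)| := by exact_mod_cast Int.one_le_abs hj
    simp only [norm_mul, Complex.norm_ofNat, Complex.norm_real, Complex.norm_I, mul_one,
      Real.norm_eq_abs, abs_of_pos Real.pi_pos]
    nlinarith [Real.pi_gt_three]
  calc ‖potential m c‖ ^ 2 ≤ ‖c j‖ ^ 2 := by gcongr
    _ ≤ ∑ j, ‖c j‖ ^ 2 := Finset.single_le_sum (f := fun j => ‖c j‖ ^ 2)
        (fun i _ => sq_nonneg _) (Finset.mem_univ j)

end Potential

/-! ### Relations between the amplitudes of the limit. -/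

section LimitModes

variable {Ω : Set Space} {t : ℕ → ℝ} {w : ℕ → Space → ℝ} {G : Fin 3 → ℕ → Space → ℝ} {C : ℝ}
  {ε₁ ε₂ : ℕ → ℝ} {c : Fin 3 → Mode → Lp ℂ 2 ((volume : Measure Space).restrict Ω)}

lemma HasModes.tendsto_pairing {v : ℕ → Space → ℝ}
    {c : Mode → Lp ℂ 2 ((volume : Measure Space).restrict Ω)} (h : HasModes Ω ε₁ ε₂ v c) (k : Mode)
    {φ : Space → ℝ} (hφ : IsTest Ω φ) :
    Tendsto (fun n => oscIntegral Ω (v n) φ (phase (ε₁ n)⁻¹ (ε₂ n)⁻¹ k)) atTop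
      (𝓝 (pairing (c k) φ)) :=
  h.tendsto_mode k φ hφ.contDiff.continuous hφ.hasCompactSupport

lemma pairing_intCast_smul (m : ℤ) (c : Lp ℂ 2 ((volume : Measure Space).restrict Ω))
    {φ : Space → ℝ} (hφ : IsTest Ω φ) : pairing ((m : ℂ) • c) φ = m * pairing c φ := by
  rw [pairing_smul _ _ hφ, map_intCast]

namespace ThinSequence

lemma curl_modes (h : ThinSequence Ω t w G C) (hm : ∀ j, HasModes Ω ε₁ ε₂ (G j) (c j))
    (hΩ : IsOpen Ω) (hε₁ : Tendsto (fun n => (ε₁ n)⁻¹) atTop atTop)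
    (hε₂ : Tendsto (fun n => (ε₂ n)⁻¹) atTop atTop) (hab : ∀ n, (ε₂ n)⁻¹ = t n * (ε₁ n)⁻¹)
    (k : Mode) (i j : Fin 3) : (k.entry i : ℂ) • c j k = (k.entry j : ℂ) • c i k := by
  refine eq_of_pairing hΩ fun φ hφ => ?_
  rw [pairing_intCast_smul _ _ hφ, pairing_intCast_smul _ _ hφ, ← sub_eq_zero]
  exact tendsto_nhds_unique ((((hm j).tendsto_pairing k hφ).const_mul _).sub
    (((hm i).tendsto_pairing k hφ).const_mul _)) (h.tendsto_curl hφ hε₁ hε₂ hab k i j)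

lemma planar_modes_eq_zero (h : ThinSequence Ω t w G C) (hm : ∀ j, HasModes Ω ε₁ ε₂ (G j) (c j))
    (hΩ : IsOpen Ω) (hε₁ : Tendsto (fun n => (ε₁ n)⁻¹) atTop atTop)
    (hε₂ : Tendsto (fun n => (ε₂ n)⁻¹) atTop atTop)
    (hab : Tendsto (fun n => t n * (ε₁ n)⁻¹) atTop (𝓝 1)) {k : Mode} (hk : k.2 ≠ 0) (j : Fin 2) :
    c (Fin.castSucc j) k = 0 :=
  eq_zero_of_pairing hΩ fun _ hφ => tendsto_nhds_unique
    ((hm (Fin.castSucc j)).tendsto_pairing k hφ) (h.tendsto_planar hφ hε₁ hε₂ hab hk j)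

lemma planar_curl_modes (h : ThinSequence Ω t w G C) (hm : ∀ j, HasModes Ω ε₁ ε₂ (G j) (c j))
    (hΩ : IsOpen Ω) (hε₁ : Tendsto (fun n => (ε₁ n)⁻¹) atTop atTop)
    (hε₂ : Tendsto (fun n => (ε₂ n)⁻¹) atTop atTop) (k : Mode) (i j : Fin 2) :
    (k.1 i : ℂ) • c (Fin.castSucc j) k = (k.1 j : ℂ) • c (Fin.castSucc i) k := by
  refine eq_of_pairing hΩ fun φ hφ => ?_
  rw [pairing_intCast_smul _ _ hφ, pairing_intCast_smul _ _ hφ, ← sub_eq_zero]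
  exact tendsto_nhds_unique ((((hm (Fin.castSucc j)).tendsto_pairing k hφ).const_mul _).sub
    (((hm (Fin.castSucc i)).tendsto_pairing k hφ).const_mul _))
    (h.tendsto_planar_curl hφ hε₁ hε₂ k i j)

lemma pairing_vertical (h : ThinSequence Ω t w G C) (hm : ∀ j, HasModes Ω ε₁ ε₂ (G j) (c j))
    (hε₁ : Tendsto (fun n => (ε₁ n)⁻¹) atTop atTop)
    (hε₂ : Tendsto (fun n => (ε₂ n)⁻¹) atTop atTop)
    (hab : Tendsto (fun n => t n * (ε₁ n)⁻¹) atTop (𝓝 1)) {k : Mode} (hk : k ≠ 0) (hk2 : k.2 = 0)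
    (j : Fin 2) {φ : Space → ℝ} (hφ : IsTest Ω φ) :
    pairing (c (Fin.castSucc j) k) (fun x => fderiv ℝ φ x (e3 2))
      = 2 * Real.pi * Complex.I * (k.1 j : ℂ) * pairing (c 2 k) φ := by
  have h1 : Tendsto (fun n => ((t n * (ε₁ n)⁻¹ : ℝ) : ℂ)) atTop (𝓝 ((1 : ℝ) : ℂ)) :=
    (Complex.continuous_ofReal.tendsto _).comp hab
  have h2 := ((((h1.const_mul (2 * Real.pi * Complex.I : ℂ)).mul_const (k.1 j : ℂ)).mul
    ((hm 2).tendsto_pairing k hφ)).sub ((hm (Fin.castSucc j)).tendsto_pairing k (hφ.fderiv (e3 2))))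
  have h3 := tendsto_nhds_unique h2 (h.tendsto_vertical hφ hε₁ hε₂ hk hk2 j)
  rw [Complex.ofReal_one, mul_one, sub_eq_zero] at h3
  exact h3.symm

end ThinSequence

lemma conj_pairing (c : Lp ℂ 2 ((volume : Measure Space).restrict Ω)) (φ : Space → ℝ) :
    starRingEnd ℂ (pairing c φ) = ∫ x in Ω, c x * (φ x : ℝ) := by
  rw [pairing, ← integral_conj]
  simp

lemma hasWeakDerivC_iff_pairing {v : Space} {f g : Lp ℂ 2 ((volume : Measure Space).restrict Ω)} :
    HasWeakDerivC Ω v f g ↔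
      ∀ φ, IsTest Ω φ → pairing f (fun x => fderiv ℝ φ x v) = -pairing g φ := by
  have key : ∀ φ : Space → ℝ, (∫ x in Ω, f x * (fderiv ℝ φ x v : ℝ) = -∫ x in Ω, g x * (φ x : ℝ))
      ↔ pairing f (fun x => fderiv ℝ φ x v) = -pairing g φ := fun φ => by
    rw [← conj_pairing, ← conj_pairing g, ← map_neg, (starRingEnd ℂ).injective.eq_iff]
  exact ⟨fun h φ hφ => (key φ).1 (h φ hφ.1 hφ.2 hφ.3),
    fun h φ h1 h2 h3 => (key φ).2 (h φ ⟨h1, h2, h3⟩)⟩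

/-- For an entry `k j ≠ 0` the planar amplitude is `2πi k j` times the potential, and this factor
cancels in `pairing_vertical`. The minus sign of a weak derivative arises because `pairing` is
conjugate linear in the amplitude. -/
lemma ThinSequence.hasWeakDerivC_potential (h : ThinSequence Ω t w G C)
    (hm : ∀ j, HasModes Ω ε₁ ε₂ (G j) (c j)) (hΩ : IsOpen Ω)
    (hε₁ : Tendsto (fun n => (ε₁ n)⁻¹) atTop atTop)
    (hε₂ : Tendsto (fun n => (ε₂ n)⁻¹) atTop atTop)
    (hab : Tendsto (fun n => t n * (ε₁ n)⁻¹) atTop (𝓝 1)) {k : Fin 2 → ℤ} (hk : k ≠ 0) :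
    HasWeakDerivC Ω (e3 2)
      (potential k fun j => c (Fin.castSucc j) (k, 0) : Lp ℂ 2 ((volume : Measure Space).restrict Ω))
      (c 2 (k, 0)) := by
  rw [hasWeakDerivC_iff_pairing]
  intro φ hφ
  obtain ⟨j, hj⟩ := Function.ne_iff.1 hk
  have hj' : (k j : ℂ) ≠ 0 := by exact_mod_cast hj
  have h1 := h.pairing_vertical hm hε₁ hε₂ hab (k := (k, 0)) (fun h0 => hk (congrArg Prod.fst h0))
    rfl j hφ
  have hcurl : ∀ i j : Fin 2, (k i : ℂ) • c (Fin.castSucc j) (k, 0)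
      = (k j : ℂ) • c (Fin.castSucc i) (k, 0) := fun i j =>
    h.planar_curl_modes hm hΩ hε₁ hε₂ (k, 0) i j
  rw [← smul_potential hk hcurl j, pairing_smul _ _ (hφ.fderiv _)] at h1
  have hpi : (2 * Real.pi * Complex.I * k j : ℂ) ≠ 0 := by simp [Real.pi_ne_zero, hj']
  refine mul_left_cancel₀ hpi ?_
  simp only [map_mul, Complex.conj_I, Complex.conj_ofReal, map_ofNat, Complex.ofReal_intCast,
    map_intCast] at h1
  linear_combination -h1

lemma phase_zero (a b : ℝ) : phase a b 0 = 0 := by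
  ext <;> simp [phase_apply]

lemma freq2_zero : freq2 0 = 0 := by
  ext
  simp [freq2_apply]

lemma HasModes.tendsto_zero_mode {v : ℕ → Space → ℝ}
    {c : Mode → Lp ℂ 2 ((volume : Measure Space).restrict Ω)} (h : HasModes Ω ε₁ ε₂ v c)
    {φ : Space → ℝ} (hφ : IsTest Ω φ) :
    Tendsto (fun n => ((∫ x in Ω, v n x * φ x : ℝ) : ℂ)) atTop (𝓝 (pairing (c 0) φ)) := by
  refine (h.tendsto_pairing 0 hφ).congr fun n => ?_
  rw [oscIntegral, phase_zero, ← integral_complex_ofReal]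
  simp [planeWave_zero]

/-- The zero mode is the weak limit. -/
lemma HasModes.ae_zero_mode_eq {v : ℕ → Space → ℝ} (hΩ : IsOpen Ω)
    {c : Mode → Lp ℂ 2 ((volume : Measure Space).restrict Ω)} (h : HasModes Ω ε₁ ε₂ v c)
    {g : Space → ℝ} (hg : MemLp g 2 (volume.restrict Ω))
    (hlim : ∀ φ, IsTest Ω φ → Tendsto (fun n => ∫ x in Ω, v n x * φ x) atTop
      (𝓝 (∫ x in Ω, g x * φ x))) :
    ∀ᵐ x ∂(volume.restrict Ω), (c 0 x).re = g x := by
  have hgc : MemLp (fun x => (g x : ℂ)) 2 (volume.restrict Ω) := hg.ofReal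
  have heq : c 0 = hgc.toLp _ := eq_of_pairing hΩ fun φ hφ => by
    have h1 : pairing (hgc.toLp _) φ = ((∫ x in Ω, g x * φ x : ℝ) : ℂ) := by
      rw [pairing, ← integral_complex_ofReal]
      refine integral_congr_ae ?_
      filter_upwards [hgc.coeFn_toLp] with x hx
      rw [hx]
      simp
    rw [h1]
    exact tendsto_nhds_unique (h.tendsto_zero_mode hφ)
      ((Complex.continuous_ofReal.tendsto _).comp (hlim φ hφ))
  filter_upwards [hgc.coeFn_toLp] with x hx
  rw [heq, hx, Complex.ofReal_re]

end LimitModes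

/-! ### Splitting of mode sums. -/

section Splitting

variable {X Y ι : Type*} [MeasurableSpace X] [MeasurableSpace Y] {μ : Measure X} [SFinite μ]
  {ν : Measure Y} [IsProbabilityMeasure ν]

lemma summable_sq_norm_ite {H : Type*} [NormedAddCommGroup H] {c : ι → H}
    (hc : Summable fun k => ‖c k‖ ^ 2) (P : ι → Prop) [DecidablePred P] :
    Summable fun k => ‖if P k then c k else 0‖ ^ 2 := by
  refine hc.of_nonneg_of_le (fun k => sq_nonneg _) fun k => ?_
  split_ifs
  · rfl
  · rw [norm_zero, zero_pow two_ne_zero]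
    exact sq_nonneg _

lemma WaveSystem.sum_eq_add_ite (χ : WaveSystem ι ν) {c : ι → Lp ℂ 2 μ}
    (hc : Summable fun k => ‖c k‖ ^ 2) (P : ι → Prop) [DecidablePred P] :
    χ.sum μ c =ᵐ[μ.prod ν] fun p => χ.sum μ (fun k => if P k then c k else 0) p
      + χ.sum μ (fun k => if P k then 0 else c k) p := by
  have hn : Summable fun k => ‖if P k then 0 else c k‖ ^ 2 := by
    simpa only [ite_not] using summable_sq_norm_ite hc fun k => ¬ P k
  have h : c = fun k => (if P k then c k else 0) + (if P k then 0 else c k) := by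
    funext k
    split_ifs <;> simp
  have h1 := χ.sum_add (summable_sq_norm_ite hc P) hn
  rw [← h] at h1
  rw [h1]
  exact Lp.coeFn_add _ _

lemma WaveSystem.sum_eq_mode_add [DecidableEq ι] (χ : WaveSystem ι ν) {c : ι → Lp ℂ 2 μ}
    (hc : Summable fun k => ‖c k‖ ^ 2) {k₀ : ι} (hk₀ : ∀ y, χ.wave k₀ y = 1) :
    χ.sum μ c =ᵐ[μ.prod ν] fun p => c k₀ p.1 + χ.sum μ (fun k => if k = k₀ then 0 else c k) p := by
  have h : (fun k => if k = k₀ then c k else 0) = fun k => if k = k₀ then c k₀ else 0 := by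
    funext k
    split_ifs with hk
    · rw [hk]
    · rfl
  filter_upwards [χ.sum_eq_add_ite hc (· = k₀), χ.coeFn_tensor μ k₀ (c k₀)] with p h1 h2
  rw [h1, h, χ.sum_single, h2, hk₀, mul_one]

end Splitting

/-! ### From square summable amplitudes to `L²(Ω; H¹(𝒴))`. -/

section Assembly

lemma memLp_re_sum {E ι : Type*} [MeasureSpace E] [SFinite (volume : Measure E)] {Y : Set E}
    [IsProbabilityMeasure ((volume : Measure E).restrict Y)] {Ω : Set Space} (χ : WaveSystem ι ((volume : Measure E).restrict Y))
    (c : ι → Lp ℂ 2 ((volume : Measure Space).restrict Ω)) :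
    MemLp (fun p => (χ.sum (volume.restrict Ω) c p).re) 2
      ((volume : Measure (Space × E)).restrict (Ω ×ˢ Y)) := by
  rw [volume_restrict_prod]
  exact (Lp.memLp (χ.sum (volume.restrict Ω) c)).re

variable {E : Type} [NormedAddCommGroup E] [NormedSpace ℝ E] [MeasureSpace E]
  [OpensMeasurableSpace E] [SFinite (volume : Measure E)] {d : ℕ} {e : Fin d → E} {Y : Set E}
  [IsProbabilityMeasure ((volume : Measure E).restrict Y)] {ι : Type*} [Countable ι] {Ω : Set Space}

lemma isL2PeriodicH1_sum (hY : IsCell e Y) (χ : WaveSystem ι ((volume : Measure E).restrict Y))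
    {l : ι → E →L[ℝ] ℝ} (hχ : ∀ k, χ.wave k = planeWave (l k))
    (hl : ∀ k j, ∃ m : ℤ, l k (e j) = m)
    {b : Fin 3 → ι → Lp ℂ 2 ((volume : Measure Space).restrict Ω)}
    {b' : Fin 3 → Fin d → ι → Lp ℂ 2 ((volume : Measure Space).restrict Ω)}
    (hb : ∀ i, Summable fun k => ‖b i k‖ ^ 2) (hb' : ∀ i j, Summable fun k => ‖b' i j k‖ ^ 2)
    (hbb' : ∀ i j k, b' i j k = (2 * Real.pi * Complex.I * (l k (e j) : ℝ) : ℂ) • b i k) :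
    IsL2PeriodicH1 Ω e Y (fun p i => (χ.sum (volume.restrict Ω) (b i) p).re)
      (fun p i j => (χ.sum (volume.restrict Ω) (b' i j) p).re) where
  memLp i := memLp_re_sum χ (b i)
  memLp_grad i j := memLp_re_sum χ (b' i j)
  slice := by
    have h1 : ∀ᵐ x ∂(volume.restrict Ω), ∀ i, MemLp
        (fun y => (χ.sum (volume.restrict Ω) (b i) (x, y)).re) 2 (volume.restrict Y) :=
      ae_all_iff.2 fun i => ae_memLp_slice (Lp.memLp (χ.sum (volume.restrict Ω) (b i))).re
    have h2 : ∀ᵐ x ∂(volume.restrict Ω), ∀ i j, MemLp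
        (fun y => (χ.sum (volume.restrict Ω) (b' i j) (x, y)).re) 2 (volume.restrict Y) :=
      ae_all_iff.2 fun i => ae_all_iff.2 fun j =>
        ae_memLp_slice (Lp.memLp (χ.sum (volume.restrict Ω) (b' i j))).re
    have h3 := ae_all_iff.2 fun i => ae_all_iff.2 fun j =>
      χ.ae_hasPeriodicWeakDeriv hY hχ hl (hb i) (hb' i j) j (hbb' i j)
    filter_upwards [h1, h2, h3] with x h1 h2 h3
    exact ⟨h1, h2, h3⟩

end Assembly

/-! ### Scaled gradients of a weakly convergent family. -/

section Compactness

variable {Ω : Set Space} {u : ℝ → Space → Fin 3 → ℝ} {Du : ℝ → Space → Fin 3 → Fin 3 → ℝ}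
  {ulim : Space → Fin 3 → ℝ} {Dulim : Space → Fin 3 → Fin 3 → ℝ} {t : ℕ → ℝ}

lemma scaledGrad_castSucc (h : ℝ) (Df : Space → Fin 3 → Fin 3 → ℝ) (x : Space) (i : Fin 3)
    (j : Fin 2) : scaledGrad h Df x i (Fin.castSucc j) = Df x i (Fin.castSucc j) := by
  fin_cases j <;> rfl

lemma scaledGrad_eq (h : ℝ) (Df : Space → Fin 3 → Fin 3 → ℝ) (x : Space) (i j : Fin 3) :
    scaledGrad h Df x i j = (![1, 1, h] j)⁻¹ * Df x i j := by
  fin_cases j <;> simp [scaledGrad, withCol]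

lemma IsH1.memLp_scaledGrad {f : Space → Fin 3 → ℝ} {Df : Space → Fin 3 → Fin 3 → ℝ}
    (hf : IsH1 e3 Ω f Df) (h : ℝ) (i j : Fin 3) :
    MemLp (fun x => scaledGrad h Df x i j) 2 (volume.restrict Ω) := by
  simp_rw [scaledGrad_eq]
  exact (hf.memLp_grad i j).const_mul _

lemma IsH1.integral_scaledGrad_sq_le {f : Space → Fin 3 → ℝ} {Df : Space → Fin 3 → Fin 3 → ℝ}
    (hf : IsH1 e3 Ω f Df) (h : ℝ) (i j : Fin 3) :
    ∫ x in Ω, scaledGrad h Df x i j ^ 2 ≤ ∫ x in Ω, ∑ i, ∑ j, scaledGrad h Df x i j ^ 2 := by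
  refine integral_mono (hf.memLp_scaledGrad h i j).integrable_sq
    (integrable_finsetSum _ fun i _ => integrable_finsetSum _ fun j _ =>
      (hf.memLp_scaledGrad h i j).integrable_sq) fun x => ?_
  refine (Finset.single_le_sum (f := fun j => scaledGrad h Df x i j ^ 2)
    (fun _ _ => sq_nonneg _) (Finset.mem_univ j)).trans ?_
  exact Finset.single_le_sum (f := fun i => ∑ j, scaledGrad h Df x i j ^ 2)
    (fun _ _ => Finset.sum_nonneg fun _ _ => sq_nonneg _) (Finset.mem_univ i)

lemma exists_thinSequence (hweak : WeaklyConvergesH1 Ω u Du ulim Dulim)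
    (hbdd : ∃ C : ℝ, ∀ h : ℝ, 0 < h → ∫ x in Ω, ∑ i, ∑ j, scaledGrad h (Du h) x i j ^ 2 ≤ C)
    (ht : ∀ n, 0 < t n) (ht0 : Tendsto t atTop (𝓝 0)) :
    ∃ C, ∀ i, ThinSequence Ω t (fun n x => u (t n) x i)
      (fun j n x => scaledGrad (t n) (Du (t n)) x i j) C := by
  obtain ⟨C₁, h1⟩ := hbdd
  obtain ⟨C₂, h2⟩ := hweak.exists_bound ht ht0
  obtain ⟨C₃, h3⟩ := ht0.bddAbove_range
  -- One constant dominates the bounds on `u`, on the scaled gradients, on the thicknesses, and on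
  -- the scaling factor `1` of the planar directions.
  refine ⟨max (max C₁ C₂) (max C₃ 1), fun i =>
    { pos := ht
      le := fun n => (h3 ⟨n, rfl⟩).trans ((le_max_left _ _).trans (le_max_right _ _))
      one_le := (le_max_right _ _).trans (le_max_right _ _)
      memLp := fun n => (hweak.mem (t n) (ht n)).memLp i
      memLp_grad := fun j n => (hweak.mem (t n) (ht n)).memLp_scaledGrad (t n) i j
      bound := fun n => (h2 n i).trans ((le_max_right _ _).trans (le_max_left _ _))
      bound_grad := fun j n =>
        ((hweak.mem (t n) (ht n)).integral_scaledGrad_sq_le (t n) i j).trans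
          ((h1 (t n) (ht n)).trans ((le_max_left _ _).trans (le_max_left _ _)))
      weak := fun j n => ?_ }⟩
  have hne : ![1, 1, t n] j ≠ 0 := by
    have := (ht n).ne'
    fin_cases j <;> simp [this]
  have := (hweak.mem (t n) (ht n)).weak_grad i j
  simpa only [scaledGrad_eq, mul_inv_cancel_left₀ hne] using this

/-- The vertical derivative of the weak limit vanishes. -/
lemma integral_vertical_eq_zero (hweak : WeaklyConvergesH1 Ω u Du ulim Dulim)
    (hbdd : ∃ C : ℝ, ∀ h : ℝ, 0 < h → ∫ x in Ω, ∑ i, ∑ j, scaledGrad h (Du h) x i j ^ 2 ≤ C)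
    (i : Fin 3) {φ : Space → ℝ} (hφ : IsTest Ω φ) : ∫ x in Ω, Dulim x i 2 * φ x = 0 := by
  -- Any sequence of thicknesses tending to zero would do: the vertical derivative is `τ n` times a
  -- bounded pairing.
  let τ : ℕ → ℝ := fun n => 1 / ((n : ℝ) + 1)
  have hτ : ∀ n, 0 < τ n := fun n => Nat.one_div_pos_of_nat
  have hτ0 : Tendsto τ atTop (𝓝 0) := tendsto_one_div_add_atTop_nhds_zero_nat
  obtain ⟨C, hthin⟩ := exists_thinSequence hweak hbdd hτ hτ0
  obtain ⟨M, hM⟩ := (hthin i).exists_bound_G hφ 2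
  refine tendsto_nhds_unique (hweak.tendsto_integral_grad hτ hτ0 i 2 hφ.memLp) ?_
  have hz : Tendsto (fun n => τ n * M) atTop (𝓝 0) := by simpa using hτ0.mul_const M
  refine squeeze_zero_norm (fun n => ?_) hz
  have h1 := hM n 0
  have h2 : oscIntegral Ω (fun x => scaledGrad (τ n) (Du (τ n)) x i 2) φ 0
      = ((∫ x in Ω, scaledGrad (τ n) (Du (τ n)) x i 2 * φ x : ℝ) : ℂ) := by
    rw [oscIntegral, ← integral_complex_ofReal]
    simp [planeWave_zero]
  have h3 : ∫ x in Ω, Du (τ n) x i 2 * φ x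
      = τ n * ∫ x in Ω, scaledGrad (τ n) (Du (τ n)) x i 2 * φ x := by
    rw [← integral_const_mul]
    refine integral_congr_ae (Eventually.of_forall fun x => ?_)
    have := (hτ n).ne'
    simp only [scaledGrad_eq, Matrix.cons_val]
    field_simp
  rw [h2, Complex.norm_real] at h1
  rw [h3, norm_mul, Real.norm_of_nonneg (hτ n).le]
  exact mul_le_mul_of_nonneg_left h1 (hτ n).le

/-- The nine entries are treated one after the other; passing to a further subsequence keeps the
modes already obtained. -/
lemma exists_gradient_modes (hΩ : IsOpen Ω) (hweak : WeaklyConvergesH1 Ω u Du ulim Dulim)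
    (hbdd : ∃ C : ℝ, ∀ h : ℝ, 0 < h → ∫ x in Ω, ∑ i, ∑ j, scaledGrad h (Du h) x i j ^ 2 ≤ C)
    (ht : ∀ n, 0 < t n) (ht0 : Tendsto t atTop (𝓝 0)) {ε₁ ε₂ : ℕ → ℝ}
    (hε₁ : Tendsto ε₁ atTop (𝓝[>] 0)) (hε₂ : Tendsto ε₂ atTop (𝓝[>] 0)) :
    ∃ (κ : ℕ → ℕ) (c : Fin 3 → Fin 3 → Mode → Lp ℂ 2 ((volume : Measure Space).restrict Ω)),
      StrictMono κ ∧ ∀ i j, HasModes Ω (ε₁ ∘ κ) (ε₂ ∘ κ)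
        (fun n x => scaledGrad (t (κ n)) (Du (t (κ n))) x i j) (c i j) := by
  obtain ⟨C, hthin⟩ := exists_thinSequence hweak hbdd ht ht0
  obtain ⟨κ, hκ, h⟩ := exists_common_subsequence (ι := Fin 3 × Fin 3)
    (fun ij κ => ∃ c, HasModes Ω (ε₁ ∘ κ) (ε₂ ∘ κ)
      (fun n x => scaledGrad (t (κ n)) (Du (t (κ n))) x ij.1 ij.2) c)
    (fun ij κ hκ => by
      obtain ⟨l, c, hl, hc⟩ := exists_hasModes hΩ.measurableSet (hε₁.comp hκ.tendsto_atTop)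
        (hε₂.comp hκ.tendsto_atTop)
        (fun n => (hthin ij.1).memLp_grad ij.2 (κ n)) (fun n => (hthin ij.1).bound_grad ij.2 (κ n))
      exact ⟨l, hl, c, hc⟩)
    (fun ij κ l hl hc => by
      obtain ⟨c, hc⟩ := hc
      exact ⟨c, hc.comp hl⟩)
  choose c hc using h
  exact ⟨κ, fun i j => c (i, j), hκ, fun i j => hc (i, j)⟩

lemma ae_zero_mode_gradient (hΩ : IsOpen Ω) (hweak : WeaklyConvergesH1 Ω u Du ulim Dulim)
    (ht : ∀ n, 0 < t n) (ht0 : Tendsto t atTop (𝓝 0)) {ε₁ ε₂ : ℕ → ℝ} (i : Fin 3) (j : Fin 2)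
    {c : Mode → Lp ℂ 2 ((volume : Measure Space).restrict Ω)}
    (hc : HasModes Ω ε₁ ε₂ (fun n x => scaledGrad (t n) (Du (t n)) x i (Fin.castSucc j)) c) :
    ∀ᵐ x ∂(volume.restrict Ω), (c 0 x).re = Dulim x i (Fin.castSucc j) := by
  refine hc.ae_zero_mode_eq hΩ (hweak.mem_lim.memLp_grad i _) fun φ hφ => ?_
  simp_rw [scaledGrad_castSucc]
  exact hweak.tendsto_integral_grad ht ht0 i _ hφ.memLp

end Compactness

/-! ### The limit fields in the two regimes. -/

section Regimes

variable {S : Set Plane}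

lemma HasWeakDerivC.re {v : Space} {U : Set Space}
    {f g : Lp ℂ 2 ((volume : Measure Space).restrict U)} (h : HasWeakDerivC U v f g) :
    HasWeakDeriv U v (fun x => (f x).re) (fun x => (g x).re) := by
  intro φ h1 h2 h3
  have hφ : IsTest U φ := ⟨h1, h2, h3⟩
  have key : ∀ (f : Lp ℂ 2 ((volume : Measure Space).restrict U)) {ψ : Space → ℝ},
      IsTest U ψ → ∫ x in U, (f x).re * ψ x = (∫ x in U, f x * (ψ x : ℝ)).re := by
    intro f ψ hψ
    have hi : Integrable (fun x => f x * ((ψ x : ℝ) : ℂ)) (volume.restrict U) :=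
      (Lp.memLp f).integrable_mul hψ.memLp.ofReal
    refine Eq.trans ?_ (integral_re hi)
    refine integral_congr_ae (Eventually.of_forall fun x => ?_)
    simp
  rw [key f (hφ.fderiv v), key g hφ, h φ h1 h2 h3, Complex.neg_re]

lemma ae_plate_prod {μ : Measure Space} {ν : Measure Space} [SFinite ν] {P : Space → Prop}
    (h : ∀ᵐ x ∂μ, P x) : ∀ᵐ p ∂(μ.prod ν), P p.1 :=
  Measure.quasiMeasurePreserving_fst.ae h

lemma summable_potential {Ω : Set Space} {d : ℕ} {ι : Type*} {m : ι → Fin d → ℤ}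
    {c : Fin d → ι → Lp ℂ 2 ((volume : Measure Space).restrict Ω)}
    (hc : ∀ j, Summable fun k => ‖c j k‖ ^ 2)
    (hcurl : ∀ k i j, (m k i : ℂ) • c j k = (m k j : ℂ) • c i k) :
    Summable fun k => ‖potential (m k) fun j => c j k‖ ^ 2 :=
  (summable_sum fun j (_ : j ∈ Finset.univ) => hc j).of_nonneg_of_le (fun _ => sq_nonneg _)
    fun k => norm_potential_sq_le (hcurl k)

lemma waves3_wave_zero (y : Space) : waves3.wave 0 y = 1 := by
  rw [waves3_wave, phase_zero, planeWave_zero]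

lemma waves2_wave_zero (y : Plane) : waves2.wave 0 y = 1 := by
  rw [waves2_wave, freq2_zero, planeWave_zero]

/-- The form of the limit when the fields of amplitudes are curl free. -/
theorem exists_curl_free_limit {ε₁ ε₂ : ℕ → ℝ} {G : ℕ → Space → Fin 3 → Fin 3 → ℝ}
    {c : Fin 3 → Fin 3 → Mode → Lp ℂ 2 ((volume : Measure Space).restrict (plate S))}
    (hc : ∀ i j, HasModes (plate S) ε₁ ε₂ (fun n x => G n x i j) (c i j))
    (hcurl : ∀ l k i j, (k.entry i : ℂ) • c l j k = (k.entry j : ℂ) • c l i k)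
    {D : Plane → Fin 3 → Fin 2 → ℝ}
    (hD : ∀ i j, ∀ᵐ x ∂(volume.restrict (plate S)), (c i (Fin.castSucc j) 0 x).re = D x.1 i j) :
    ∃ (u1 : Space → Fin 3 → ℝ) (D3u1 : Space → Fin 3 → ℝ)
      (u2 : Space × Space → Fin 3 → ℝ) (Dyu2 : Space × Space → Fin 3 → Fin 3 → ℝ),
      (∀ i, MemLp (fun x => u1 x i) 2 (volume.restrict (plate S))) ∧
      (∀ i, MemLp (fun x => D3u1 x i) 2 (volume.restrict (plate S))) ∧
      (∀ i, HasWeakDeriv (plate S) (e3 2) (fun x => u1 x i) (fun x => D3u1 x i)) ∧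
      IsL2PeriodicH1 (plate S) e3 cell3 u2 Dyu2 ∧
      TwoScaleConvergesMatrix (plate S) ε₁ ε₂ G
        (fun p => withCol (D p.1.1) (D3u1 p.1) + Dyu2 p) := by
  -- Nothing is known about the mean of the third column, and nothing is needed: its primitive in
  -- `x₃` serves as `u¹`.
  choose F hF using fun i => exists_primitive S (c i 2 0)
  -- A `y`-gradient has no zero mode; the means are carried by `∇'u⁰` and `∂₃u¹`.
  let b' : Fin 3 → Fin 3 → Mode → Lp ℂ 2 ((volume : Measure Space).restrict (plate S)) :=
    fun i j k => if k = 0 then 0 else c i j k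
  have hb' : ∀ i j, Summable fun k => ‖b' i j k‖ ^ 2 := fun i j => by
    simpa only [b', ite_not] using summable_sq_norm_ite (hc i j).summable fun k => ¬ k = 0
  refine ⟨fun x i => (F i x).re, fun x i => (c i 2 0 x).re,
    fun p i => (waves3.sum (volume.restrict (plate S))
      (fun k => potential k.entry fun j => c i j k) p).re,
    fun p i j => (waves3.sum (volume.restrict (plate S)) (b' i j) p).re,
    fun i => (Lp.memLp (F i)).re, fun i => (Lp.memLp (c i 2 0)).re, fun i => (hF i).re, ?_, ?_⟩
  · refine isL2PeriodicH1_sum isCell_cell3 waves3 waves3_wave phase_integral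
      (fun i => summable_potential (fun j => (hc i j).summable) (hcurl i)) hb' fun i j k => ?_
    have h1 : phase 1 1 k (e3 j) = (k.entry j : ℝ) := by
      rw [phase_e3]
      fin_cases j <;> simp
    rw [h1]
    by_cases hk : k = 0
    · have h0 : (0 : Mode).entry j = 0 := by fin_cases j <;> rfl
      simp [b', hk, h0]
    · obtain ⟨m, hm⟩ := Mode.exists_entry_ne_zero hk
      rw [smul_potential (Function.ne_iff.2 ⟨m, hm⟩) (hcurl i k) j]
      simp [b', hk]
  · intro i j
    refine (hc i j).twoScale _ ?_
    rw [volume_restrict_prod]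
    filter_upwards [waves3.sum_eq_mode_add (hc i j).summable waves3_wave_zero,
      ae_plate_prod (hD i 0), ae_plate_prod (hD i 1)] with p h1 h2 h3
    rw [h1, Complex.add_re]
    fin_cases j
    · exact congrArg (· + _) h2.symm
    · exact congrArg (· + _) h3.symm
    · rfl

/-- The form of the limit when the planar amplitudes are curl free in the plane and have the third
column as their vertical derivative. -/
theorem exists_planar_limit (hS : IsOpen S) {ε₁ ε₂ : ℕ → ℝ} {G : ℕ → Space → Fin 3 → Fin 3 → ℝ}
    {c : Fin 3 → Fin 3 → Mode → Lp ℂ 2 ((volume : Measure Space).restrict (plate S))}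
    (hc : ∀ i j, HasModes (plate S) ε₁ ε₂ (fun n x => G n x i j) (c i j))
    (hzero : ∀ i j k, k.2 ≠ 0 → c i (Fin.castSucc j) k = 0)
    (hcurl : ∀ (l : Fin 3) (k : Fin 2 → ℤ) (i j : Fin 2),
      (k i : ℂ) • c l (Fin.castSucc j) (k, 0) = (k j : ℂ) • c l (Fin.castSucc i) (k, 0))
    (hvert : ∀ (i : Fin 3) (k : Fin 2 → ℤ), k ≠ 0 → HasWeakDerivC (plate S) (e3 2)
      (potential k fun j => c i (Fin.castSucc j) (k, 0) :
        Lp ℂ 2 ((volume : Measure Space).restrict (plate S))) (c i 2 (k, 0)))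
    {D : Plane → Fin 3 → Fin 2 → ℝ}
    (hD : ∀ i j, ∀ᵐ x ∂(volume.restrict (plate S)), (c i (Fin.castSucc j) 0 x).re = D x.1 i j) :
    ∃ (u1 : Space × Plane → Fin 3 → ℝ)
      (Dyu1 : Space × Plane → Fin 3 → Fin 2 → ℝ) (D3u1 : Space × Plane → Fin 3 → ℝ)
      (d : Space × Space → Fin 3 → ℝ),
      IsL2PeriodicH1 (plate S) e2 cell2 u1 Dyu1 ∧
      (∀ i, MemLp (fun p => D3u1 p i) 2 (volume.restrict (plate S ×ˢ cell2))) ∧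
      (∀ i, HasWeakDeriv (plate S ×ˢ interior cell2) (e3 2, 0)
        (fun p => u1 p i) (fun p => D3u1 p i)) ∧
      (∀ i, MemLp (fun p => d p i) 2 (volume.restrict (plate S ×ˢ cell3))) ∧
      (∀ᵐ q ∂(volume.restrict (plate S ×ˢ cell2)), ∀ i,
        ∫ s in Ico (0 : ℝ) 1, d (q.1, (q.2, s)) i = 0) ∧
      TwoScaleConvergesMatrix (plate S) ε₁ ε₂ G
        (fun p => withCol (D p.1.1) 0
          + withCol (Dyu1 (p.1, p.2.1)) (D3u1 (p.1, p.2.1))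
          + withCol 0 (d p)) := by
  choose F hF using fun i => exists_primitive S (c i 2 0)
  have hinj : Function.Injective (fun k : Fin 2 → ℤ => ((k, 0) : Mode)) := fun k l h =>
    congrArg Prod.fst h
  have hc0 : ∀ i j, Summable fun k : Fin 2 → ℤ => ‖c i j (k, 0)‖ ^ 2 := fun i j =>
    (hc i j).summable.comp_injective hinj
  -- The potential vanishes at `k = 0`, and the `y'`-gradient does not see that mode. It is
  -- therefore free to hold the primitive `F i`, which makes the `x₃`-derivative correct for `k = 0`
  -- as well.
  let b : Fin 3 → (Fin 2 → ℤ) → Lp ℂ 2 ((volume : Measure Space).restrict (plate S)) :=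
    fun i k => (potential k fun j => c i (Fin.castSucc j) (k, 0)) + if k = 0 then F i else 0
  let b' : Fin 3 → Fin 2 → (Fin 2 → ℤ) → Lp ℂ 2 ((volume : Measure Space).restrict (plate S)) :=
    fun i j k => if k = 0 then 0 else c i (Fin.castSucc j) (k, 0)
  have hpot0 : ∀ i, (potential 0 fun j => c i (Fin.castSucc j) ((0 : Fin 2 → ℤ), 0)) = 0 :=
    fun i => by simp [potential]
  have hb0 : ∀ i, b i 0 = F i := fun i => by simp [b, hpot0]
  have hbk : ∀ i k, k ≠ 0 → b i k = potential k fun j => c i (Fin.castSucc j) (k, 0) :=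
    fun i k hk => by simp [b, hk]
  have hb : ∀ i, Summable fun k => ‖b i k‖ ^ 2 := fun i => by
    have h1 := (summable_potential (m := id) (fun j : Fin 2 => hc0 i (Fin.castSucc j)) (hcurl i)).add
      (summable_sq_single (0 : Fin 2 → ℤ) (F i))
    refine (h1.mul_left 2).of_nonneg_of_le (fun k => sq_nonneg _) fun k => ?_
    refine (pow_le_pow_left₀ (norm_nonneg _) (norm_add_le _ _) 2).trans (add_sq_le.trans_eq ?_)
    rfl
  have hb' : ∀ i j, Summable fun k => ‖b' i j k‖ ^ 2 := fun i j => by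
    simpa only [b', ite_not] using
      summable_sq_norm_ite (hc0 i (Fin.castSucc j)) fun k => ¬ k = 0
  -- The third column splits by `k₃`: the part `A` without oscillation in `y₃` becomes `∂₃u¹`, and
  -- the part `B` becomes `d`.
  let A : Fin 3 → Mode → Lp ℂ 2 ((volume : Measure Space).restrict (plate S)) :=
    fun i k => if k.2 = 0 then c i 2 k else 0
  let B : Fin 3 → Mode → Lp ℂ 2 ((volume : Measure Space).restrict (plate S)) :=
    fun i k => if k.2 = 0 then 0 else c i 2 k
  have hA : ∀ i, Summable fun k => ‖A i k‖ ^ 2 := fun i =>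
    summable_sq_norm_ite (hc i 2).summable fun k => k.2 = 0
  have hB : ∀ i, Summable fun k => ‖B i k‖ ^ 2 := fun i => by
    simpa only [B, ite_not] using summable_sq_norm_ite (hc i 2).summable fun k => ¬ k.2 = 0
  refine ⟨fun p i => (waves2.sum (volume.restrict (plate S)) (b i) p).re,
    fun p i j => (waves2.sum (volume.restrict (plate S)) (b' i j) p).re,
    fun p i => (waves2.sum (volume.restrict (plate S)) (fun k => c i 2 (k, 0)) p).re,
    fun p i => (waves3.sum (volume.restrict (plate S)) (B i) p).re,
    ?_, fun i => memLp_re_sum _ _, fun i => ?_, fun i => memLp_re_sum _ _, ?_, ?_⟩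
  · refine isL2PeriodicH1_sum isCell_cell2 waves2 waves2_wave freq2_integral hb hb' fun i j k => ?_
    rw [freq2_e2]
    by_cases hk : k = 0
    · simp [b', hk]
    · rw [hbk i k hk, smul_potential hk (hcurl i k) j]
      simp [b', hk]
  · refine hasWeakDeriv_sum (isOpen_plate hS).measurableSet (e3 2) (hb i) (hc0 i 2) fun k => ?_
    by_cases hk : k = 0
    · rw [hk, hb0]
      exact hF i
    · rw [hbk i k hk]
      exact hvert i k hk
  · rw [volume_restrict_prod]
    exact ae_all_iff.2 fun i => integral_sum_last_eq_zero (hB i) fun k hk => by simp [B, hk]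
  · intro i j
    refine (hc i j).twoScale _ ?_
    rw [volume_restrict_prod]
    have hcol : ∀ j : Fin 2, ∀ᵐ p ∂((volume.restrict (plate S)).prod (volume.restrict cell3)),
        (waves3.sum (volume.restrict (plate S)) (c i (Fin.castSucc j)) p).re
          = D p.1.1 i j + (waves2.sum (volume.restrict (plate S)) (b' i j) (p.1, p.2.1)).re := by
      intro j
      filter_upwards [lift_sum (hc i (Fin.castSucc j)).summable (hzero i j),
        ae_plate_prod (hD i j),
        measurePreserving_dropLast.quasiMeasurePreserving.ae
          (waves2.sum_eq_mode_add (hc0 i (Fin.castSucc j)) waves2_wave_zero)] with p h1 h2 h3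
      rw [h1, h3, Complex.add_re]
      exact congrArg (· + _) h2
    have hlast : ∀ᵐ p ∂((volume.restrict (plate S)).prod (volume.restrict cell3)),
        (waves3.sum (volume.restrict (plate S)) (c i 2) p).re
          = (waves2.sum (volume.restrict (plate S)) (fun k => c i 2 (k, 0)) (p.1, p.2.1)).re
            + (waves3.sum (volume.restrict (plate S)) (B i) p).re := by
      filter_upwards [waves3.sum_eq_add_ite (hc i 2).summable fun k => k.2 = 0,
        lift_sum (hA i) fun k hk => by simp [A, hk]] with p h1 h2
      rw [h1, Complex.add_re]
      refine congrArg (· + _) ((congrArg Complex.re h2).trans ?_)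
      simp [A]
    filter_upwards [hcol 0, hcol 1, hlast] with p h1 h2 h3
    fin_cases j
    · refine Eq.trans ?_ h1.symm
      simp [withCol]
    · refine Eq.trans ?_ h2.symm
      simp [withCol]
    · refine Eq.trans ?_ h3.symm
      simp [withCol]

end Regimes

end ThinPlate

/-! ### The main theorem. -/

theorem mainTheorem4
    (S : Set Plane) (hS : IsOpen S)
    (u : ℝ → Space → Fin 3 → ℝ) (Du : ℝ → Space → Fin 3 → Fin 3 → ℝ)
    (ulim : Space → Fin 3 → ℝ) (Dulim : Space → Fin 3 → Fin 3 → ℝ)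
    (hweak : WeaklyConvergesH1 (plate S) u Du ulim Dulim)
    (hbdd : ∃ C : ℝ, ∀ h : ℝ, 0 < h →
      ∫ x in plate S, ∑ i, ∑ j, scaledGrad h (Du h) x i j ^ 2 ≤ C) :
    -- the limit is a function of `x'` alone
    ∃ (u0 : Plane → Fin 3 → ℝ) (Du0 : Plane → Fin 3 → Fin 2 → ℝ),
      IsH1 e2 S u0 Du0 ∧
      (∀ᵐ x ∂(volume.restrict (plate S)), ulim x = u0 x.1) ∧
      -- first regime; every sequence of thicknesses has a good subsequence
      (∀ α : ℝ, 0 < α →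
        ∀ t : ℕ → ℝ, (∀ n, 0 < t n) → Tendsto t atTop (𝓝 0) →
        ∃ (k : ℕ → ℕ) (u1 : Space → Fin 3 → ℝ) (D3u1 : Space → Fin 3 → ℝ)
          (u2 : Space × Space → Fin 3 → ℝ) (Dyu2 : Space × Space → Fin 3 → Fin 3 → ℝ),
          StrictMono k ∧
          (∀ i, MemLp (fun x => u1 x i) 2 (volume.restrict (plate S))) ∧
          (∀ i, MemLp (fun x => D3u1 x i) 2 (volume.restrict (plate S))) ∧
          (∀ i, HasWeakDeriv (plate S) (e3 2) (fun x => u1 x i) (fun x => D3u1 x i)) ∧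
          IsL2PeriodicH1 (plate S) e3 cell3 u2 Dyu2 ∧
          TwoScaleConvergesMatrix (plate S)
            (fun n => t (k n) ^ (α + 1)) (fun n => t (k n) ^ α)
            (fun n => scaledGrad (t (k n)) (Du (t (k n))))
            (fun p => withCol (Du0 p.1.1) (D3u1 p.1) + Dyu2 p)) ∧
      -- second regime
      (∀ ε₁ ε₂ : ℝ → ℝ, (∀ h, 0 < h → 0 < ε₁ h) → (∀ h, 0 < h → 0 < ε₂ h) →
        Tendsto (fun h => h / ε₁ h) (𝓝[>] 0) (𝓝 1) → Tendsto ε₂ (𝓝[>] 0) (𝓝 0) →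
        ∀ t : ℕ → ℝ, (∀ n, 0 < t n) → Tendsto t atTop (𝓝 0) →
        ∃ (k : ℕ → ℕ) (u1 : Space × Plane → Fin 3 → ℝ)
          (Dyu1 : Space × Plane → Fin 3 → Fin 2 → ℝ) (D3u1 : Space × Plane → Fin 3 → ℝ)
          (d : Space × Space → Fin 3 → ℝ),
          StrictMono k ∧
          IsL2PeriodicH1 (plate S) e2 cell2 u1 Dyu1 ∧
          (∀ i, MemLp (fun p => D3u1 p i) 2 (volume.restrict (plate S ×ˢ cell2))) ∧
          (∀ i, HasWeakDeriv (plate S ×ˢ interior cell2) (e3 2, 0)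
            (fun p => u1 p i) (fun p => D3u1 p i)) ∧
          (∀ i, MemLp (fun p => d p i) 2 (volume.restrict (plate S ×ˢ cell3))) ∧
          (∀ᵐ q ∂(volume.restrict (plate S ×ˢ cell2)), ∀ i,
            ∫ s in Ico (0 : ℝ) 1, d (q.1, (q.2, s)) i = 0) ∧
          TwoScaleConvergesMatrix (plate S)
            (fun n => ε₁ (t (k n))) (fun n => ε₂ (t (k n)))
            (fun n => scaledGrad (t (k n)) (Du (t (k n))))
            (fun p => withCol (Du0 p.1.1) 0
              + withCol (Dyu1 (p.1, p.2.1)) (D3u1 (p.1, p.2.1))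
              + withCol 0 (d p))) := by
  obtain ⟨u0, Du0, hu0, hlim, hgrad⟩ := exists_planar hS hweak.mem_lim fun i φ h1 h2 h3 =>
    integral_vertical_eq_zero hweak hbdd i ⟨h1, h2, h3⟩
  have hΩ := isOpen_plate hS
  have hmean : ∀ {t : ℕ → ℝ} {ε₁ ε₂ : ℕ → ℝ}
      {c : Fin 3 → Fin 3 → Mode → Lp ℂ 2 ((volume : Measure Space).restrict (plate S))},
      (∀ n, 0 < t n) → Tendsto t atTop (𝓝 0) →
      (∀ i j, HasModes (plate S) ε₁ ε₂ (fun n x => scaledGrad (t n) (Du (t n)) x i j) (c i j)) →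
      ∀ i j, ∀ᵐ x ∂(volume.restrict (plate S)),
        (c i (Fin.castSucc j) 0 x).re = Du0 x.1 i j := by
    intro t ε₁ ε₂ c ht ht0 hc i j
    filter_upwards [ae_zero_mode_gradient hΩ hweak ht ht0 i j (hc i _), hgrad i j] with x h1 h2
    rw [h1, h2]
  refine ⟨u0, Du0, hu0, hlim, fun α hα t ht ht0 => ?_, fun ε₁ ε₂ hε₁ hε₂ hratio hε₂0 t ht ht0 => ?_⟩
  · have hpow : ∀ β : ℝ, 0 < β → Tendsto (fun n => t n ^ β) atTop (𝓝[>] 0) := fun β hβ => by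
      have h := ht0.rpow_const (p := β) (Or.inr hβ.le)
      rw [Real.zero_rpow hβ.ne'] at h
      exact tendsto_nhdsWithin_iff.2
        ⟨h, Eventually.of_forall fun n => Real.rpow_pos_of_pos (ht n) β⟩
    obtain ⟨κ, c, hκ, hc⟩ := exists_gradient_modes hΩ hweak hbdd ht ht0 (hpow (α + 1) (by linarith))
      (hpow α hα)
    have htκ : Tendsto (t ∘ κ) atTop (𝓝 0) := ht0.comp hκ.tendsto_atTop
    obtain ⟨C, hthin⟩ := exists_thinSequence hweak hbdd (fun n => ht (κ n)) htκ
    obtain ⟨u1, D3u1, u2, Dyu2, h⟩ := exists_curl_free_limit hc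
      (fun i => (hthin i).curl_modes (hc i) hΩ
        (tendsto_inv_nhdsGT_zero.comp ((hpow (α + 1) (by linarith)).comp hκ.tendsto_atTop))
        (tendsto_inv_nhdsGT_zero.comp ((hpow α hα).comp hκ.tendsto_atTop)) fun n => by
          -- Here `1 / t ^ α = t * (1 / t ^ (α + 1))`, the exact balance `b = t a` between the two
          -- frequencies.
          have := (ht (κ n)).ne'
          simp only [Function.comp_apply, Real.rpow_add_one this]
          field_simp)
      (hmean (fun n => ht (κ n)) htκ hc)
    exact ⟨κ, u1, D3u1, u2, Dyu2, hκ, h⟩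
  · have ht' : Tendsto t atTop (𝓝[>] 0) :=
      tendsto_nhdsWithin_iff.2 ⟨ht0, Eventually.of_forall ht⟩
    have hr : Tendsto (fun n => t n * (ε₁ (t n))⁻¹) atTop (𝓝 1) := hratio.comp ht'
    have h1 : Tendsto (fun n => ε₁ (t n)) atTop (𝓝[>] 0) := by
      refine tendsto_nhdsWithin_iff.2 ⟨?_, Eventually.of_forall fun n => hε₁ _ (ht n)⟩
      -- `ε₁` is the quotient of `t` by `t / ε₁`, so it tends to `0 / 1`.
      have := ht0.div hr one_ne_zero
      rw [zero_div] at this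
      refine this.congr fun n => ?_
      have hn := (ht n).ne'
      have hn' := (hε₁ _ (ht n)).ne'
      simp only [Pi.div_apply]
      field_simp
    have h2 : Tendsto (fun n => ε₂ (t n)) atTop (𝓝[>] 0) :=
      tendsto_nhdsWithin_iff.2 ⟨hε₂0.comp ht', Eventually.of_forall fun n => hε₂ _ (ht n)⟩
    obtain ⟨κ, c, hκ, hc⟩ := exists_gradient_modes hΩ hweak hbdd ht ht0 h1 h2
    have htκ : Tendsto (t ∘ κ) atTop (𝓝 0) := ht0.comp hκ.tendsto_atTop
    obtain ⟨C, hthin⟩ := exists_thinSequence hweak hbdd (fun n => ht (κ n)) htκ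
    have a1 := tendsto_inv_nhdsGT_zero.comp (h1.comp hκ.tendsto_atTop)
    have a2 := tendsto_inv_nhdsGT_zero.comp (h2.comp hκ.tendsto_atTop)
    have a3 := hr.comp hκ.tendsto_atTop
    obtain ⟨u1, Dyu1, D3u1, d, h⟩ := exists_planar_limit hS hc
      (fun i j k hk => (hthin i).planar_modes_eq_zero (hc i) hΩ a1 a2 a3 hk j)
      (fun i k => (hthin i).planar_curl_modes (hc i) hΩ a1 a2 (k, 0))
      (fun i k hk => (hthin i).hasWeakDerivC_potential (hc i) hΩ a1 a2 a3 hk)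
      (hmean (fun n => ht (κ n)) htκ hc)
    exact ⟨κ, u1, Dyu1, D3u1, d, hκ, h⟩
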